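/- **Model.** Let $n\ge 1$, $K\ge1$. Let $\Pi\in\mathbb{R}^{n\times K}$ have nonnegative entries, row sums $1$, rank $K$, and for every $k\in[K]$ a pure row ($\Pi(i,k)=1$ for some $i$). Let $P\in\mathbb{R}^{K\times K}$ be symmetric of rank $K$ with unit diagonal, let $\theta\in\mathbb{R}^n$ have positive entries, $\Theta=\mathrm{diag}(\theta)$ and $\Omega=\Theta\Pi P\Pi'\Theta$. Let $A$ be a random symmetric $n\times n$ matrix whose entries $A(i,j)$, $i\le j$, are independent with arbitrary distributions and $\mathbb{E}[A(i,j)]=\Omega(i,j)$ for all $i,j$. **Algorithm (ScD).** Input $A$, $K$ and a tuning parameter $\delta\ge0$. (1) Let $A\hat U=\hat U\hat\Lambda$, $\hat U'\hat U=I_K$, be an eigendecomposition for the $K$ eigenvalues of $A$ of largest magnitude, and let $\hat U_*$ be $\hat U$ with every row divided by its Euclidean norm. (2) SVM-cone: let $(\hat w,\hat b)$ maximize $b$ subject to $\|w\|_2\le1$ and $\hat U_*(i,:)w\ge b$ for all $i$; cluster the rows with $\hat U_*(i,:)\hat w\le\hat b+\delta$ into $K$ clusters by $k$-means (farthest-first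 seeds, then any number of Lloyd iterations), and let $\hat{\mathcal I}$ contain one index from each cluster (any index of these rows for a cluster that is empty). (3) Put $\hat Z=\max\big(0,\hat U\,\hat U_*(\hat{\mathcal I},:)^{-1}\sqrt{\mathrm{diag}(\hat U_*(\hat{\mathcal I},:)\hat\Lambda\hat U_*(\hat{\mathcal I},:)')}\big)$. (4) Put $\hat\Pi(i,:)=\hat Z(i,:)/\|\hat Z(i,:)\|_1$. (Inverses, square roots and quotients that are undefined are read as $0$; ties are broken arbitrarily.) **Theorem.** Fix constants $K_0\in\mathbb N$, $\kappa_0,B,C_1\in\mathbb R$, $c_0,c_1>0$ and $D\ge0$. There are a constant $C$ and a sequence $\varepsilon_n=o(n^{-5})$, depending only on these constants, such that the following holds for every $n$ and every model as above. Let $\tau,\gamma$ be finite numbers with $|A(i,j)-\Omega(i,j)|\le\tau$ almost surely and $\mathrm{Var}(A(i,j))/(\theta(i)\theta(j))\le\gamma$ for all $i,j$, and let $\rho>0$. Suppose that $$\gamma\,\theta_{\max}\|\theta\|_1\ge\tau^2\log n,$$ that $K\le K_0$, $\kappa(P)=\sigma_1(P)/\sigma_K(P)\le\kappa_0$, $\max_{k,l}|P(k,l)|\le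 B$, that the smallest eigenvalue satisfies $\lambda_K(\Pi'\Pi)\ge c_0 n/K$, and that $c_1\sqrt\rho\le\theta(i)\le C_1\sqrt\rho$ for all $i$. Put $r=\dfrac{\sqrt{\gamma\log n}}{\sigma_K(P)\sqrt{\rho n}}$. Then with probability at least $1-\varepsilon_n$: for every $\delta\in[0,Dr]$ the algorithm has an output, and for every output $\hat\Pi$ of ScD with parameter $\delta$ there is a $K\times K$ permutation matrix $\mathcal P$ with $$\max_{i\in[n]}\|e_i'(\hat\Pi-\Pi\mathcal P)\|_1\le C\,r.$$ -/

import Mathlib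

open MeasureTheory ProbabilityTheory

noncomputable section

/-! ### Matrix notions -/

/-- The `k`-th largest singular value of a real matrix (`k ≥ 1`). -/
def sval {m n : ℕ} (M : Matrix (Fin m) (Fin n) ℝ) (k : ℕ) : ℝ :=
  (Matrix.toEuclideanLin M).singularValues (k - 1)

/-- The condition number `σ₁(M) / σ_K(M)` of a `K × K` matrix. -/
def condNumber {K : ℕ} (M : Matrix (Fin K) (Fin K) ℝ) : ℝ :=
  sval M 1 / sval M K

/-- The `i`-th row of a matrix as a point of Euclidean space. -/
def rowVec {n K : ℕ} (M : Matrix (Fin n) (Fin K) ℝ) (i : Fin n) : EuclideanSpace ℝ (Fin K) :=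
  WithLp.toLp 2 (M i)

/-- Row normalization with respect to the Euclidean norm. -/
def rowNormalize {n K : ℕ} (M : Matrix (Fin n) (Fin K) ℝ) : Matrix (Fin n) (Fin K) ℝ :=
  Matrix.of fun i k => M i k / ‖rowVec M i‖

/-! ### The DCMMDF model -/

/-- The mean matrix `Θ Π P Π' Θ`. -/
def meanMatrix {n K : ℕ} (Pi : Matrix (Fin n) (Fin K) ℝ) (P : Matrix (Fin K) (Fin K) ℝ)
    (θ : Fin n → ℝ) : Matrix (Fin n) (Fin n) ℝ :=
  Matrix.diagonal θ * Pi * P * Pi.transpose * Matrix.diagonal θ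

/-- The random matrix `A` follows the degree-corrected mixed membership distribution-free model
with membership matrix `Pi`, connectivity matrix `P` and heterogeneity vector `θ`. -/
structure IsDCMMDF {S : Type*} [MeasurableSpace S] (μ : Measure S) {n K : ℕ}
    (Pi : Matrix (Fin n) (Fin K) ℝ) (P : Matrix (Fin K) (Fin K) ℝ) (θ : Fin n → ℝ)
    (A : S → Matrix (Fin n) (Fin n) ℝ) : Prop where
  rank_Pi : Pi.rank = K
  Pi_nonneg : ∀ i k, 0 ≤ Pi i k
  Pi_sum : ∀ i, ∑ k, Pi i k = 1
  pure_node : ∀ k, ∃ i, Pi i k = 1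
  P_symm : P.transpose = P
  rank_P : P.rank = K
  P_diag : ∀ k, P k k = 1
  θ_pos : ∀ i, 0 < θ i
  A_symm : ∀ s, (A s).transpose = A s
  measurable : ∀ i j, Measurable fun s => A s i j
  indep : iIndepFun (fun (p : {p : Fin n × Fin n // p.1 ≤ p.2}) s => A s p.1.1 p.1.2) μ
  integrable : ∀ i j, Integrable (fun s => A s i j) μ
  mean : ∀ i j, ∫ s, A s i j ∂μ = meanMatrix Pi P θ i j

/-! ### One-class SVM and k-means -/

/-- `(w, b)` solves the one-class SVM problem for the points `x i`:
maximize `b` subject to `‖w‖ ≤ 1` and `⟪w, x i⟫ ≥ b` for all `i`. -/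
structure IsOneClassSVM {n K : ℕ} (x : Fin n → EuclideanSpace ℝ (Fin K))
    (w : EuclideanSpace ℝ (Fin K)) (b : ℝ) : Prop where
  norm_le : ‖w‖ ≤ 1
  le_inner : ∀ i, b ≤ inner ℝ w (x i)
  optimal : ∀ (w' : EuclideanSpace ℝ (Fin K)) (b' : ℝ),
    ‖w'‖ ≤ 1 → (∀ i, b' ≤ inner ℝ w' (x i)) → b' ≤ b

/-- Indices of the points at distance at most `δ` beyond the hyperplane `⟪w, ·⟫ = b`. -/
def nearHyperplane {n K : ℕ} (x : Fin n → EuclideanSpace ℝ (Fin K))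
    (w : EuclideanSpace ℝ (Fin K)) (b δ : ℝ) : Finset (Fin n) :=
  {i | inner ℝ w (x i) ≤ b + δ}

/-- Farthest-first seeds in `N`: the first seed is arbitrary, and every further seed maximizes,
over `N`, the distance to the set of the earlier seeds. -/
def IsFarthestFirst {n K : ℕ} (x : Fin n → EuclideanSpace ℝ (Fin K)) (N : Finset (Fin n))
    (s : Fin K → Fin n) : Prop :=
  ∀ k, s k ∈ N ∧ ∀ i ∈ N, Metric.infDist (x i) {y | ∃ j < k, y = x (s j)} ≤
    Metric.infDist (x (s k)) {y | ∃ j < k, y = x (s j)}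

/-- The labelling `c` sends each point of `N` to a nearest center. -/
def IsNearestLabelling {n K : ℕ} (x : Fin n → EuclideanSpace ℝ (Fin K)) (N : Finset (Fin n))
    (m : Fin K → EuclideanSpace ℝ (Fin K)) (c : Fin n → Fin K) : Prop :=
  ∀ i ∈ N, ∀ k, dist (x i) (m (c i)) ≤ dist (x i) (m k)

/-- The centroids of the clusters of `N`; an empty cluster keeps its old center. -/
def centroids {n K : ℕ} (x : Fin n → EuclideanSpace ℝ (Fin K)) (N : Finset (Fin n))
    (m : Fin K → EuclideanSpace ℝ (Fin K)) (c : Fin n → Fin K) :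
    Fin K → EuclideanSpace ℝ (Fin K) :=
  fun k => if (N.filter fun i => c i = k).Nonempty then
      ((N.filter fun i => c i = k).card : ℝ)⁻¹ • ∑ i ∈ N.filter (fun i => c i = k), x i
    else m k

/-- The centers that occur in a run of Lloyd's iteration on `N` from farthest-first seeds. -/
inductive IsKMeansCenters {n K : ℕ} (x : Fin n → EuclideanSpace ℝ (Fin K))
    (N : Finset (Fin n)) : (Fin K → EuclideanSpace ℝ (Fin K)) → Prop
  | seed (s : Fin K → Fin n) (hs : IsFarthestFirst x N s) : IsKMeansCenters x N (fun k => x (s k))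
  | step (m : Fin K → EuclideanSpace ℝ (Fin K)) (c : Fin n → Fin K)
      (hm : IsKMeansCenters x N m) (hc : IsNearestLabelling x N m c) :
      IsKMeansCenters x N (centroids x N m c)

/-- `c` is a clustering of `N` into `K` clusters returned by k-means (farthest-first seeding,
then any number of Lloyd iterations). -/
def IsKMeans {n K : ℕ} (x : Fin n → EuclideanSpace ℝ (Fin K)) (N : Finset (Fin n))
    (c : Fin n → Fin K) : Prop :=
  ∃ m, IsKMeansCenters x N m ∧ IsNearestLabelling x N m c

/-- `I` is an output of the SVM-cone algorithm with `K` corners and distance parameter `δ` on the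
points `x i`: run the one-class SVM, cluster the points near the hyperplane into `K` clusters by
k-means, pick one point of each cluster (any point near the hyperplane if a cluster is empty). -/
def IsSVMCone {n K : ℕ} (x : Fin n → EuclideanSpace ℝ (Fin K)) (δ : ℝ)
    (I : Fin K → Fin n) : Prop :=
  ∃ (w : EuclideanSpace ℝ (Fin K)) (b : ℝ) (c : Fin n → Fin K),
    IsOneClassSVM x w b ∧ IsKMeans x (nearHyperplane x w b δ) c ∧
    ∀ k, I k ∈ nearHyperplane x w b δ ∧
      ((∃ i ∈ nearHyperplane x w b δ, c i = k) → c (I k) = k)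

/-! ### The ScD algorithm -/

/-- `U` (orthonormal columns) and `lam` form a leading-`K` eigendecomposition of the symmetric
matrix `A`, eigenvalues being ordered by decreasing magnitude. -/
structure IsLeadingEigen {n K : ℕ} (A : Matrix (Fin n) (Fin n) ℝ)
    (U : Matrix (Fin n) (Fin K) ℝ) (lam : Fin K → ℝ) : Prop where
  orthonormal : U.transpose * U = 1
  eigen : A * U = U * Matrix.diagonal lam
  ordered : Antitone fun k => |lam k|
  leading : ∀ (v : Fin n → ℝ) (ν : ℝ), v ≠ 0 → A.mulVec v = ν • v → U.transpose.mulVec v = 0 →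
    ∀ k, |ν| ≤ |lam k|

/-- `max(0, U U_*(I,:)⁻¹ √diag(U_*(I,:) Λ U_*(I,:)'))`, where `U_*` is the row-normalized `U`. -/
def zMatrix {n K : ℕ} (U : Matrix (Fin n) (Fin K) ℝ) (lam : Fin K → ℝ) (I : Fin K → Fin n) :
    Matrix (Fin n) (Fin K) ℝ :=
  let V : Matrix (Fin K) (Fin K) ℝ := (rowNormalize U).submatrix I id
  (U * V⁻¹ * Matrix.diagonal fun k =>
    Real.sqrt ((V * Matrix.diagonal lam * V.transpose) k k)).map fun t => max 0 t

/-- `Pihat` is an output of the ScD algorithm with input `A`, `K` and SVM-cone distance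
parameter `δ`. -/
def IsScD {n K : ℕ} (A : Matrix (Fin n) (Fin n) ℝ) (δ : ℝ)
    (Pihat : Matrix (Fin n) (Fin K) ℝ) : Prop :=
  ∃ (U : Matrix (Fin n) (Fin K) ℝ) (lam : Fin K → ℝ) (I : Fin K → Fin n),
    IsLeadingEigen A U lam ∧ IsSVMCone (rowVec (rowNormalize U)) δ I ∧
    ∀ i k, Pihat i k = zMatrix U lam I i k / ∑ l, |zMatrix U lam I i l|

/-- The rate `√(γ log n) / (σ_K(P) √(ρ n))`. -/
def scdRate (n : ℕ) {K : ℕ} (P : Matrix (Fin K) (Fin K) ℝ) (γ ρ : ℝ) : ℝ :=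
  Real.sqrt (γ * Real.log n) / (sval P K * Real.sqrt (ρ * n))

end

/-! ### Trace inequalities and a matrix Khintchine inequality -/

section TraceInequalities

set_option linter.unusedSectionVars false

open Matrix

variable {ι : Type*} [Fintype ι] [DecidableEq ι]

/-! Divide `A` by `ρn`. With `F = diag(θ/√ρ) Π` it becomes `n⁻¹ F P F' + W`, where `F` and `P` are
well conditioned by assumption and `W` is a noise matrix whose size `ζ` is of the order of the rate.
If `u` is a leading unit eigenvector with eigenvalue `λ` and `t = 1/λ`, then `(1 - tW) u = t n⁻¹ F P
F' u`, that is, `√n u = (1 - tW)⁻¹ F h` for some bounded vector `h`. Hence it suffices that the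
resolvent moves every entry of every column of `F` by `O(ζ)`, uniformly over bounded `t`: then `√n
U` is `F H` up to `O(ζ)` in each entry. No gap between the leading eigenvalues and no alignment with
population eigenvectors is needed (`IsFactorModel.eigenvector_structure`).

The resolvent is controlled by leaving one vertex out (`resolvent_entrywise`). After row and column
`i` of the noise are deleted, the resolvent no longer depends on row `i`, so its inner product with
that row obeys Bernstein's inequality; restoring the row costs a lower order term because the
spectral norm of `W` is small. A grid of values of `t` makes the estimate uniform. The spectral norm
is bounded by `√(V n log n)` up to a constant (`measure_spectral_norm_gt_le`): symmetrization, a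
Khintchine inequality for traces of even powers of order `log n`, and an exponential moment of the
row sums of squares.

The rest is deterministic. Orthonormality of `U` makes `H` invertible, and with `J` its inverse
transpose, `J J'` is close to `F'F/n`, which has nonnegative entries. So the normalized rows of `U`
lie near a simplicial cone whose dual vectors have almost nonnegative inner products. This is what
makes the SVM hyperplane touch every corner, and only near corners (`IsConeFrame.svm_near_corners`);
farthest-first k-means then separates the corners (`IsSeparated.exists_perm`). Expanding the rows of
`U` in the selected rows gives the memberships up to column scales, which the square root of the
diagonal corrects because `H Λ H'` is close to `P` and `P` has unit diagonal (`recovery`).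

All this needs `ζ` below a constant. For larger `ζ` the claimed bound exceeds `2`, which the error
never does. -/

theorem Matrix.IsHermitian.exists_orthogonal_diagonal {M : Matrix ι ι ℝ} (hM : M.IsHermitian) :
    ∃ (U : Matrix ι ι ℝ) (d : ι → ℝ), Uᵀ * U = 1 ∧ U * Uᵀ = 1 ∧ M = U * diagonal d * Uᵀ := by
  refine ⟨hM.eigenvectorUnitary, hM.eigenvalues, ?_, ?_, ?_⟩
  · have := Unitary.coe_star_mul_self hM.eigenvectorUnitary
    rwa [star_eq_conjTranspose, conjTranspose_eq_transpose_of_trivial] at this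
  · have := Unitary.coe_mul_star_self hM.eigenvectorUnitary
    rwa [Unitary.coe_star, star_eq_conjTranspose, conjTranspose_eq_transpose_of_trivial] at this
  · have := hM.spectral_theorem
    rw [Unitary.conjStarAlgAut_apply, star_eq_conjTranspose,
      conjTranspose_eq_transpose_of_trivial] at this
    exact this

theorem orthogonal_diagonal_pow {U : Matrix ι ι ℝ} (hU : Uᵀ * U = 1) (hU' : U * Uᵀ = 1)
    (d : ι → ℝ) (k : ℕ) :
    (U * diagonal d * Uᵀ) ^ k = U * diagonal (fun i => d i ^ k) * Uᵀ := by
  induction k with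
  | zero => simp [hU']
  | succ k ih =>
    calc (U * diagonal d * Uᵀ) ^ (k + 1)
        = U * diagonal (fun i => d i ^ k) * (Uᵀ * U) * diagonal d * Uᵀ := by
          rw [pow_succ, ih]; simp only [Matrix.mul_assoc]
      _ = _ := by
          rw [hU, Matrix.mul_one, Matrix.mul_assoc U, diagonal_mul_diagonal]
          simp [pow_succ]

/-- The squared overlaps of the two eigenbases are nonnegative weights on pairs of eigenvalues, so a
scalar inequality in `a` and `b` transfers to traces of noncommuting matrices. -/
theorem trace_pow_mul_pow {U V : Matrix ι ι ℝ} (hU : Uᵀ * U = 1) (hU' : U * Uᵀ = 1)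
    (hV : Vᵀ * V = 1) (hV' : V * Vᵀ = 1) (a b : ι → ℝ) (k l : ℕ) :
    ((U * diagonal a * Uᵀ) ^ k * (V * diagonal b * Vᵀ) ^ l).trace =
      ∑ i, ∑ j, a i ^ k * b j ^ l * (Uᵀ * V) i j ^ 2 := by
  rw [orthogonal_diagonal_pow hU hU', orthogonal_diagonal_pow hV hV']
  have h1 : U * diagonal (fun i => a i ^ k) * Uᵀ * (V * diagonal (fun i => b i ^ l) * Vᵀ) =
      U * (diagonal (fun i => a i ^ k) * (Uᵀ * V) * diagonal (fun i => b i ^ l) * Vᵀ) := by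
    simp only [Matrix.mul_assoc]
  have h2 : diagonal (fun i => a i ^ k) * (Uᵀ * V) * diagonal (fun i => b i ^ l) * Vᵀ * U =
      diagonal (fun i => a i ^ k) * (Uᵀ * V) * diagonal (fun i => b i ^ l) * (Uᵀ * V)ᵀ := by
    rw [transpose_mul, transpose_transpose]; simp only [Matrix.mul_assoc]
  rw [h1, trace_mul_comm, h2, Matrix.trace]
  refine Finset.sum_congr rfl fun i _ => ?_
  rw [diag_apply, Matrix.mul_apply]
  refine Finset.sum_congr rfl fun j _ => ?_
  rw [mul_diagonal, diagonal_mul, transpose_apply]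
  ring

/-- For nonnegative numbers this is `(x^q - y^q)(x^s - y^s) ≥ 0`; the even total degree allows
passing to absolute values. -/
theorem pow_mul_pow_add_le (a b : ℝ) (q s : ℕ) (h : Even (q + s)) :
    a ^ q * b ^ s + a ^ s * b ^ q ≤ a ^ (q + s) + b ^ (q + s) := by
  have key : ∀ x y : ℝ, 0 ≤ x → 0 ≤ y →
      x ^ q * y ^ s + x ^ s * y ^ q ≤ x ^ (q + s) + y ^ (q + s) := by
    intro x y hx hy
    have : 0 ≤ (x ^ q - y ^ q) * (x ^ s - y ^ s) := by
      rcases le_total x y with hxy | hxy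
      · exact mul_nonneg_of_nonpos_of_nonpos (sub_nonpos.2 (pow_le_pow_left₀ hx hxy _))
          (sub_nonpos.2 (pow_le_pow_left₀ hx hxy _))
      · exact mul_nonneg (sub_nonneg.2 (pow_le_pow_left₀ hy hxy _))
          (sub_nonneg.2 (pow_le_pow_left₀ hy hxy _))
    rw [pow_add, pow_add]
    linarith
  calc a ^ q * b ^ s + a ^ s * b ^ q ≤ |a| ^ q * |b| ^ s + |a| ^ s * |b| ^ q := by
        refine add_le_add ?_ ?_ <;>
        · rw [← abs_pow, ← abs_pow, ← abs_mul]; exact le_abs_self _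
    _ ≤ |a| ^ (q + s) + |b| ^ (q + s) := key _ _ (abs_nonneg a) (abs_nonneg b)
    _ = _ := by rw [h.pow_abs, h.pow_abs]

/-- The second factor is `(a - b)` times a geometric sum of `2m + 1` terms. Pairing each term with
its mirror image bounds each pair by `a^(2m) + b^(2m)`, whence the factor `(2m + 1)/2`. -/
theorem sub_mul_pow_sub_pow_le (a b : ℝ) (m : ℕ) :
    (a - b) * (a ^ (2 * m + 1) - b ^ (2 * m + 1)) ≤
      (2 * m + 1) / 2 * ((a - b) ^ 2 * (a ^ (2 * m) + b ^ (2 * m))) := by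
  have h1 := Commute.geom_sum₂_mul (Commute.all a b) (2 * m + 1)
  have h2 : ∑ i ∈ Finset.range (2 * m + 1), a ^ i * b ^ (2 * m + 1 - 1 - i) ≤
      (2 * m + 1) / 2 * (a ^ (2 * m) + b ^ (2 * m)) := by
    have hr : ∑ i ∈ Finset.range (2 * m + 1), a ^ i * b ^ (2 * m + 1 - 1 - i) =
        ∑ i ∈ Finset.range (2 * m + 1), a ^ (2 * m + 1 - 1 - i) * b ^ i := by
      rw [← Finset.sum_range_reflect]
      refine Finset.sum_congr rfl fun i hi => ?_
      have := Finset.mem_range.1 hi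
      congr 2; omega
    have h3 : ∑ i ∈ Finset.range (2 * m + 1), (a ^ i * b ^ (2 * m + 1 - 1 - i) +
        a ^ (2 * m + 1 - 1 - i) * b ^ i) ≤
        ∑ i ∈ Finset.range (2 * m + 1), (a ^ (2 * m) + b ^ (2 * m)) := by
      refine Finset.sum_le_sum fun i hi => ?_
      have hi' := Finset.mem_range.1 hi
      have e : i + (2 * m + 1 - 1 - i) = 2 * m := by omega
      have := pow_mul_pow_add_le a b i (2 * m + 1 - 1 - i) (by rw [e]; exact even_two_mul m)
      rwa [e] at this
    rw [Finset.sum_add_distrib, ← hr, Finset.sum_const, Finset.card_range, nsmul_eq_mul] at h3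
    rw [Nat.cast_add, Nat.cast_mul, Nat.cast_ofNat, Nat.cast_one] at h3
    linarith
  calc (a - b) * (a ^ (2 * m + 1) - b ^ (2 * m + 1))
      = (a - b) ^ 2 * ∑ i ∈ Finset.range (2 * m + 1), a ^ i * b ^ (2 * m + 1 - 1 - i) := by
        rw [← h1]; ring
    _ ≤ (a - b) ^ 2 * ((2 * m + 1) / 2 * (a ^ (2 * m) + b ^ (2 * m))) := by gcongr
    _ = _ := by ring

theorem trace_sub_mul_pow_sub_pow_le {M N : Matrix ι ι ℝ} (hM : M.IsHermitian)
    (hN : N.IsHermitian) (m : ℕ) :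
    ((M - N) * (M ^ (2 * m + 1) - N ^ (2 * m + 1))).trace ≤
      (2 * m + 1) / 2 * ((M - N) ^ 2 * (M ^ (2 * m) + N ^ (2 * m))).trace := by
  -- Cyclicity of the trace turns both sides into combinations of `tr(M^k N^l)`, to which the
  -- eigenvalue formula applies.
  have eL : ((M - N) * (M ^ (2 * m + 1) - N ^ (2 * m + 1))).trace =
      (M ^ (2 * m + 2) * N ^ 0).trace - (M ^ 1 * N ^ (2 * m + 1)).trace -
      (M ^ (2 * m + 1) * N ^ 1).trace + (M ^ 0 * N ^ (2 * m + 2)).trace := by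
    have : (M - N) * (M ^ (2 * m + 1) - N ^ (2 * m + 1)) =
        M ^ (2 * m + 2) * N ^ 0 - M ^ 1 * N ^ (2 * m + 1) - N * M ^ (2 * m + 1) +
        M ^ 0 * N ^ (2 * m + 2) := by
      rw [pow_succ' M (2 * m + 1), pow_succ' N (2 * m + 1)]
      noncomm_ring
    rw [this, trace_add, trace_sub, trace_sub, trace_mul_comm N, pow_one N]
  have eR : ((M - N) ^ 2 * (M ^ (2 * m) + N ^ (2 * m))).trace =
      (M ^ (2 * m + 2) * N ^ 0).trace - 2 * (M ^ (2 * m + 1) * N ^ 1).trace +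
      (M ^ (2 * m) * N ^ 2).trace + (M ^ 2 * N ^ (2 * m)).trace -
      2 * (M ^ 1 * N ^ (2 * m + 1)).trace + (M ^ 0 * N ^ (2 * m + 2)).trace := by
    have : (M - N) ^ 2 * (M ^ (2 * m) + N ^ (2 * m)) =
        M ^ (2 * m + 2) * N ^ 0 - M * (N * M ^ (2 * m)) - N * M ^ (2 * m + 1) +
        N ^ 2 * M ^ (2 * m) + M ^ 2 * N ^ (2 * m) - M * N ^ (2 * m + 1)
        - N * (M * N ^ (2 * m)) + M ^ 0 * N ^ (2 * m + 2) := by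
      rw [show 2 * m + 2 = (2 * m + 1) + 1 from rfl, pow_succ' M (2 * m + 1),
        pow_succ' N (2 * m + 1), pow_succ' M (2 * m), pow_succ' N (2 * m)]
      noncomm_ring
    rw [this]
    simp only [trace_add, trace_sub]
    have a1 : (M * (N * M ^ (2 * m))).trace = (M ^ (2 * m + 1) * N ^ 1).trace := by
      rw [trace_mul_comm, Matrix.mul_assoc, trace_mul_comm, ← pow_succ, pow_one]
    have a2 : (N * M ^ (2 * m + 1)).trace = (M ^ (2 * m + 1) * N ^ 1).trace := by
      rw [trace_mul_comm, pow_one]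
    have a3 : (N ^ 2 * M ^ (2 * m)).trace = (M ^ (2 * m) * N ^ 2).trace := trace_mul_comm _ _
    have a4 : (N * (M * N ^ (2 * m))).trace = (M ^ 1 * N ^ (2 * m + 1)).trace := by
      rw [trace_mul_comm, Matrix.mul_assoc, ← pow_succ, pow_one]
    rw [a1, a2, a3, a4, pow_one M]
    ring
  obtain ⟨U, a, hU, hU', rfl⟩ := hM.exists_orthogonal_diagonal
  obtain ⟨V, b, hV, hV', rfl⟩ := hN.exists_orthogonal_diagonal
  rw [eL, eR]
  simp only [trace_pow_mul_pow hU hU' hV hV']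
  simp only [Finset.mul_sum, ← Finset.sum_add_distrib, ← Finset.sum_sub_distrib]
  refine Finset.sum_le_sum fun i _ => Finset.sum_le_sum fun j _ => ?_
  have := mul_le_mul_of_nonneg_right (sub_mul_pow_sub_pow_le (a i) (b j) m)
    (sq_nonneg ((Uᵀ * V) i j))
  refine le_trans (le_of_eq ?_) (this.trans (le_of_eq ?_)) <;> ring

theorem diag_pow_two_mul_nonneg {M : Matrix ι ι ℝ} (hM : M.IsHermitian) (m : ℕ) (i : ι) :
    0 ≤ (M ^ (2 * m)) i i := by
  have h : (M ^ m)ᵀ = M ^ m := by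
    rw [transpose_pow]; congr 1
  rw [two_mul, pow_add, Matrix.mul_apply]
  refine Finset.sum_nonneg fun j _ => ?_
  rw [← h, transpose_apply, h]
  exact mul_self_nonneg _

/-- The form is at most the largest `|a i|`, whose `2p`-th power is one of the nonnegative terms of
the trace. -/
theorem sq_eigenvalue_bound {M : Matrix ι ι ℝ} (hM : M.IsHermitian) (p : ℕ) (hp : p ≠ 0)
    (x y : ι → ℝ) (hx : x ⬝ᵥ x ≤ 1) (hy : y ⬝ᵥ y ≤ 1) :
    (y ⬝ᵥ M *ᵥ x) ^ (2 * p) ≤ (M ^ (2 * p)).trace := by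
  obtain ⟨U, a, hU, hU', rfl⟩ := hM.exists_orthogonal_diagonal
  have htr : ((U * diagonal a * Uᵀ) ^ (2 * p)).trace = ∑ i, a i ^ (2 * p) := by
    rw [orthogonal_diagonal_pow hU hU', trace_mul_comm, ← Matrix.mul_assoc, hU, Matrix.one_mul,
      trace_diagonal]
  rw [htr]
  set x' := Uᵀ *ᵥ x with hx'
  set y' := Uᵀ *ᵥ y with hy'
  have e : y ⬝ᵥ (U * diagonal a * Uᵀ) *ᵥ x = ∑ i, a i * (y' i * x' i) := by
    rw [Matrix.mul_assoc, ← mulVec_mulVec, ← mulVec_mulVec, dotProduct_mulVec, ← mulVec_transpose]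
    simp only [dotProduct, mulVec_diagonal, ← hx', ← hy']
    exact Finset.sum_congr rfl fun i _ => by ring
  have nx : ∑ i, x' i ^ 2 ≤ 1 := by
    have : ∑ i, x' i ^ 2 = x ⬝ᵥ x := by
      have : ∑ i, x' i ^ 2 = x' ⬝ᵥ x' := by simp [dotProduct, sq]
      rw [this, hx', dotProduct_mulVec, vecMul_transpose, mulVec_mulVec, hU', one_mulVec]
    rwa [this]
  have ny : ∑ i, y' i ^ 2 ≤ 1 := by
    have : ∑ i, y' i ^ 2 = y ⬝ᵥ y := by
      have : ∑ i, y' i ^ 2 = y' ⬝ᵥ y' := by simp [dotProduct, sq]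
      rw [this, hy', dotProduct_mulVec, vecMul_transpose, mulVec_mulVec, hU', one_mulVec]
    rwa [this]
  rw [e]
  rcases isEmpty_or_nonempty ι with hι | hι
  · simp [hp]
  obtain ⟨i₀, -, hi₀⟩ := Finset.exists_max_image Finset.univ (fun i => |a i|) Finset.univ_nonempty
  have hb : |∑ i, a i * (y' i * x' i)| ≤ |a i₀| := by
    calc |∑ i, a i * (y' i * x' i)| ≤ ∑ i, |a i * (y' i * x' i)| := Finset.abs_sum_le_sum_abs _ _
      _ ≤ ∑ i, |a i₀| * ((y' i ^ 2 + x' i ^ 2) / 2) := by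
          refine Finset.sum_le_sum fun i _ => ?_
          rw [abs_mul]
          refine mul_le_mul (hi₀ i (Finset.mem_univ _)) ?_ (abs_nonneg _) (abs_nonneg _)
          rw [abs_mul]
          nlinarith [sq_nonneg (|y' i| - |x' i|), sq_abs (y' i), sq_abs (x' i)]
      _ = |a i₀| * ((∑ i, y' i ^ 2 + ∑ i, x' i ^ 2) / 2) := by
          rw [← Finset.mul_sum, ← Finset.sum_div, Finset.sum_add_distrib]
      _ ≤ |a i₀| * 1 := by gcongr; linarith
      _ = _ := mul_one _
  calc (∑ i, a i * (y' i * x' i)) ^ (2 * p) = |∑ i, a i * (y' i * x' i)| ^ (2 * p) := by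
        rw [(even_two_mul p).pow_abs]
    _ ≤ |a i₀| ^ (2 * p) := by gcongr
    _ = a i₀ ^ (2 * p) := (even_two_mul p).pow_abs _
    _ ≤ _ := Finset.single_le_sum (f := fun i => a i ^ (2 * p))
        (fun i _ => (even_two_mul p).pow_nonneg _) (Finset.mem_univ i₀)

variable {E : Type*} [Fintype E] [DecidableEq E]

/-- The signed sum `∑ e, ε e • X e`. -/
def signedSum (X : E → Matrix ι ι ℝ) (ε : E → ℤˣ) : Matrix ι ι ℝ :=
  ∑ e, ((ε e : ℤ) : ℝ) • X e

theorem signedSum_isHermitian {X : E → Matrix ι ι ℝ} (hX : ∀ e, (X e).IsHermitian) (ε : E → ℤˣ) :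
    (signedSum X ε).IsHermitian := by
  unfold signedSum IsHermitian
  rw [conjTranspose_sum]
  refine Finset.sum_congr rfl fun e _ => ?_
  rw [conjTranspose_smul, (hX e).eq]; simp

theorem signedSum_sub_flip (X : E → Matrix ι ι ℝ) (ε : E → ℤˣ) (e : E) :
    signedSum X ε - signedSum X (Function.update ε e (-ε e)) = (2 * ((ε e : ℤ) : ℝ)) • X e := by
  unfold signedSum
  rw [← Finset.sum_sub_distrib, Finset.sum_eq_single e]
  · simp only [Function.update_self, Units.val_neg, Int.cast_neg, ← sub_smul]
    congr 1; ring
  · intro b _ hb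
    simp [Function.update_of_ne hb]
  · simp

theorem sum_flip (e : E) (f : (E → ℤˣ) → ℝ) :
    ∑ ε : E → ℤˣ, f (Function.update ε e (-ε e)) = ∑ ε, f ε := by
  have hinv : Function.Involutive (fun ε : E → ℤˣ => Function.update ε e (-ε e)) := by
    intro ε
    simp
  exact Equiv.sum_comp hinv.toPerm f

/-- Split off one factor of `Y = signedSum X ε` and average each summand with the one where `ε e` is
flipped. The flip changes `Y` by `2 ε e • X e`, so the trace inequality for differences of odd
powers replaces the split-off pair by `X e * X e`. Summed over `e` these squares form a diagonal
matrix bounded by `D`. -/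
theorem sum_trace_signedSum_pow_succ_le {X : E → Matrix ι ι ℝ} (hX : ∀ e, (X e).IsHermitian)
    {d : ι → ℝ} (hd : ∑ e, X e * X e = diagonal d) {D : ℝ} (hD : ∀ i, d i ≤ D) (m : ℕ) :
    ∑ ε : E → ℤˣ, (signedSum X ε ^ (2 * (m + 1))).trace ≤
      (2 * m + 1) * D * ∑ ε : E → ℤˣ, (signedSum X ε ^ (2 * m)).trace := by
  set Y := signedSum X with hY
  have hYH : ∀ ε, (Y ε).IsHermitian := signedSum_isHermitian hX
  have h1 : ∀ ε, (Y ε ^ (2 * (m + 1))).trace =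
      ∑ e, ((ε e : ℤ) : ℝ) * (X e * Y ε ^ (2 * m + 1)).trace := by
    intro ε
    rw [show 2 * (m + 1) = (2 * m + 1) + 1 by ring, pow_succ']
    conv_lhs => enter [1, 1]; rw [hY]; unfold signedSum
    rw [Finset.sum_mul, trace_sum]
    refine Finset.sum_congr rfl fun e _ => ?_
    rw [Matrix.smul_mul, trace_smul, smul_eq_mul]
  have hsq : ∀ u : ℤˣ, ((u : ℤ) : ℝ) * ((u : ℤ) : ℝ) = 1 := by
    intro u
    rcases Int.units_eq_one_or u with h | h <;> simp [h]
  have h2 : ∀ e, ∑ ε : E → ℤˣ, ((ε e : ℤ) : ℝ) * (X e * Y ε ^ (2 * m + 1)).trace ≤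
      (2 * m + 1) * ∑ ε : E → ℤˣ, (X e * X e * Y ε ^ (2 * m)).trace := by
    intro e
    have f1 := sum_flip e (fun ε : E → ℤˣ => ((ε e : ℤ) : ℝ) * (X e * Y ε ^ (2 * m + 1)).trace)
    have f2 := sum_flip e (fun ε : E → ℤˣ => (X e * X e * Y ε ^ (2 * m)).trace)
    simp only [Function.update_self, Units.val_neg, Int.cast_neg] at f1
    have h3 : ∀ ε : E → ℤˣ, ((ε e : ℤ) : ℝ) * (X e * Y ε ^ (2 * m + 1)).trace +
        -((ε e : ℤ) : ℝ) * (X e * Y (Function.update ε e (-ε e)) ^ (2 * m + 1)).trace ≤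
        (2 * m + 1) * ((X e * X e * Y ε ^ (2 * m)).trace +
          (X e * X e * Y (Function.update ε e (-ε e)) ^ (2 * m)).trace) := by
      intro ε
      have k1 := trace_sub_mul_pow_sub_pow_le (hYH ε) (hYH (Function.update ε e (-ε e))) m
      rw [hY, signedSum_sub_flip, ← hY] at k1
      simp only [sq, Matrix.smul_mul, Matrix.mul_smul, trace_smul, smul_eq_mul, Matrix.mul_sub,
        Matrix.mul_add, trace_sub, trace_add] at k1
      have := hsq (ε e)
      set z := ((ε e : ℤ) : ℝ)
      set T := (X e * X e * Y ε ^ (2 * m)).trace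
      set T' := (X e * X e * Y (Function.update ε e (-ε e)) ^ (2 * m)).trace
      have k2 : (2 * (m : ℝ) + 1) / 2 * (2 * z * (2 * z * T) + 2 * z * (2 * z * T')) =
          2 * ((2 * m + 1) * (T + T')) := by
        linear_combination 2 * (2 * (m : ℝ) + 1) * (T + T') * this
      linarith
    have h4 := Finset.sum_le_sum fun ε (_ : ε ∈ (Finset.univ : Finset (E → ℤˣ))) => h3 ε
    rw [Finset.sum_add_distrib, ← Finset.mul_sum, Finset.sum_add_distrib, f1, f2] at h4
    linarith
  calc ∑ ε : E → ℤˣ, (Y ε ^ (2 * (m + 1))).trace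
      = ∑ e, ∑ ε : E → ℤˣ, ((ε e : ℤ) : ℝ) * (X e * Y ε ^ (2 * m + 1)).trace := by
        rw [Finset.sum_comm]; exact Finset.sum_congr rfl fun ε _ => h1 ε
    _ ≤ ∑ e, (2 * m + 1) * ∑ ε : E → ℤˣ, (X e * X e * Y ε ^ (2 * m)).trace :=
        Finset.sum_le_sum fun e _ => h2 e
    _ = (2 * m + 1) * ∑ ε : E → ℤˣ, (diagonal d * Y ε ^ (2 * m)).trace := by
        rw [← Finset.mul_sum, Finset.sum_comm]
        congr 1
        refine Finset.sum_congr rfl fun ε _ => ?_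
        rw [← hd, Finset.sum_mul, trace_sum]
    _ ≤ (2 * m + 1) * ∑ ε : E → ℤˣ, D * (Y ε ^ (2 * m)).trace := by
        gcongr with ε
        simp only [Matrix.trace, diag_apply, diagonal_mul, Finset.mul_sum]
        refine Finset.sum_le_sum fun i _ => ?_
        exact mul_le_mul_of_nonneg_right (hD i) (diag_pow_two_mul_nonneg (hYH ε) m i)
    _ = _ := by rw [← Finset.mul_sum]; ring

/-- Iterate the one-step bound down from `p`, replacing each factor `2m + 1` by `2p`. -/
theorem sum_trace_signedSum_pow_le {X : E → Matrix ι ι ℝ} (hX : ∀ e, (X e).IsHermitian)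
    {d : ι → ℝ} (hd : ∑ e, X e * X e = diagonal d) {D : ℝ} (hD0 : 0 ≤ D) (hD : ∀ i, d i ≤ D)
    (p : ℕ) :
    ∑ ε : E → ℤˣ, (signedSum X ε ^ (2 * p)).trace ≤
      (2 * p * D) ^ p * (Fintype.card (E → ℤˣ) * Fintype.card ι) := by
  have : ∀ m ≤ p, ∑ ε : E → ℤˣ, (signedSum X ε ^ (2 * m)).trace ≤
      (2 * p * D) ^ m * (Fintype.card (E → ℤˣ) * Fintype.card ι) := by
    intro m
    induction m with
    | zero => intro _; simp
    | succ m ih =>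
      intro hm
      refine (sum_trace_signedSum_pow_succ_le hX hd hD m).trans ?_
      have hm' : (m : ℝ) + 1 ≤ p := by exact_mod_cast hm
      calc (2 * m + 1) * D * ∑ ε : E → ℤˣ, (signedSum X ε ^ (2 * m)).trace
          ≤ (2 * m + 1) * D * ((2 * p * D) ^ m * (Fintype.card (E → ℤˣ) * Fintype.card ι)) := by
            gcongr; exact ih (by omega)
        _ ≤ (2 * p) * D * ((2 * p * D) ^ m * (Fintype.card (E → ℤˣ) * Fintype.card ι)) := by
            gcongr; linarith
        _ = _ := by ring
  exact this p le_rfl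

end TraceInequalities

/-! ### The spectral norm of a symmetric random matrix with independent entries -/

section EdgeMatrices

open Matrix

/-- The unordered pairs of indices. -/
abbrev Edge (n : ℕ) := {p : Fin n × Fin n // p.1 ≤ p.2}

/-- The unordered pair of `i` and `j`. -/
def mkEdge {n : ℕ} (i j : Fin n) : Edge n := ⟨(min i j, max i j), min_le_max⟩

theorem mkEdge_comm {n : ℕ} (i j : Fin n) : mkEdge i j = mkEdge j i := by
  simp [mkEdge, min_comm, max_comm]

theorem mkEdge_left_injective {n : ℕ} (j : Fin n) : Function.Injective fun i => mkEdge i j := by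
  intro i k h
  simp only [mkEdge, Subtype.mk.injEq, Prod.mk.injEq] at h
  obtain ⟨h1, h2⟩ := h
  rcases le_total i j with a | a <;> rcases le_total k j with b | b <;>
    simp only [min_eq_left, min_eq_right, max_eq_left, max_eq_right, a, b] at h1 h2 <;> order

theorem mkEdge_right_injective {n : ℕ} (i : Fin n) : Function.Injective (mkEdge i) := by
  intro j k h
  apply mkEdge_left_injective i
  simpa [mkEdge_comm] using h

/-- The symmetric matrix with the given entries. -/
def symMat {n : ℕ} (x : Edge n → ℝ) : Matrix (Fin n) (Fin n) ℝ := of fun i j => x (mkEdge i j)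

theorem symMat_apply {n : ℕ} (x : Edge n → ℝ) (i j : Fin n) : symMat x i j = x (mkEdge i j) := rfl

/-- The symmetric `0`-`1` matrix supported on the edge `e`. -/
def edgeMat {n : ℕ} (e : Edge n) : Matrix (Fin n) (Fin n) ℝ :=
  of fun i j => if mkEdge i j = e then 1 else 0

theorem symMat_isHermitian {n : ℕ} (x : Edge n → ℝ) : (symMat x).IsHermitian := by
  ext i j
  simp [symMat, mkEdge_comm]

theorem edgeMat_smul_isHermitian {n : ℕ} (x : Edge n → ℝ) (e : Edge n) :
    (x e • edgeMat e).IsHermitian := by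
  ext i j
  simp [edgeMat, mkEdge_comm]

theorem signedSum_edgeMat {n : ℕ} (x : Edge n → ℝ) (ε : Edge n → ℤˣ) :
    signedSum (fun e => x e • edgeMat e) ε = symMat fun e => ((ε e : ℤ) : ℝ) * x e := by
  ext i j
  simp only [signedSum, Matrix.sum_apply, Matrix.smul_apply, edgeMat, of_apply, symMat, smul_eq_mul,
    mul_ite, mul_one, mul_zero]
  rw [Finset.sum_ite_eq]
  simp

/-- Two different vertices cannot be joined to the same `j` by the same edge, so the off-diagonal
entries vanish. -/
theorem sum_sq_edgeMat {n : ℕ} (x : Edge n → ℝ) :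
    ∑ e, (x e • edgeMat e) * (x e • edgeMat e) =
      diagonal fun i => ∑ j, x (mkEdge i j) ^ 2 := by
  ext i k
  simp only [Matrix.sum_apply, Matrix.mul_apply, Matrix.smul_apply, edgeMat, of_apply, smul_eq_mul,
    mul_ite, mul_one, mul_zero, diagonal_apply]
  rw [Finset.sum_comm]
  split_ifs with hik
  · subst hik
    refine Finset.sum_congr rfl fun j _ => ?_
    simp only [mkEdge_comm j i]
    rw [Finset.sum_eq_single (mkEdge i j)]
    · simp [sq]
    · intro b _ hb; simp [hb.symm]
    · simp
  · refine Finset.sum_eq_zero fun j _ => Finset.sum_eq_zero fun e _ => ?_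
    split_ifs with h1 h2
    · exfalso
      apply hik
      apply mkEdge_left_injective j
      simp only [h1, h2, mkEdge_comm k j]
    · simp
    · simp

theorem pow_le_factorial_mul_exp {d s : ℝ} (hd : 0 ≤ d) (hs : 0 < s) (p : ℕ) :
    d ^ p ≤ (p * s) ^ p * Real.exp (d / s) := by
  have h := Real.pow_div_factorial_le_exp (x := d / s) (by positivity) p
  have hf : ((p.factorial : ℕ) : ℝ) ≤ (p : ℝ) ^ p := by exact_mod_cast Nat.factorial_le_pow p
  rw [div_le_iff₀ (by positivity), div_pow, div_le_iff₀ (by positivity)] at h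
  calc d ^ p ≤ Real.exp (d / s) * p.factorial * s ^ p := h
    _ ≤ Real.exp (d / s) * (p : ℝ) ^ p * s ^ p := by gcongr
    _ = _ := by rw [mul_pow]; ring

/-- The Khintchine bound contains the `p`-th power of the largest row sum of squares. Trading the
power for an exponential, and the maximum for a sum over rows, leaves quantities that factorize
under independence. -/
theorem sum_sign_trace_symMat_le {n : ℕ} (x : Edge n → ℝ) (p : ℕ) {s : ℝ} (hs : 0 < s) :
    ∑ ε : Edge n → ℤˣ, (symMat (fun e => ((ε e : ℤ) : ℝ) * x e) ^ (2 * p)).trace ≤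
      Fintype.card (Edge n → ℤˣ) * (n * (2 * p ^ 2 * s) ^ p *
        ∑ i, Real.exp ((∑ j, x (mkEdge i j) ^ 2) / s)) := by
  rcases isEmpty_or_nonempty (Fin n) with hn | hn
  · simp [Matrix.trace]
  obtain ⟨i₀, -, hi₀⟩ := Finset.exists_max_image Finset.univ
    (fun i => ∑ j, x (mkEdge i j) ^ 2) Finset.univ_nonempty
  have hD0 : 0 ≤ ∑ j, x (mkEdge i₀ j) ^ 2 := Finset.sum_nonneg fun j _ => sq_nonneg _
  have h := sum_trace_signedSum_pow_le (edgeMat_smul_isHermitian x) (sum_sq_edgeMat x)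
    (D := ∑ j, x (mkEdge i₀ j) ^ 2) hD0 (fun i => hi₀ i (Finset.mem_univ _)) p
  simp only [signedSum_edgeMat, Fintype.card_fin] at h
  refine h.trans ?_
  have h1 := pow_le_factorial_mul_exp hD0 hs p
  have h2 : Real.exp ((∑ j, x (mkEdge i₀ j) ^ 2) / s) ≤
      ∑ i, Real.exp ((∑ j, x (mkEdge i j) ^ 2) / s) :=
    Finset.single_le_sum (f := fun i => Real.exp ((∑ j, x (mkEdge i j) ^ 2) / s))
      (fun i _ => (Real.exp_pos _).le) (Finset.mem_univ i₀)
  calc (2 * p * ∑ j, x (mkEdge i₀ j) ^ 2) ^ p * (Fintype.card (Edge n → ℤˣ) * n)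
      = (2 * p) ^ p * (∑ j, x (mkEdge i₀ j) ^ 2) ^ p * (Fintype.card (Edge n → ℤˣ) * n) := by
        rw [mul_pow]
    _ ≤ (2 * p) ^ p * ((p * s) ^ p * ∑ i, Real.exp ((∑ j, x (mkEdge i j) ^ 2) / s)) *
        (Fintype.card (Edge n → ℤˣ) * n) := by
        gcongr
        exact h1.trans (by gcongr)
    _ = _ := by
        rw [show (2 * (p : ℝ) ^ 2 * s) = (2 * p) * (p * s) by ring, mul_pow (2 * (p : ℝ))]
        ring

end EdgeMatrices

/-! ### Symmetrization by an independent copy, and exponential moments of sums of squares. -/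

section Symmetrization

variable {S : Type*} [MeasurableSpace S] {μ : Measure S} [IsProbabilityMeasure μ]

theorem integrable_continuous_comp_of_bounded {T : Type*} [MeasurableSpace T] {Q : Measure T}
    [IsFiniteMeasure Q] {E : Type*} [Fintype E] {F : (E → ℝ) → ℝ} (hF : Continuous F)
    {Z : T → E → ℝ} (hZ : Measurable Z) {R : ℝ} (hR : ∀ s, ‖Z s‖ ≤ R) :
    Integrable (fun s => F (Z s)) Q := by
  obtain ⟨C, hC⟩ := (isCompact_closedBall (0 : E → ℝ) R).exists_bound_of_continuousOn
    hF.continuousOn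
  refine Integrable.of_bound (hF.measurable.comp hZ).aestronglyMeasurable C
    (Filter.Eventually.of_forall fun s => hC _ ?_)
  simpa using hR s

/-- Exchanging a coordinate with its independent copy wherever `ε e = -1` preserves the product law.
-/
theorem integral_symmetrized_sign {E : Type*} [Fintype E] {X : E → S → ℝ}
    (hX : ∀ e, Measurable (X e)) (hind : iIndepFun X μ) {F : (E → ℝ) → ℝ} (hF : Continuous F)
    (ε : E → ℤˣ) :
    ∫ z : S × S, F (fun e => X e z.1 - X e z.2) ∂μ.prod μ =
      ∫ z : S × S, F (fun e => ((ε e : ℤ) : ℝ) * (X e z.1 - X e z.2)) ∂μ.prod μ := by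
  classical
  set ν : E → Measure ℝ := fun e => μ.map (X e) with hν
  have hνp : ∀ e, IsProbabilityMeasure (ν e) := fun e =>
    Measure.isProbabilityMeasure_map (hX e).aemeasurable
  have hXm : Measurable fun s e => X e s := measurable_pi_lambda _ hX
  have hpi : μ.map (fun s e => X e s) = Measure.pi ν :=
    hind.map_fun_eq_pi_map fun e => (hX e).aemeasurable
  set Z : S × S → (E → ℝ) × (E → ℝ) := Prod.map (fun s e => X e s) (fun s e => X e s) with hZ
  have hZm : Measurable Z := hXm.prodMap hXm
  have hZmap : (μ.prod μ).map Z = (Measure.pi ν).prod (Measure.pi ν) := by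
    rw [hZ, ← Measure.map_prod_map _ _ hXm hXm, hpi]
  -- the coordinatewise swap
  set sw : E → ℝ × ℝ → ℝ × ℝ := fun e => if ε e = 1 then id else Prod.swap with hsw
  have hswp : ∀ e, MeasurePreserving (sw e) ((ν e).prod (ν e)) ((ν e).prod (ν e)) := by
    intro e
    by_cases h : ε e = 1
    · simp only [hsw, h, if_true]; exact MeasurePreserving.id _
    · simp only [hsw, h, if_false]; exact Measure.measurePreserving_swap
  have hT := measurePreserving_pi (fun e => (ν e).prod (ν e)) (fun e => (ν e).prod (ν e)) hswp
  have hA := measurePreserving_arrowProdEquivProdArrow ℝ ℝ E ν ν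
  have hcomp := (hA.comp hT).comp hA.symm
  set T : (E → ℝ) × (E → ℝ) → (E → ℝ) × (E → ℝ) :=
    (MeasurableEquiv.arrowProdEquivProdArrow ℝ ℝ E ∘ fun a i => sw i (a i)) ∘
      (MeasurableEquiv.arrowProdEquivProdArrow ℝ ℝ E).symm with hTdef
  have hTapp : ∀ (x y : E → ℝ) (e : E), (T (x, y)).1 e - (T (x, y)).2 e =
      ((ε e : ℤ) : ℝ) * (x e - y e) := by
    intro x y e
    change (sw e (x e, y e)).1 - (sw e (x e, y e)).2 = _
    rcases Int.units_eq_one_or (ε e) with h | h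
    · simp [hsw, h]
    · have : ¬ ((-1 : ℤˣ) = 1) := by decide
      simp [hsw, h, this]
  set Gf : (E → ℝ) × (E → ℝ) → ℝ := fun z => F (fun e => z.1 e - z.2 e) with hG
  have hGm : Measurable Gf := by
    refine hF.measurable.comp ?_
    exact measurable_pi_lambda _ fun e => by fun_prop
  calc ∫ z : S × S, F (fun e => X e z.1 - X e z.2) ∂μ.prod μ
      = ∫ z, Gf (Z z) ∂μ.prod μ := rfl
    _ = ∫ w, Gf w ∂((Measure.pi ν).prod (Measure.pi ν)) := by
        rw [← hZmap, integral_map hZm.aemeasurable hGm.aestronglyMeasurable]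
    _ = ∫ w, Gf (T w) ∂((Measure.pi ν).prod (Measure.pi ν)) := by
        conv_lhs => rw [← hcomp.map_eq]
        rw [integral_map hcomp.measurable.aemeasurable hGm.aestronglyMeasurable]
    _ = ∫ z, Gf (T (Z z)) ∂μ.prod μ := by
        rw [← hZmap]
        exact integral_map hZm.aemeasurable (hGm.comp hcomp.measurable).aestronglyMeasurable
    _ = _ := by
        refine integral_congr_ae (Filter.Eventually.of_forall fun z => ?_)
        simp only [hG]
        congr 1
        funext e
        exact hTapp _ _ e

theorem exp_le_one_add_two_mul {x : ℝ} (h0 : 0 ≤ x) (h1 : x ≤ 1) : Real.exp x ≤ 1 + 2 * x := by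
  have := Real.abs_exp_sub_one_sub_id_le (x := x) (by rw [abs_of_nonneg h0]; exact h1)
  have := (abs_le.1 this).2
  nlinarith

theorem integral_exp_sum_sq_le {ι : Type*} [Fintype ι] {ξ : ι → S → ℝ}
    (hξ : ∀ i, Measurable (ξ i)) (hind : iIndepFun ξ μ) {τ V s : ℝ}
    (hb : ∀ i ω, |ξ i ω| ≤ τ) (hV : ∀ i, ∫ ω, ξ i ω ^ 2 ∂μ ≤ V) (hs : 0 < s)
    (hτs : 2 * τ ^ 2 ≤ s) :
    ∫ ω, Real.exp (2 * (∑ i, ξ i ω ^ 2) / s) ∂μ ≤ Real.exp (4 * Fintype.card ι * V / s) := by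
  have e1 : ∀ ω, Real.exp (2 * (∑ i, ξ i ω ^ 2) / s) = ∏ i, Real.exp (2 * ξ i ω ^ 2 / s) := by
    intro ω
    rw [← Real.exp_sum, Finset.mul_sum, Finset.sum_div]
  have hsq : ∀ i ω, ξ i ω ^ 2 ≤ τ ^ 2 := fun i ω => by
    rw [← sq_abs]; exact pow_le_pow_left₀ (abs_nonneg _) (hb i ω) 2
  simp only [e1]
  rw [iIndepFun.integral_fun_prod_comp (f := fun _ x => Real.exp (2 * x ^ 2 / s)) hind
    (fun i => (hξ i).aemeasurable) (fun i => by fun_prop)]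
  have hint : ∀ i, Integrable (fun ω => ξ i ω ^ 2) μ := fun i =>
    Integrable.of_bound ((hξ i).pow_const 2).aestronglyMeasurable (τ ^ 2)
      (Filter.Eventually.of_forall fun ω => by
        rw [Real.norm_of_nonneg (sq_nonneg _)]; exact hsq i ω)
  have h1 : ∀ i, ∫ ω, Real.exp (2 * ξ i ω ^ 2 / s) ∂μ ≤ Real.exp (4 * V / s) := by
    intro i
    calc ∫ ω, Real.exp (2 * ξ i ω ^ 2 / s) ∂μ ≤ ∫ ω, (1 + 4 / s * ξ i ω ^ 2) ∂μ := by
          refine integral_mono_of_nonneg (Filter.Eventually.of_forall fun ω => (Real.exp_pos _).le)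
            ((integrable_const _).add ((hint i).const_mul _))
            (Filter.Eventually.of_forall fun ω => ?_)
          have := exp_le_one_add_two_mul (x := 2 * ξ i ω ^ 2 / s) (by positivity)
            (by rw [div_le_one hs]; linarith [hsq i ω])
          refine this.trans (le_of_eq ?_)
          ring
      _ = 1 + 4 / s * ∫ ω, ξ i ω ^ 2 ∂μ := by
          rw [integral_add (integrable_const _) ((hint i).const_mul _), integral_const_mul]
          simp
      _ ≤ 1 + 4 / s * V := by gcongr; exact hV i
      _ ≤ Real.exp (4 * V / s) := by
          have := Real.add_one_le_exp (4 * V / s)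
          have e : 4 / s * V = 4 * V / s := by ring
          linarith
  calc ∏ i, ∫ ω, Real.exp (2 * ξ i ω ^ 2 / s) ∂μ ≤ ∏ _i : ι, Real.exp (4 * V / s) :=
        Finset.prod_le_prod (fun i _ => integral_nonneg fun ω => (Real.exp_pos _).le)
          fun i _ => h1 i
    _ = _ := by
        rw [Finset.prod_const, ← Real.exp_nat_mul, Finset.card_univ]
        congr 1; ring

end Symmetrization

/-! ### Moment bound for the spectral norm. -/

section SpectralNorm

set_option linter.unusedSectionVars false

open Matrix

variable {S : Type*} [MeasurableSpace S] {μ : Measure S} [IsProbabilityMeasure μ]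

theorem continuous_trace_symMat_pow {n : ℕ} (k : ℕ) :
    Continuous fun x : Edge n → ℝ => (symMat x ^ k).trace := by
  have h : Continuous fun x : Edge n → ℝ => symMat x := by
    refine continuous_matrix fun i j => ?_
    exact continuous_apply (mkEdge i j)
  exact (h.pow k).matrix_trace

theorem norm_sub_le_of_abs_le {n : ℕ} {X : Edge n → S → ℝ} {τ : ℝ} (hτ : 0 ≤ τ)
    (hb : ∀ e s, |X e s| ≤ τ) (s s' : S) : ‖fun e => X e s - X e s'‖ ≤ 2 * τ := by
  rw [pi_norm_le_iff_of_nonneg (by positivity)]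
  intro e
  rw [Real.norm_eq_abs]
  calc |X e s - X e s'| ≤ |X e s| + |X e s'| := abs_sub _ _
    _ ≤ 2 * τ := by linarith [hb e s, hb e s']

/-- The inequality `(a - b)² ≤ 2a² + 2b²` decouples the two copies. -/
theorem integral_exp_sum_sq_sub_le {ι : Type*} [Fintype ι] {ξ : ι → S → ℝ}
    (hξ : ∀ i, Measurable (ξ i)) (hind : iIndepFun ξ μ) {τ V s : ℝ}
    (hb : ∀ i ω, |ξ i ω| ≤ τ) (hV : ∀ i, ∫ ω, ξ i ω ^ 2 ∂μ ≤ V) (hs : 0 < s)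
    (hτs : 2 * τ ^ 2 ≤ s) :
    ∫ z : S × S, Real.exp ((∑ i, (ξ i z.1 - ξ i z.2) ^ 2) / s) ∂μ.prod μ ≤
      Real.exp (8 * Fintype.card ι * V / s) := by
  set f : S → ℝ := fun ω => Real.exp (2 * (∑ i, ξ i ω ^ 2) / s) with hf
  have h := integral_exp_sum_sq_le hξ hind hb hV hs hτs
  have hfm : Measurable f := by
    refine Real.measurable_exp.comp ?_
    exact ((Finset.measurable_sum _ fun i _ => (hξ i).pow_const 2).const_mul 2).div_const s
  have hfi : Integrable f μ := by
    refine Integrable.of_bound hfm.aestronglyMeasurable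
      (Real.exp (2 * (∑ _i : ι, τ ^ 2) / s)) (Filter.Eventually.of_forall fun ω => ?_)
    rw [Real.norm_of_nonneg (Real.exp_pos _).le]
    refine Real.exp_le_exp.2 ?_
    refine div_le_div_of_nonneg_right (mul_le_mul_of_nonneg_left
      (Finset.sum_le_sum fun i _ => ?_) (by norm_num)) hs.le
    exact sq_le_sq' (abs_le.1 (hb i ω)).1 (abs_le.1 (hb i ω)).2
  calc ∫ z : S × S, Real.exp ((∑ i, (ξ i z.1 - ξ i z.2) ^ 2) / s) ∂μ.prod μ
      ≤ ∫ z : S × S, f z.1 * f z.2 ∂μ.prod μ := by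
        refine integral_mono_of_nonneg (Filter.Eventually.of_forall fun z => (Real.exp_pos _).le)
          (hfi.mul_prod hfi) (Filter.Eventually.of_forall fun z => ?_)
        simp only [hf]
        rw [← Real.exp_add]
        refine Real.exp_le_exp.2 ?_
        rw [← add_div, ← mul_add, ← Finset.sum_add_distrib, Finset.mul_sum]
        gcongr with i
        nlinarith [sq_nonneg (ξ i z.1 + ξ i z.2)]
    _ = (∫ ω, f ω ∂μ) * ∫ ω, f ω ∂μ := integral_prod_mul f f
    _ ≤ Real.exp (4 * Fintype.card ι * V / s) * Real.exp (4 * Fintype.card ι * V / s) :=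
        mul_le_mul h h (integral_nonneg fun ω => (Real.exp_pos _).le) (Real.exp_pos _).le
    _ = _ := by rw [← Real.exp_add]; congr 1; ring

theorem integral_trace_symMat_pow_le {n : ℕ} {X : Edge n → S → ℝ}
    (hX : ∀ e, Measurable (X e)) (hind : iIndepFun X μ) {τ V s : ℝ} (hτ : 0 ≤ τ)
    (hb : ∀ e ω, |X e ω| ≤ τ) (hV : ∀ e, ∫ ω, X e ω ^ 2 ∂μ ≤ V) (hs : 0 < s)
    (hτs : 2 * τ ^ 2 ≤ s) (p : ℕ) :
    ∫ z : S × S, (symMat (fun e => X e z.1 - X e z.2) ^ (2 * p)).trace ∂μ.prod μ ≤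
      n * (2 * p ^ 2 * s) ^ p * (n * Real.exp (8 * n * V / s)) := by
  obtain ⟨F, hF⟩ : ∃ F : (Edge n → ℝ) → ℝ, ∀ x, (symMat x ^ (2 * p)).trace = F x :=
    ⟨_, fun _ => rfl⟩
  have hFc : Continuous F := by
    simpa only [hF] using continuous_trace_symMat_pow (n := n) (2 * p)
  simp only [hF]
  set c : ℝ := (Fintype.card (Edge n → ℤˣ) : ℝ) with hc
  have hcpos : 0 < c := by
    rw [hc]; exact_mod_cast Fintype.card_pos
  have hdm : Measurable fun z : S × S => fun e => X e z.1 - X e z.2 :=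
    measurable_pi_lambda _ fun e => ((hX e).comp measurable_fst).sub ((hX e).comp measurable_snd)
  have hint : ∀ ε : Edge n → ℤˣ, Integrable (fun z : S × S =>
      F (fun e => ((ε e : ℤ) : ℝ) * (X e z.1 - X e z.2))) (μ.prod μ) := by
    intro ε
    refine integrable_continuous_comp_of_bounded
      (F := fun x => F (fun e => ((ε e : ℤ) : ℝ) * x e)) ?_ hdm
      (fun z => norm_sub_le_of_abs_le hτ hb z.1 z.2)
    have hm : Continuous fun (x : Edge n → ℝ) e => ((ε e : ℤ) : ℝ) * x e := by fun_prop
    exact hFc.comp hm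
  have hexp : ∀ i : Fin n, Integrable (fun z : S × S =>
      Real.exp ((∑ j, (X (mkEdge i j) z.1 - X (mkEdge i j) z.2) ^ 2) / s)) (μ.prod μ) := by
    intro i
    have hm : Continuous fun x : Edge n → ℝ => Real.exp ((∑ j, x (mkEdge i j) ^ 2) / s) := by
      fun_prop
    have h := integrable_continuous_comp_of_bounded (Q := μ.prod μ) hm hdm
      (fun z => norm_sub_le_of_abs_le hτ hb z.1 z.2)
    exact h
  -- All sign patterns give the same integral, so it equals its average over the signs, to which the
  -- Khintchine bound applies pointwise.
  have h1 : c * ∫ z : S × S, F (fun e => X e z.1 - X e z.2) ∂μ.prod μ =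
      ∫ z : S × S, ∑ ε : Edge n → ℤˣ,
        F (fun e => ((ε e : ℤ) : ℝ) * (X e z.1 - X e z.2)) ∂μ.prod μ := by
    rw [integral_finsetSum _ fun ε _ => hint ε,
      ← Finset.sum_congr rfl fun ε _ => integral_symmetrized_sign hX hind hFc ε,
      Finset.sum_const, Finset.card_univ, nsmul_eq_mul]
  have h2 : ∫ z : S × S, ∑ ε : Edge n → ℤˣ,
        F (fun e => ((ε e : ℤ) : ℝ) * (X e z.1 - X e z.2)) ∂μ.prod μ ≤
      ∫ z : S × S, c * (n * (2 * p ^ 2 * s) ^ p * ∑ i, Real.exp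
        ((∑ j, (X (mkEdge i j) z.1 - X (mkEdge i j) z.2) ^ 2) / s)) ∂μ.prod μ := by
    refine integral_mono (integrable_finsetSum _ fun ε _ => hint ε)
      (((integrable_finsetSum _ fun i _ => hexp i).const_mul _).const_mul _) fun z => ?_
    have := sum_sign_trace_symMat_le (fun e => X e z.1 - X e z.2) p hs
    simpa only [hF] using this
  rw [integral_const_mul, integral_const_mul, integral_finsetSum _ fun i _ => hexp i] at h2
  have h3 : ∑ i : Fin n, ∫ z : S × S, Real.exp
      ((∑ j, (X (mkEdge i j) z.1 - X (mkEdge i j) z.2) ^ 2) / s) ∂μ.prod μ ≤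
      n * Real.exp (8 * n * V / s) := by
    calc _ ≤ ∑ _i : Fin n, Real.exp (8 * n * V / s) := by
          refine Finset.sum_le_sum fun i _ => ?_
          have := integral_exp_sum_sq_sub_le (ξ := fun j => X (mkEdge i j)) (fun j => hX _)
            (hind.precomp (mkEdge_right_injective i)) (fun j ω => hb _ ω) (fun j => hV _) hs hτs
          simpa using this
      _ = _ := by simp
  rw [← h1] at h2
  have h4 := le_of_mul_le_mul_left h2 hcpos
  exact h4.trans (by gcongr)

/-- The copy is centered, so the form at `s` is the mean over `s'` of the form of the difference.
Jensen's inequality for the even power does the rest, and the right side does not depend on `x` and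
`y`. -/
theorem pow_dotProduct_mulVec_le_integral {n : ℕ} {X : Edge n → S → ℝ}
    (hX : ∀ e, Measurable (X e)) {τ : ℝ} (hτ : 0 ≤ τ)
    (hb : ∀ e ω, |X e ω| ≤ τ) (h0 : ∀ e, ∫ ω, X e ω ∂μ = 0) (p : ℕ) (hp : p ≠ 0) (s : S)
    (x y : Fin n → ℝ) (hx : x ⬝ᵥ x ≤ 1) (hy : y ⬝ᵥ y ≤ 1) :
    (y ⬝ᵥ symMat (fun e => X e s) *ᵥ x) ^ (2 * p) ≤
      ∫ s', (symMat (fun e => X e s - X e s') ^ (2 * p)).trace ∂μ := by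
  set Lf : (Edge n → ℝ) → ℝ := fun z => y ⬝ᵥ symMat z *ᵥ x with hL
  have hLs : ∀ z, Lf z = ∑ i, ∑ j, y i * (z (mkEdge i j) * x j) := by
    intro z
    simp only [hL, dotProduct, mulVec, symMat_apply, Finset.mul_sum]
  have hLc : Continuous Lf := by
    have : Lf = fun z => ∑ i, ∑ j, y i * (z (mkEdge i j) * x j) := funext hLs
    rw [this]; fun_prop
  have hdm : Measurable fun s' : S => fun e => X e s - X e s' :=
    measurable_pi_lambda _ fun e => measurable_const.sub (hX e)
  have hbd := norm_sub_le_of_abs_le hτ hb s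
  have hXi : ∀ e, Integrable (X e) μ := fun e =>
    Integrable.of_bound (hX e).aestronglyMeasurable τ (Filter.Eventually.of_forall (hb e))
  have hmean : Lf (fun e => X e s) = ∫ s', Lf (fun e => X e s - X e s') ∂μ := by
    simp only [hLs]
    have hi : ∀ i j, Integrable (fun s' => y i * ((X (mkEdge i j) s - X (mkEdge i j) s') * x j)) μ :=
      fun i j => ((((integrable_const _).sub (hXi _)).mul_const _).const_mul _)
    rw [integral_finsetSum _ fun i _ => integrable_finsetSum _ fun j _ => hi i j]
    refine Finset.sum_congr rfl fun i _ => ?_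
    rw [integral_finsetSum _ fun j _ => hi i j]
    refine Finset.sum_congr rfl fun j _ => ?_
    rw [integral_const_mul, integral_mul_const, integral_sub (integrable_const _) (hXi _), h0]
    simp
  have hJ : (∫ s', Lf (fun e => X e s - X e s') ∂μ) ^ (2 * p) ≤
      ∫ s', Lf (fun e => X e s - X e s') ^ (2 * p) ∂μ :=
    (even_two_mul p).convexOn_pow.map_integral_le (μ := μ) (continuous_pow _).continuousOn
      isClosed_univ (Filter.Eventually.of_forall fun _ => Set.mem_univ _)
      (integrable_continuous_comp_of_bounded hLc hdm hbd)
      (integrable_continuous_comp_of_bounded (F := fun z => Lf z ^ (2 * p)) (hLc.pow _) hdm hbd)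
  change Lf (fun e => X e s) ^ (2 * p) ≤ _
  rw [hmean]
  refine hJ.trans (integral_mono
    (integrable_continuous_comp_of_bounded (F := fun z => Lf z ^ (2 * p)) (hLc.pow _) hdm hbd)
    (integrable_continuous_comp_of_bounded (continuous_trace_symMat_pow (2 * p)) hdm hbd)
    fun s' => ?_)
  exact sq_eigenvalue_bound (symMat_isHermitian _) p hp x y hx hy

/-- The spectral norm of a symmetric random matrix with independent centered bounded entries is
at most of the order `√(V n log n)` with high probability. -/
theorem measure_spectral_norm_gt_le {n : ℕ} (hn : 3 ≤ n) {X : Edge n → S → ℝ}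
    (hX : ∀ e, Measurable (X e)) (hind : iIndepFun X μ) {τ V : ℝ} (hτ : 0 ≤ τ) (hVpos : 0 < V)
    (hb : ∀ e ω, |X e ω| ≤ τ) (h0 : ∀ e, ∫ ω, X e ω ∂μ = 0)
    (hV : ∀ e, ∫ ω, X e ω ^ 2 ∂μ ≤ V) (hτV : τ ^ 2 * Real.log n ≤ V * n) :
    μ {s | ¬ ∀ x y : Fin n → ℝ, x ⬝ᵥ x ≤ 1 → y ⬝ᵥ y ≤ 1 →
      |y ⬝ᵥ symMat (fun e => X e s) *ᵥ x| ≤ Real.sqrt (64 * Real.exp 9 * (V * n * Real.log n))} ≤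
      ENNReal.ofReal ((n : ℝ) ^ 6)⁻¹ := by
  have hn0 : (0 : ℝ) < n := by positivity
  have hlog1 : 1 ≤ Real.log n := by
    rw [Real.le_log_iff_exp_le hn0]
    have := Real.exp_one_lt_d9
    have h3 : (3 : ℝ) ≤ n := by exact_mod_cast hn
    linarith
  set ℓ := Real.log n with hℓ
  set p := ⌈ℓ⌉₊ with hp
  have hp1 : ℓ ≤ p := Nat.le_ceil _
  have hp2 : (p : ℝ) ≤ 2 * ℓ := by
    have := Nat.ceil_lt_add_one (a := ℓ) (by linarith)
    linarith
  have hp0 : p ≠ 0 := by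
    intro h; rw [h] at hp1; norm_num at hp1; linarith
  -- This choice makes `exp(8nV/s₀) = n` and turns the sparsity condition into `2τ² ≤ s₀`.
  set s₀ := 8 * V * n / ℓ with hs₀
  have hs₀pos : 0 < s₀ := by positivity
  have hτs : 2 * τ ^ 2 ≤ s₀ := by
    rw [hs₀, le_div_iff₀ (by linarith)]
    nlinarith [mul_pos hVpos hn0]
  -- The factor `64` absorbs `2p²s₀` for `p ≤ 2ℓ`. The power `exp(9)^p ≥ n^9` pays for three factors
  -- `n` in the moment bound and for the probability `n⁻⁶`.
  set t2 := 64 * Real.exp 9 * (V * n * ℓ) with ht2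
  have ht2pos : 0 < t2 := by positivity
  set Ψ : S → ℝ := fun s => ∫ s', (symMat (fun e => X e s - X e s') ^ (2 * p)).trace ∂μ with hΨ
  have hdm : Measurable fun z : S × S => fun e => X e z.1 - X e z.2 :=
    measurable_pi_lambda _ fun e => ((hX e).comp measurable_fst).sub ((hX e).comp measurable_snd)
  have hFi : Integrable (fun z : S × S =>
      (symMat (fun e => X e z.1 - X e z.2) ^ (2 * p)).trace) (μ.prod μ) :=
    integrable_continuous_comp_of_bounded (continuous_trace_symMat_pow (2 * p)) hdm
      (fun z => norm_sub_le_of_abs_le hτ hb z.1 z.2)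
  have hΨi : Integrable Ψ μ := hFi.integral_prod_left
  have hΨint : ∫ s, Ψ s ∂μ ≤ n * (2 * p ^ 2 * s₀) ^ p * (n * Real.exp (8 * n * V / s₀)) := by
    rw [hΨ, ← integral_prod _ hFi]
    exact integral_trace_symMat_pow_le hX hind hτ hb hV hs₀pos hτs p
  have hΨ0 : 0 ≤ Ψ := fun s => integral_nonneg fun s' => by
    simp only [Matrix.trace, diag_apply]
    exact Finset.sum_nonneg fun i _ => diag_pow_two_mul_nonneg (symMat_isHermitian _) p i
  have hsub : {s | ¬ ∀ x y : Fin n → ℝ, x ⬝ᵥ x ≤ 1 → y ⬝ᵥ y ≤ 1 →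
      |y ⬝ᵥ symMat (fun e => X e s) *ᵥ x| ≤ Real.sqrt t2} ⊆ {s | t2 ^ p ≤ Ψ s} := by
    intro s hs
    simp only [Set.mem_ofPred_eq, not_forall, not_le] at hs
    obtain ⟨x, y, hx, hy, h⟩ := hs
    have h1 := pow_dotProduct_mulVec_le_integral hX hτ hb h0 p hp0 s x y hx hy
    refine le_trans ?_ h1
    rw [pow_mul]
    refine pow_le_pow_left₀ ht2pos.le ?_ p
    rw [← sq_abs, ← Real.sq_sqrt ht2pos.le]
    exact pow_le_pow_left₀ (Real.sqrt_nonneg _) h.le 2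
  have hmk := mul_meas_ge_le_integral_of_nonneg (Filter.Eventually.of_forall hΨ0) hΨi (t2 ^ p)
  have hbound : ((n : ℝ) * (2 * p ^ 2 * s₀) ^ p * (n * Real.exp (8 * n * V / s₀))) ≤
      t2 ^ p * ((n : ℝ) ^ 6)⁻¹ := by
    have e1 : 8 * n * V / s₀ = ℓ := by
      rw [hs₀]; field_simp
    have e2 : 2 * (p : ℝ) ^ 2 * s₀ ≤ 64 * (V * n * ℓ) := by
      have : (p : ℝ) ^ 2 ≤ 4 * ℓ ^ 2 := by nlinarith [Nat.cast_nonneg (α := ℝ) p]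
      calc 2 * (p : ℝ) ^ 2 * s₀ ≤ 2 * (4 * ℓ ^ 2) * s₀ := by gcongr
        _ = 64 * (V * n * ℓ) := by rw [hs₀]; field_simp; ring
    have e3 : (n : ℝ) ^ 9 ≤ Real.exp 9 ^ p := by
      rw [← Real.exp_nat_mul]
      calc (n : ℝ) ^ 9 = Real.exp (ℓ * 9) := by
            rw [mul_comm, hℓ]
            have := Real.exp_nat_mul (Real.log n) 9
            rw [Real.exp_log hn0] at this
            rw [← this]; norm_num
        _ ≤ Real.exp (p * 9) := Real.exp_le_exp.2 (by linarith)
    rw [e1, hℓ, Real.exp_log hn0, ← div_eq_mul_inv, le_div_iff₀ (by positivity)]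
    calc (n : ℝ) * (2 * p ^ 2 * s₀) ^ p * (n * n) * n ^ 6
        ≤ (n : ℝ) * (64 * (V * n * ℓ)) ^ p * (n * n) * n ^ 6 := by gcongr
      _ = n ^ 9 * (64 * (V * n * ℓ)) ^ p := by ring
      _ ≤ Real.exp 9 ^ p * (64 * (V * n * ℓ)) ^ p := by gcongr
      _ = t2 ^ p := by rw [ht2, ← mul_pow]; congr 1; ring
  have hfin : μ.real {s | t2 ^ p ≤ Ψ s} ≤ ((n : ℝ) ^ 6)⁻¹ := by
    have := hmk.trans (hΨint.trans hbound)
    exact le_of_mul_le_mul_left this (by positivity)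
  refine (measure_mono hsub).trans ?_
  rw [← ENNReal.ofReal_toReal (measure_ne_top μ {s | t2 ^ p ≤ Ψ s})]
  exact ENNReal.ofReal_le_ofReal hfin

end SpectralNorm

/-! ### Bernstein's inequality for weights that are independent of the summands -/

section Bernstein

variable {S : Type*} [MeasurableSpace S] {μ : Measure S} [IsProbabilityMeasure μ]
  {ι : Type*} [Fintype ι]

/-- The deviation scale in Bernstein's inequality for the weights `m`. -/
noncomputable def bernsteinScale (V τ ℓ : ℝ) (m : ι → ℝ) : ℝ :=
  Real.sqrt (V * ℓ * ∑ i, m i ^ 2) + τ * ℓ * ‖m‖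

theorem bernsteinScale_neg (V τ ℓ : ℝ) (m : ι → ℝ) :
    bernsteinScale V τ ℓ (-m) = bernsteinScale V τ ℓ m := by
  simp [bernsteinScale]

theorem bernsteinScale_nonneg {V τ ℓ : ℝ} (hτ : 0 ≤ τ) (hℓ : 0 ≤ ℓ) (m : ι → ℝ) :
    0 ≤ bernsteinScale V τ ℓ m := by
  unfold bernsteinScale; positivity

theorem integral_exp_weighted_sum_le {ξ : ι → S → ℝ} (hξ : ∀ i, Measurable (ξ i))
    (hind : iIndepFun ξ μ) {τ V : ℝ} (hb : ∀ i ω, |ξ i ω| ≤ τ)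
    (h0 : ∀ i, ∫ ω, ξ i ω ∂μ = 0) (hV : ∀ i, ∫ ω, ξ i ω ^ 2 ∂μ ≤ V) (a : ι → ℝ)
    (ha : ∀ i, |a i| * τ ≤ 1) :
    ∫ ω, Real.exp (∑ i, a i * ξ i ω) ∂μ ≤ Real.exp (V * ∑ i, a i ^ 2) := by
  simp only [Real.exp_sum]
  rw [iIndepFun.integral_fun_prod_comp (f := fun i x => Real.exp (a i * x)) hind
    (fun i => (hξ i).aemeasurable) (fun i => by fun_prop)]
  have hint1 : ∀ i, Integrable (ξ i) μ := fun i =>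
    Integrable.of_bound (hξ i).aestronglyMeasurable τ (Filter.Eventually.of_forall (hb i))
  have hint : ∀ i, Integrable (fun ω => ξ i ω ^ 2) μ := fun i =>
    Integrable.of_bound ((hξ i).pow_const 2).aestronglyMeasurable (τ ^ 2)
      (Filter.Eventually.of_forall fun ω => by
        rw [Real.norm_of_nonneg (sq_nonneg _)]
        exact sq_le_sq' (abs_le.1 (hb i ω)).1 (abs_le.1 (hb i ω)).2)
  have h1 : ∀ i, ∫ ω, Real.exp (a i * ξ i ω) ∂μ ≤ Real.exp (V * a i ^ 2) := by
    intro i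
    calc ∫ ω, Real.exp (a i * ξ i ω) ∂μ
        ≤ ∫ ω, (1 + a i * ξ i ω + a i ^ 2 * ξ i ω ^ 2) ∂μ := by
          refine integral_mono_of_nonneg (Filter.Eventually.of_forall fun ω => (Real.exp_pos _).le)
            (((integrable_const _).add ((hint1 i).const_mul _)).add ((hint i).const_mul _))
            (Filter.Eventually.of_forall fun ω => ?_)
          have hle : |a i * ξ i ω| ≤ 1 := by
            rw [abs_mul]
            exact (mul_le_mul_of_nonneg_left (hb i ω) (abs_nonneg _)).trans (ha i)
          have := (abs_le.1 (Real.abs_exp_sub_one_sub_id_le hle)).2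
          rw [mul_pow] at this
          linarith
      _ = 1 + a i ^ 2 * ∫ ω, ξ i ω ^ 2 ∂μ := by
          have hi1 : Integrable (fun ω => 1 + a i * ξ i ω) μ :=
            (integrable_const _).add ((hint1 i).const_mul _)
          rw [integral_add hi1 ((hint i).const_mul _), integral_add (integrable_const _) ((hint1 i).const_mul _),
            integral_const_mul, integral_const_mul, h0]
          simp
      _ ≤ 1 + a i ^ 2 * V := by gcongr; exact hV i
      _ ≤ Real.exp (V * a i ^ 2) := by
          have := Real.add_one_le_exp (V * a i ^ 2)
          linarith
  calc ∏ i, ∫ ω, Real.exp (a i * ξ i ω) ∂μ ≤ ∏ i, Real.exp (V * a i ^ 2) :=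
        Finset.prod_le_prod (fun i _ => integral_nonneg fun ω => (Real.exp_pos _).le)
          fun i _ => h1 i
    _ = _ := by rw [← Real.exp_sum, Finset.mul_sum]

theorem measureReal_weighted_sum_gt_le {ξ : ι → S → ℝ} (hξ : ∀ i, Measurable (ξ i))
    (hind : iIndepFun ξ μ) {τ V ℓ : ℝ} (hτ : 0 ≤ τ) (hV0 : 0 ≤ V) (hℓ : 0 < ℓ)
    (hb : ∀ i ω, |ξ i ω| ≤ τ)
    (h0 : ∀ i, ∫ ω, ξ i ω ∂μ = 0) (hV : ∀ i, ∫ ω, ξ i ω ^ 2 ∂μ ≤ V) (m : ι → ℝ) :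
    μ.real {ω | 13 * bernsteinScale V τ ℓ m < ∑ i, m i * ξ i ω} ≤ Real.exp (-(12 * ℓ)) := by
  set q := bernsteinScale V τ ℓ m with hq
  have hq0 : 0 ≤ q := bernsteinScale_nonneg hτ hℓ.le m
  have hs1 : 0 ≤ Real.sqrt (V * ℓ * ∑ i, m i ^ 2) := Real.sqrt_nonneg _
  have hs2 : 0 ≤ τ * ℓ * ‖m‖ := by positivity
  have hqe : q = Real.sqrt (V * ℓ * ∑ i, m i ^ 2) + τ * ℓ * ‖m‖ := rfl
  -- If the scale is zero, either `τ = 0` or all weights vanish, and the sum is identically zero.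
  rcases hq0.eq_or_lt with hq00 | hqpos
  · have h2 : τ * ℓ * ‖m‖ = 0 := by linarith
    have hz : ∀ ω, ∑ i, m i * ξ i ω = 0 := by
      intro ω
      refine Finset.sum_eq_zero fun i _ => ?_
      rcases mul_eq_zero.1 h2 with h | h
      · have hτ0 : τ = 0 := by
          rcases mul_eq_zero.1 h with h | h
          · exact h
          · exact absurd h hℓ.ne'
        have := hb i ω
        rw [hτ0] at this
        rw [abs_nonpos_iff.1 this, mul_zero]
      · rw [norm_eq_zero.1 h]; simp
    have : {ω | 13 * q < ∑ i, m i * ξ i ω} = ∅ := by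
      ext ω; simp [hz, ← hq00]
    rw [this]; simp [(Real.exp_pos _).le]
  -- With this exponent both `|l m i| τ ≤ 1` and `V ∑ (l m i)² ≤ ℓ` hold, so Markov's inequality at
  -- `13q` gives `exp(ℓ - 13ℓ)`.
  · set l := ℓ / q with hl
    have hlpos : 0 < l := by positivity
    have hlq : l * q = ℓ := by rw [hl]; field_simp
    have ha : ∀ i, |l * m i| * τ ≤ 1 := by
      intro i
      rw [abs_mul, abs_of_pos hlpos]
      have h1 : |m i| ≤ ‖m‖ := norm_le_pi_norm m i
      have h2 : ℓ * (τ * ‖m‖) ≤ q := by linarith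
      calc l * |m i| * τ ≤ l * ‖m‖ * τ := by gcongr
        _ = ℓ * (τ * ‖m‖) / q := by rw [hl]; ring
        _ ≤ 1 := by rw [div_le_one hqpos]; exact h2
    have hmgf := integral_exp_weighted_sum_le hξ hind hb h0 hV (fun i => l * m i) ha
    have hexpo : V * ∑ i, (l * m i) ^ 2 ≤ ℓ := by
      have hss : V * ℓ * ∑ i, m i ^ 2 ≤ q ^ 2 := by
        have h3 : 0 ≤ V * ℓ * ∑ i, m i ^ 2 := by
          have : 0 ≤ ∑ i, m i ^ 2 := Finset.sum_nonneg fun i _ => sq_nonneg _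
          positivity
        rw [← Real.sq_sqrt h3]
        exact pow_le_pow_left₀ hs1 (by linarith) 2
      have e : V * ∑ i, (l * m i) ^ 2 = ℓ * (V * ℓ * ∑ i, m i ^ 2) / q ^ 2 := by
        simp only [mul_pow, ← Finset.mul_sum, hl]; field_simp
      rw [e, div_le_iff₀ (by positivity)]
      exact mul_le_mul_of_nonneg_left hss hℓ.le
    have hmeas : Measurable fun ω => ∑ i, l * m i * ξ i ω :=
      Finset.measurable_sum _ fun i _ => (hξ i).const_mul _
    have hint : Integrable (fun ω => Real.exp (∑ i, l * m i * ξ i ω)) μ := by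
      refine Integrable.of_bound (Real.measurable_exp.comp hmeas).aestronglyMeasurable
        (Real.exp (∑ _i : ι, 1)) (Filter.Eventually.of_forall fun ω => ?_)
      rw [Real.norm_of_nonneg (Real.exp_pos _).le]
      refine Real.exp_le_exp.2 (Finset.sum_le_sum fun i _ => ?_)
      calc l * m i * ξ i ω ≤ |l * m i * ξ i ω| := le_abs_self _
        _ ≤ |l * m i| * τ := by rw [abs_mul]; gcongr; exact hb i ω
        _ ≤ 1 := ha i
    have hmk := mul_meas_ge_le_integral_of_nonneg
      (Filter.Eventually.of_forall fun ω => (Real.exp_pos (∑ i, l * m i * ξ i ω)).le) hint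
      (Real.exp (13 * ℓ))
    have hsub : {ω | 13 * q < ∑ i, m i * ξ i ω} ⊆
        {ω | Real.exp (13 * ℓ) ≤ Real.exp (∑ i, l * m i * ξ i ω)} := by
      intro ω hω
      refine Real.exp_le_exp.2 ?_
      have e : ∑ i, l * m i * ξ i ω = l * ∑ i, m i * ξ i ω := by
        rw [Finset.mul_sum]; exact Finset.sum_congr rfl fun i _ => by ring
      rw [e, ← hlq]
      have hω' : 13 * q < ∑ i, m i * ξ i ω := hω
      nlinarith
    have h5 := (mul_le_mul_of_nonneg_left (measureReal_mono (μ := μ) hsub)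
      (Real.exp_pos (13 * ℓ)).le).trans (hmk.trans (hmgf.trans (Real.exp_le_exp.2 hexpo)))
    have h6 : Real.exp ℓ = Real.exp (13 * ℓ) * Real.exp (-(12 * ℓ)) := by
      rw [← Real.exp_add]; congr 1; ring
    rw [h6] at h5
    exact le_of_mul_le_mul_left h5 (Real.exp_pos _)

theorem measure_abs_weighted_sum_gt_le {ξ : ι → S → ℝ} (hξ : ∀ i, Measurable (ξ i))
    (hind : iIndepFun ξ μ) {τ V ℓ : ℝ} (hτ : 0 ≤ τ) (hV0 : 0 ≤ V) (hℓ : 0 < ℓ)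
    (hb : ∀ i ω, |ξ i ω| ≤ τ)
    (h0 : ∀ i, ∫ ω, ξ i ω ∂μ = 0) (hV : ∀ i, ∫ ω, ξ i ω ^ 2 ∂μ ≤ V) (m : ι → ℝ) :
    μ {ω | 13 * bernsteinScale V τ ℓ m < |∑ i, m i * ξ i ω|} ≤
      ENNReal.ofReal (2 * Real.exp (-(12 * ℓ))) := by
  have h1 := measureReal_weighted_sum_gt_le hξ hind hτ hV0 hℓ hb h0 hV m
  have h2 := measureReal_weighted_sum_gt_le hξ hind hτ hV0 hℓ hb h0 hV (-m)
  rw [bernsteinScale_neg] at h2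
  have hsub : {ω | 13 * bernsteinScale V τ ℓ m < |∑ i, m i * ξ i ω|} ⊆
      {ω | 13 * bernsteinScale V τ ℓ m < ∑ i, m i * ξ i ω} ∪
      {ω | 13 * bernsteinScale V τ ℓ m < ∑ i, (-m) i * ξ i ω} := by
    intro ω hω
    have hω' : 13 * bernsteinScale V τ ℓ m < |∑ i, m i * ξ i ω| := hω
    rcases lt_abs.1 hω' with h | h
    · exact Or.inl h
    · right
      change _ < ∑ i, (-m) i * ξ i ω
      simpa using h
  have h3 : μ.real {ω | 13 * bernsteinScale V τ ℓ m < |∑ i, m i * ξ i ω|} ≤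
      2 * Real.exp (-(12 * ℓ)) :=
    (measureReal_mono hsub).trans ((measureReal_union_le _ _).trans (by linarith))
  rw [← ENNReal.ofReal_toReal (measure_ne_top μ _)]
  exact ENNReal.ofReal_le_ofReal h3

theorem measurable_bernsteinScale (V τ ℓ : ℝ) :
    Measurable (bernsteinScale V τ ℓ : (ι → ℝ) → ℝ) := by
  have : Continuous (bernsteinScale V τ ℓ : (ι → ℝ) → ℝ) := by
    unfold bernsteinScale
    fun_prop
  exact this.measurable

/-- Bernstein's inequality for random weights that are independent of the summands. -/
theorem measure_abs_random_weighted_sum_gt_le {ξ : ι → S → ℝ} (hξ : ∀ i, Measurable (ξ i))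
    (hind : iIndepFun ξ μ) {τ V ℓ : ℝ} (hτ : 0 ≤ τ) (hV0 : 0 ≤ V) (hℓ : 0 < ℓ)
    (hb : ∀ i ω, |ξ i ω| ≤ τ)
    (h0 : ∀ i, ∫ ω, ξ i ω ∂μ = 0) (hV : ∀ i, ∫ ω, ξ i ω ^ 2 ∂μ ≤ V)
    {m : S → ι → ℝ} (hm : Measurable m) (hmi : IndepFun m (fun ω i => ξ i ω) μ) :
    μ {ω | 13 * bernsteinScale V τ ℓ (m ω) < |∑ i, m ω i * ξ i ω|} ≤
      ENNReal.ofReal (2 * Real.exp (-(12 * ℓ))) := by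
  set B : Set ((ι → ℝ) × (ι → ℝ)) :=
    {z | 13 * bernsteinScale V τ ℓ z.1 < |∑ i, z.1 i * z.2 i|} with hB
  have hBm : MeasurableSet B := by
    refine measurableSet_lt ?_ ?_
    · exact ((measurable_bernsteinScale V τ ℓ).comp measurable_fst).const_mul 13
    · have : Continuous fun z : (ι → ℝ) × (ι → ℝ) => |∑ i, z.1 i * z.2 i| := by fun_prop
      exact this.measurable
  have hξm : Measurable fun ω i => ξ i ω := measurable_pi_lambda _ hξ
  have hlaw := (indepFun_iff_map_prod_eq_prod_map_map hm.aemeasurable hξm.aemeasurable).1 hmi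
  have hpm : IsProbabilityMeasure (μ.map m) := Measure.isProbabilityMeasure_map hm.aemeasurable
  have hpx : IsProbabilityMeasure (μ.map fun ω i => ξ i ω) :=
    Measure.isProbabilityMeasure_map hξm.aemeasurable
  have e1 : μ {ω | 13 * bernsteinScale V τ ℓ (m ω) < |∑ i, m ω i * ξ i ω|} =
      (μ.map fun ω => (m ω, fun i => ξ i ω)) B := by
    rw [Measure.map_apply (hm.prodMk hξm) hBm]; rfl
  -- By independence the joint law is a product, so the weights can be frozen and the bound for
  -- fixed weights applied to each section.
  rw [e1, hlaw, Measure.prod_apply hBm]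
  calc ∫⁻ x, (μ.map fun ω i => ξ i ω) (Prod.mk x ⁻¹' B) ∂(μ.map m)
      ≤ ∫⁻ _x, ENNReal.ofReal (2 * Real.exp (-(12 * ℓ))) ∂(μ.map m) := by
        refine lintegral_mono fun x => ?_
        rw [Measure.map_apply hξm (measurable_prodMk_left hBm)]
        exact measure_abs_weighted_sum_gt_le hξ hind hτ hV0 hℓ hb h0 hV x
    _ = _ := by simp

end Bernstein

/-! ### Independence of a row from the rest of the matrix. -/

section LeaveOneOut

set_option linter.unusedSectionVars false

variable {S : Type*} [MeasurableSpace S] {μ : Measure S} [IsProbabilityMeasure μ]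

/-- The weights `x` with all edges at `i` set to zero. -/
def dropVertex {n : ℕ} (i : Fin n) (x : Edge n → ℝ) : Edge n → ℝ :=
  fun e => if e.1.1 = i ∨ e.1.2 = i then 0 else x e

theorem indepFun_dropVertex {n : ℕ} {X : Edge n → S → ℝ} (hX : ∀ e, Measurable (X e))
    (hind : iIndepFun X μ) (i : Fin n) :
    IndepFun (fun s => dropVertex i fun e => X e s) (fun s j => X (mkEdge i j) s) μ := by
  classical
  set P : Finset (Edge n) := Finset.univ.filter fun e => e.1.1 = i ∨ e.1.2 = i with hP
  have hPm : ∀ j, mkEdge i j ∈ P := by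
    intro j
    simp only [hP, Finset.mem_filter, Finset.mem_univ, true_and, mkEdge]
    rcases le_total i j with h | h <;> simp [h]
  have h := hind.indepFun_finset Pᶜ P disjoint_compl_left hX
  set φ : ((e : (Pᶜ : Finset (Edge n))) → ℝ) → Edge n → ℝ :=
    fun y e => if he : e ∈ Pᶜ then y ⟨e, he⟩ else 0 with hφ
  set ψ : ((e : P) → ℝ) → Fin n → ℝ := fun y j => y ⟨mkEdge i j, hPm j⟩ with hψ
  have hφm : Measurable φ := by
    refine measurable_pi_lambda _ fun e => ?_
    by_cases he : e ∈ Pᶜ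
    · simp only [hφ, he, dif_pos]; exact measurable_pi_apply _
    · simp only [hφ, he]; exact measurable_const
  have hψm : Measurable ψ := measurable_pi_lambda _ fun j => measurable_pi_apply _
  have h2 := h.comp hφm hψm
  have e1 : (φ ∘ fun s (e : (Pᶜ : Finset (Edge n))) => X e s) =
      fun s => dropVertex i fun e => X e s := by
    funext s e
    simp only [Function.comp, hφ, dropVertex, hP, Finset.mem_compl, Finset.mem_filter,
      Finset.mem_univ, true_and]
    by_cases he : e.1.1 = i ∨ e.1.2 = i
    · simp [he]
    · simp [he]
  rw [e1] at h2
  exact h2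

/-- For every measurable function of the part of the matrix outside row `i`, the inner product with
row `i` obeys Bernstein's inequality. -/
theorem measure_abs_row_dropVertex_gt_le {n : ℕ} {X : Edge n → S → ℝ}
    (hX : ∀ e, Measurable (X e)) (hind : iIndepFun X μ) {τ V ℓ : ℝ} (hτ : 0 ≤ τ) (hV0 : 0 ≤ V)
    (hℓ : 0 < ℓ) (hb : ∀ e ω, |X e ω| ≤ τ) (h0 : ∀ e, ∫ ω, X e ω ∂μ = 0)
    (hV : ∀ e, ∫ ω, X e ω ^ 2 ∂μ ≤ V) (i : Fin n) {g : (Edge n → ℝ) → Fin n → ℝ}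
    (hg : Measurable g) :
    μ {s | 13 * bernsteinScale V τ ℓ (g (dropVertex i fun e => X e s)) <
        |∑ j, g (dropVertex i fun e => X e s) j * symMat (fun e => X e s) i j|} ≤
      ENNReal.ofReal (2 * Real.exp (-(12 * ℓ))) := by
  have hd : Measurable fun s => dropVertex i fun e => X e s := by
    refine measurable_pi_lambda _ fun e => ?_
    unfold dropVertex
    by_cases he : e.1.1 = i ∨ e.1.2 = i
    · simp [he]
    · simpa [he] using hX e
  exact measure_abs_random_weighted_sum_gt_le (ξ := fun j => X (mkEdge i j)) (fun j => hX _)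
    (hind.precomp (mkEdge_right_injective i)) hτ hV0 hℓ (fun j => hb _) (fun j => h0 _)
    (fun j => hV _) (hg.comp hd) ((indepFun_dropVertex hX hind i).comp hg measurable_id)

end LeaveOneOut

/-! ### Entrywise perturbation of resolvents by the leave-one-out method -/

section LTwoNorm

open Matrix

variable {ι : Type*} [Fintype ι]

/-- The Euclidean norm of a vector. -/
noncomputable def l2norm (x : ι → ℝ) : ℝ := ‖(WithLp.toLp 2 x : EuclideanSpace ℝ ι)‖

theorem l2norm_nonneg (x : ι → ℝ) : 0 ≤ l2norm x := norm_nonneg _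

theorem l2norm_add_le (x y : ι → ℝ) : l2norm (x + y) ≤ l2norm x + l2norm y := by
  unfold l2norm; rw [WithLp.toLp_add]; exact norm_add_le _ _

theorem l2norm_sub_le (x y : ι → ℝ) : l2norm (x - y) ≤ l2norm x + l2norm y := by
  unfold l2norm; rw [WithLp.toLp_sub]; exact norm_sub_le _ _

theorem l2norm_smul (c : ℝ) (x : ι → ℝ) : l2norm (c • x) = |c| * l2norm x := by
  unfold l2norm; rw [WithLp.toLp_smul, norm_smul, Real.norm_eq_abs]

theorem l2norm_sq (x : ι → ℝ) : l2norm x ^ 2 = ∑ i, x i ^ 2 := by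
  unfold l2norm; rw [EuclideanSpace.real_norm_sq_eq]

theorem l2norm_eq_sqrt (x : ι → ℝ) : l2norm x = Real.sqrt (∑ i, x i ^ 2) := by
  rw [← l2norm_sq, Real.sqrt_sq (l2norm_nonneg x)]

theorem dotProduct_self_eq_l2norm_sq (x : ι → ℝ) : x ⬝ᵥ x = l2norm x ^ 2 := by
  rw [l2norm_sq]; simp [dotProduct, sq]

theorem abs_le_l2norm (x : ι → ℝ) (i : ι) : |x i| ≤ l2norm x := by
  have h : x i ^ 2 ≤ l2norm x ^ 2 := by
    rw [l2norm_sq]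
    exact Finset.single_le_sum (f := fun i => x i ^ 2) (fun i _ => sq_nonneg _) (Finset.mem_univ i)
  exact abs_le_of_sq_le_sq h (l2norm_nonneg x)

theorem abs_dotProduct_le (x y : ι → ℝ) : |x ⬝ᵥ y| ≤ l2norm x * l2norm y := by
  have h := abs_real_inner_le_norm (WithLp.toLp 2 y : EuclideanSpace ℝ ι) (WithLp.toLp 2 x)
  rw [EuclideanSpace.inner_toLp_toLp] at h
  simp only [star_trivial] at h
  unfold l2norm
  linarith

theorem l2norm_eq_zero {x : ι → ℝ} : l2norm x = 0 ↔ x = 0 := by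
  unfold l2norm; rw [norm_eq_zero, WithLp.toLp_eq_zero]

theorem l2norm_single [DecidableEq ι] (i : ι) : l2norm (Pi.single i (1 : ℝ)) = 1 := by
  rw [l2norm_eq_sqrt, Finset.sum_eq_single i]
  · simp
  · intro j _ hj; simp [hj]
  · simp

theorem l2norm_le_of_abs_le {x : ι → ℝ} {φ : ℝ} (hφ : 0 ≤ φ) (h : ∀ i, |x i| ≤ φ) :
    l2norm x ≤ Real.sqrt (Fintype.card ι) * φ := by
  rw [l2norm_eq_sqrt]
  refine Real.sqrt_le_iff.2 ⟨by positivity, ?_⟩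
  rw [mul_pow, Real.sq_sqrt (by positivity)]
  calc ∑ i, x i ^ 2 ≤ ∑ _i : ι, φ ^ 2 :=
        Finset.sum_le_sum fun i _ => sq_le_sq' (abs_le.1 (h i)).1 (abs_le.1 (h i)).2
    _ = _ := by simp

theorem l2norm_le_of_abs_le_abs {x y : ι → ℝ} (h : ∀ i, |x i| ≤ |y i|) :
    l2norm x ≤ l2norm y := by
  rw [l2norm_eq_sqrt, l2norm_eq_sqrt]
  exact Real.sqrt_le_sqrt (Finset.sum_le_sum fun i _ => sq_le_sq.2 (h i))

theorem l2norm_mulVec_le_of_forall {W : Matrix ι ι ℝ} {b : ℝ} (hb : 0 ≤ b)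
    (h : ∀ x y : ι → ℝ, x ⬝ᵥ x ≤ 1 → y ⬝ᵥ y ≤ 1 → |y ⬝ᵥ W *ᵥ x| ≤ b) (x : ι → ℝ) :
    l2norm (W *ᵥ x) ≤ b * l2norm x := by
  rcases (l2norm_nonneg x).eq_or_lt with hx | hx
  · have : x = 0 := l2norm_eq_zero.1 hx.symm
    subst this
    rw [mulVec_zero, ← hx]; simp
  rcases (l2norm_nonneg (W *ᵥ x)).eq_or_lt with hy | hy
  · rw [← hy]; positivity
  have h1 := h ((l2norm x)⁻¹ • x) ((l2norm (W *ᵥ x))⁻¹ • (W *ᵥ x))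
    (by rw [dotProduct_self_eq_l2norm_sq, l2norm_smul, abs_of_pos (by positivity),
      inv_mul_cancel₀ hx.ne', one_pow])
    (by rw [dotProduct_self_eq_l2norm_sq, l2norm_smul, abs_of_pos (by positivity),
      inv_mul_cancel₀ hy.ne', one_pow])
  rw [mulVec_smul, dotProduct_smul, smul_dotProduct, dotProduct_self_eq_l2norm_sq, smul_eq_mul,
    smul_eq_mul, abs_of_nonneg (by positivity)] at h1
  have e : (l2norm x)⁻¹ * ((l2norm (W *ᵥ x))⁻¹ * l2norm (W *ᵥ x) ^ 2) =
      l2norm (W *ᵥ x) / l2norm x := by field_simp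
  rw [e, div_le_iff₀ hx] at h1
  exact h1

end LTwoNorm

/-! ### The resolvent, its minors, and the entrywise estimate. -/

section Resolvent

open Matrix

variable {n : ℕ}

/-- The vector `(1 - t W)⁻¹ f`. -/
noncomputable def resolventVec (t : ℝ) (W : Matrix (Fin n) (Fin n) ℝ) (f : Fin n → ℝ) :
    Fin n → ℝ := (1 - t • W)⁻¹ *ᵥ f

theorem l2norm_le_two_mul_of_sub_eq {W : Matrix (Fin n) (Fin n) ℝ} {b t : ℝ}
    (hW : ∀ x, l2norm (W *ᵥ x) ≤ b * l2norm x) (hb : |t| * b ≤ 1 / 2) {g f : Fin n → ℝ}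
    (h : g - t • W *ᵥ g = f) : l2norm g ≤ 2 * l2norm f := by
  have h1 : g = f + t • W *ᵥ g := by rw [← h]; simp
  have h2 : l2norm g ≤ l2norm f + |t| * (b * l2norm g) := by
    calc l2norm g = l2norm (f + t • W *ᵥ g) := by rw [← h1]
      _ ≤ l2norm f + |t| * l2norm (W *ᵥ g) := by
          rw [← l2norm_smul]; exact l2norm_add_le _ _
      _ ≤ _ := by gcongr; exact hW g
  nlinarith [l2norm_nonneg g]

theorem isUnit_det_one_sub_smul {W : Matrix (Fin n) (Fin n) ℝ} {b t : ℝ}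
    (hW : ∀ x, l2norm (W *ᵥ x) ≤ b * l2norm x) (hb : |t| * b ≤ 1 / 2) :
    IsUnit (1 - t • W).det := by
  rw [← isUnit_iff_isUnit_det, ← mulVec_injective_iff_isUnit]
  intro x y hxy
  have h0 : (x - y) - t • W *ᵥ (x - y) = 0 := by
    have : (1 - t • W) *ᵥ (x - y) = 0 := by rw [mulVec_sub, sub_eq_zero]; exact hxy
    rw [sub_mulVec, one_mulVec, smul_mulVec] at this
    exact this
  have := l2norm_le_two_mul_of_sub_eq hW hb h0
  rw [l2norm_eq_zero.2 rfl, mul_zero] at this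
  exact sub_eq_zero.1 (l2norm_eq_zero.1 (le_antisymm this (l2norm_nonneg _)))

theorem resolventVec_spec {W : Matrix (Fin n) (Fin n) ℝ} {b t : ℝ}
    (hW : ∀ x, l2norm (W *ᵥ x) ≤ b * l2norm x) (hb : |t| * b ≤ 1 / 2) (f : Fin n → ℝ) :
    resolventVec t W f - t • W *ᵥ resolventVec t W f = f := by
  have h : (1 - t • W) *ᵥ resolventVec t W f = f := by
    rw [resolventVec, mulVec_mulVec, mul_nonsing_inv _ (isUnit_det_one_sub_smul hW hb), one_mulVec]
  rwa [sub_mulVec, one_mulVec, smul_mulVec] at h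

theorem measurable_resolventVec (t : ℝ) (f : Fin n → ℝ) :
    Measurable fun x : Edge n → ℝ => resolventVec t (symMat x) f := by
  have hs : Continuous fun x : Edge n → ℝ => (1 - t • symMat x) := by
    have h : Continuous fun x : Edge n → ℝ => symMat x :=
      continuous_matrix fun i j => continuous_apply (mkEdge i j)
    fun_prop
  refine measurable_pi_lambda _ fun i => ?_
  -- The inverse is the adjugate times the inverse determinant, with `0⁻¹ = 0`; measurability
  -- therefore holds without assuming invertibility.
  simp only [resolventVec, inv_def, Ring.inverse_eq_inv', mulVec, dotProduct, Matrix.smul_apply,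
    smul_eq_mul]
  refine Finset.measurable_sum _ fun j _ => Measurable.mul_const (Measurable.mul ?_ ?_) _
  · exact (hs.matrix_det.measurable).inv
  · exact ((continuous_apply_apply i j).comp hs.matrix_adjugate).measurable

theorem symMat_dropVertex_apply (i : Fin n) (x : Edge n → ℝ) (j k : Fin n) :
    symMat (dropVertex i x) j k = if j = i ∨ k = i then 0 else symMat x j k := by
  simp only [symMat_apply, dropVertex, mkEdge]
  have : (min j k = i ∨ max j k = i) ↔ (j = i ∨ k = i) := by
    rcases le_total j k with h | h <;> simp [h, or_comm]
  simp only [this]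

theorem l2norm_mulVec_dropVertex_le {x : Edge n → ℝ} {b : ℝ}
    (hW : ∀ v, l2norm (symMat x *ᵥ v) ≤ b * l2norm v) (i : Fin n) (hb : 0 ≤ b) (v : Fin n → ℝ) :
    l2norm (symMat (dropVertex i x) *ᵥ v) ≤ b * l2norm v := by
  set v' : Fin n → ℝ := fun k => if k = i then 0 else v k with hv'
  have h1 : l2norm v' ≤ l2norm v := l2norm_le_of_abs_le_abs fun k => by
    by_cases hk : k = i <;> simp [hv', hk]
  have h2 : l2norm (symMat (dropVertex i x) *ᵥ v) ≤ l2norm (symMat x *ᵥ v') := by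
    refine l2norm_le_of_abs_le_abs fun j => ?_
    by_cases hj : j = i
    · have : (symMat (dropVertex i x) *ᵥ v) j = 0 := by
        simp [mulVec, dotProduct, symMat_dropVertex_apply, hj]
      rw [this, abs_zero]; exact abs_nonneg _
    · have : (symMat (dropVertex i x) *ᵥ v) j = (symMat x *ᵥ v') j := by
        simp only [mulVec, dotProduct, symMat_dropVertex_apply, hj, false_or, hv']
        refine Finset.sum_congr rfl fun k _ => ?_
        by_cases hk : k = i <;> simp [hk]
      rw [this]
  calc _ ≤ _ := h2
    _ ≤ b * l2norm v' := hW v'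
    _ ≤ _ := by gcongr

/-- Comparison of the resolvents of a matrix and of its minor. -/
theorem resolvent_dropVertex_compare {x : Edge n → ℝ} {b t ω φ : ℝ} (hb : 0 ≤ b)
    (hW : ∀ v, l2norm (symMat x *ᵥ v) ≤ b * l2norm v) (htb : |t| * b ≤ ω) (hω : ω ≤ 1 / 2)
    (i : Fin n) {f g g' : Fin n → ℝ} (hf : |f i| ≤ φ) (hg : g - t • symMat x *ᵥ g = f)
    (hg' : g' - t • symMat (dropVertex i x) *ᵥ g' = f) :
    l2norm (g - g') ≤ 2 * (ω * φ + |t| * |∑ j, g' j * symMat x i j|) ∧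
    |g i - f i| ≤ |t| * |∑ j, g' j * symMat x i j| +
      ω * (2 * (ω * φ + |t| * |∑ j, g' j * symMat x i j|)) := by
  set Y := ∑ j, g' j * symMat x i j with hY
  set W := symMat x with hWdef
  have hsym : ∀ j k, W j k = W k j := fun j k => by
    simp [hWdef, symMat_apply, mkEdge_comm]
  have hω0 : 0 ≤ ω := le_trans (by positivity) htb
  have hφ0 : 0 ≤ φ := (abs_nonneg _).trans hf
  -- Row `i` of the minor is zero, so the minor's resolvent fixes the `i`-th entry.
  have hg'i : g' i = f i := by
    have := congrFun hg' i
    simp only [Pi.sub_apply, Pi.smul_apply, smul_eq_mul] at this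
    have h0 : (symMat (dropVertex i x) *ᵥ g') i = 0 := by
      simp [mulVec, dotProduct, symMat_dropVertex_apply]
    rw [h0] at this
    linarith
  -- the perturbation
  set u : Fin n → ℝ := fun j => if j = i then 0 else W j i with hu
  have hcol : l2norm (W *ᵥ Pi.single i 1) ≤ b := by
    have h := hW (Pi.single i 1)
    rwa [l2norm_single, mul_one] at h
  have hcolv : ∀ j, (W *ᵥ Pi.single i 1) j = W j i := fun j => by simp
  have hu_le : l2norm u ≤ b := by
    refine le_trans (l2norm_le_of_abs_le_abs fun j => ?_) hcol
    rw [hcolv]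
    by_cases hj : j = i <;> simp [hu, hj]
  -- Restoring vertex `i` contributes its off-diagonal column, weighted with the small entry `g' i =
  -- f i`, and in row `i` the inner product `Y`, the only term that needs a probabilistic bound.
  have hdiff : W *ᵥ g' - symMat (dropVertex i x) *ᵥ g' =
      f i • u + Y • (Pi.single i (1 : ℝ) : Fin n → ℝ) := by
    funext j
    simp only [Pi.sub_apply, Pi.add_apply, Pi.smul_apply, smul_eq_mul]
    by_cases hj : j = i
    · subst hj
      have h0 : (symMat (dropVertex j x) *ᵥ g') j = 0 := by
        simp [mulVec, dotProduct, symMat_dropVertex_apply]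
      rw [h0]
      simp only [hu, if_true, Pi.single_eq_same, mul_zero, zero_add, mul_one, sub_zero, hY, mulVec,
        dotProduct]
      exact Finset.sum_congr rfl fun k _ => mul_comm _ _
    · simp only [mulVec, dotProduct, symMat_dropVertex_apply, hj, false_or, hu, if_false,
        Pi.single_eq_of_ne hj, mul_zero, add_zero]
      rw [← Finset.sum_sub_distrib, Finset.sum_eq_single i]
      · simp [hg'i, mul_comm]
      · intro k _ hk; simp [hk, hWdef]
      · simp
  have hzn : l2norm (f i • u + Y • (Pi.single i (1 : ℝ) : Fin n → ℝ)) ≤ φ * b + |Y| := by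
    refine (l2norm_add_le _ _).trans ?_
    rw [l2norm_smul, l2norm_smul, l2norm_single, mul_one]
    have := l2norm_nonneg u
    gcongr
  have hd : (g - g') - t • W *ᵥ (g - g') =
      t • (f i • u + Y • (Pi.single i (1 : ℝ) : Fin n → ℝ)) := by
    rw [← hdiff, mulVec_sub, smul_sub, smul_sub]
    have e1 := hg
    have e2 := hg'
    rw [← e2] at e1
    have : g = g' - t • symMat (dropVertex i x) *ᵥ g' + t • W *ᵥ g := by rw [← e1]; simp
    nth_rewrite 1 [this]
    abel
  have hdn := l2norm_le_two_mul_of_sub_eq hW (htb.trans hω) hd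
  rw [l2norm_smul] at hdn
  have hD : l2norm (g - g') ≤ 2 * (ω * φ + |t| * |Y|) := by
    calc l2norm (g - g') ≤ 2 * (|t| * (φ * b + |Y|)) := hdn.trans (by gcongr)
      _ = 2 * ((|t| * b) * φ + |t| * |Y|) := by ring
      _ ≤ _ := by gcongr
  refine ⟨hD, ?_⟩
  have hgi : g i - f i = t * Y + t * (W *ᵥ (g - g')) i := by
    have := congrFun hg i
    simp only [Pi.sub_apply, Pi.smul_apply, smul_eq_mul] at this
    have hYe : Y = (W *ᵥ g') i := by
      simp only [hY, mulVec, dotProduct]; exact Finset.sum_congr rfl fun k _ => mul_comm _ _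
    rw [hYe, mulVec_sub, Pi.sub_apply]
    linarith
  rw [hgi]
  calc |t * Y + t * (W *ᵥ (g - g')) i| ≤ |t| * |Y| + |t| * |(W *ᵥ (g - g')) i| := by
        rw [← abs_mul, ← abs_mul]; exact abs_add_le _ _
    _ ≤ |t| * |Y| + |t| * (b * l2norm (g - g')) := by
        gcongr; exact (abs_le_l2norm _ _).trans (hW _)
    _ = |t| * |Y| + (|t| * b) * l2norm (g - g') := by ring
    _ ≤ _ := by
        have := l2norm_nonneg (g - g')
        gcongr

/-- If row `i` of the matrix is in general position with respect to the resolvent of the minor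
without vertex `i`, then the resolvent moves the entries of `f` by little. -/
theorem resolvent_entrywise {x : Edge n → ℝ} {b t ω φ V τ ℓ : ℝ} (hb : 0 ≤ b) (hφ : 0 ≤ φ)
    (hV : 0 ≤ V) (hℓ : 0 ≤ ℓ)
    (hW : ∀ v, l2norm (symMat x *ᵥ v) ≤ b * l2norm v) (htb : |t| * b ≤ ω)
    (htV : |t| * Real.sqrt (V * ℓ * n) ≤ ω) (htτ : |t| * (τ * ℓ) ≤ ω) (hω : ω ≤ 1 / 200)
    {f g : Fin n → ℝ} (hf : ∀ i, |f i| ≤ φ) (hg : g - t • symMat x *ᵥ g = f)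
    (hrow : ∀ i, |∑ j, resolventVec t (symMat (dropVertex i x)) f j * symMat x i j| ≤
      13 * bernsteinScale V τ ℓ (resolventVec t (symMat (dropVertex i x)) f)) (i : Fin n) :
    |g i - f i| ≤ 72 * (ω * φ) := by
  have hω0 : 0 ≤ ω := le_trans (by positivity) htb
  set g' : Fin n → Fin n → ℝ := fun i => resolventVec t (symMat (dropVertex i x)) f with hg'
  have hWi : ∀ i v, l2norm (symMat (dropVertex i x) *ᵥ v) ≤ b * l2norm v :=
    fun i => l2norm_mulVec_dropVertex_le hW i hb
  have hg's : ∀ i, g' i - t • symMat (dropVertex i x) *ᵥ g' i = f := fun i =>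
    resolventVec_spec (hWi i) (htb.trans (by linarith)) f
  set Y : Fin n → ℝ := fun i => |t| * |∑ j, g' i j * symMat x i j| with hY
  have hcmp := fun i => resolvent_dropVertex_compare hb hW htb (by linarith) i (hf i) hg (hg's i)
  -- The argument is self-consistent. The worst value `y` bounds the sup norm of every leave-one-out
  -- resolvent by `2φ + 4y`, and Bernstein's bound at the worst vertex then bounds `y` by `52ωφ +
  -- 52ωy`, whose last term is absorbed since `ω ≤ 1/200`.
  obtain ⟨i₀, -, hi₀⟩ := Finset.exists_max_image Finset.univ Y ⟨i, Finset.mem_univ i⟩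
  set y := Y i₀ with hy
  have hYy : ∀ i, Y i ≤ y := fun i => hi₀ i (Finset.mem_univ i)
  have hy0 : 0 ≤ y := by rw [hy, hY]; positivity
  have hωφ : 0 ≤ ω * φ := by positivity
  have hd : ∀ i, l2norm (g - g' i) ≤ 2 * (ω * φ + y) := fun i =>
    (hcmp i).1.trans (by have := hYy i; simp only [hY] at this; linarith)
  have he : ∀ i, |g i - f i| ≤ y + ω * (2 * (ω * φ + y)) := fun i =>
    (hcmp i).2.trans (by
      have := hYy i; simp only [hY] at this
      gcongr)
  have hsmall : y + ω * (2 * (ω * φ + y)) ≤ 2 * y + φ / 10 := by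
    have : ω * (ω * φ) ≤ φ / 200 / 200 := by
      have h1 : ω * φ ≤ 1 / 200 * φ := by gcongr
      have h2 : ω * (ω * φ) ≤ 1 / 200 * (1 / 200 * φ) := by gcongr
      linarith
    nlinarith
  have hsup : ∀ i, ‖g' i‖ ≤ 2 * φ + 4 * y := by
    intro i
    rw [pi_norm_le_iff_of_nonneg (by positivity)]
    intro j
    have h1 : |g j - g' i j| ≤ 2 * (ω * φ + y) := (abs_le_l2norm (g - g' i) j).trans (hd i)
    have h2 := (he j).trans hsmall
    have h3 := hf j
    have h4 : ω * φ ≤ 1 / 200 * φ := by gcongr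
    rw [Real.norm_eq_abs]
    have e : g' i j = f j + (g j - f j) - (g j - g' i j) := by ring
    rw [e]
    calc |f j + (g j - f j) - (g j - g' i j)| ≤ |f j| + |g j - f j| + |g j - g' i j| :=
          (abs_sub _ _).trans (by gcongr; exact abs_add_le _ _)
      _ ≤ _ := by linarith
  have hscale : |t| * bernsteinScale V τ ℓ (g' i₀) ≤ 2 * (ω * φ) + ω * (2 * φ + 4 * y) := by
    have h1 : Real.sqrt (V * ℓ * ∑ j, g' i₀ j ^ 2) ≤ Real.sqrt (V * ℓ * n) * (2 * φ) := by
      have h2 : l2norm (g' i₀) ≤ Real.sqrt n * (2 * φ) := by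
        have h3 := l2norm_le_two_mul_of_sub_eq (hWi i₀) (htb.trans (by linarith)) (hg's i₀)
        have h4 := l2norm_le_of_abs_le hφ hf
        rw [Fintype.card_fin] at h4
        linarith
      rw [Real.sqrt_mul (by positivity), ← l2norm_eq_sqrt, Real.sqrt_mul (by positivity) (n : ℝ),
        mul_assoc]
      gcongr
    unfold bernsteinScale
    rw [mul_add]
    refine add_le_add ?_ ?_
    · calc |t| * Real.sqrt (V * ℓ * ∑ j, g' i₀ j ^ 2)
          ≤ |t| * (Real.sqrt (V * ℓ * n) * (2 * φ)) := by gcongr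
        _ = (|t| * Real.sqrt (V * ℓ * n)) * (2 * φ) := by ring
        _ ≤ ω * (2 * φ) := by gcongr
        _ = _ := by ring
    · calc |t| * (τ * ℓ * ‖g' i₀‖) = (|t| * (τ * ℓ)) * ‖g' i₀‖ := by ring
        _ ≤ ω * (2 * φ + 4 * y) := by gcongr; exact hsup i₀
  have hyb : y ≤ 13 * (2 * (ω * φ) + ω * (2 * φ + 4 * y)) := by
    have := mul_le_mul_of_nonneg_left (hrow i₀) (abs_nonneg t)
    calc y ≤ |t| * (13 * bernsteinScale V τ ℓ (g' i₀)) := this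
      _ = 13 * (|t| * bernsteinScale V τ ℓ (g' i₀)) := by ring
      _ ≤ _ := by gcongr
  have hωy : ω * y ≤ 1 / 200 * y := by gcongr
  have hy2 : y ≤ 71 * (ω * φ) := by nlinarith
  have h5 : ω * (ω * φ) ≤ 1 / 200 * (ω * φ) := by gcongr
  have := he i
  nlinarith

/-- Equally spaced points of `[-t₀, t₀]`. -/
noncomputable def gridPoint (t₀ : ℝ) (n : ℕ) (k : Fin (2 * n + 1)) : ℝ := t₀ * (((k : ℝ) - n) / n)

theorem abs_gridPoint_le {t₀ : ℝ} (ht₀ : 0 ≤ t₀) (hn : 0 < n) (k : Fin (2 * n + 1)) :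
    |gridPoint t₀ n k| ≤ t₀ := by
  have hk : (k : ℝ) ≤ 2 * n := by
    have : (k : ℕ) ≤ 2 * n := by omega
    exact_mod_cast this
  have hn' : (0 : ℝ) < n := by exact_mod_cast hn
  have h0 : (0 : ℝ) ≤ (k : ℝ) := by positivity
  rw [gridPoint, abs_mul, abs_of_nonneg ht₀]
  have : |((k : ℝ) - n) / n| ≤ 1 := by
    rw [abs_div, abs_of_pos hn', div_le_one hn', abs_le]
    constructor <;> linarith
  nlinarith

theorem exists_gridPoint_near {t₀ t : ℝ} (ht₀ : 0 < t₀) (hn : 0 < n) (ht : |t| ≤ t₀) :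
    ∃ k, |t - gridPoint t₀ n k| ≤ t₀ / n := by
  have hn' : (0 : ℝ) < n := by exact_mod_cast hn
  set u := (t / t₀ + 1) * n with hu
  have hu1 : |t / t₀| ≤ 1 := by rw [abs_div, abs_of_pos ht₀, div_le_one ht₀]; exact ht
  have hu0 : 0 ≤ u := by
    have := (abs_le.1 hu1).1
    have h : 0 ≤ t / t₀ + 1 := by linarith
    positivity
  have hu2 : u ≤ 2 * n := by
    have := (abs_le.1 hu1).2
    rw [hu]; nlinarith
  have hfl : ⌊u⌋₊ < 2 * n + 1 := by
    have : ⌊u⌋₊ ≤ 2 * n := by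
      rw [← Nat.floor_natCast (R := ℝ) (2 * n)]
      exact Nat.floor_le_floor (by push_cast; exact hu2)
    omega
  refine ⟨⟨⌊u⌋₊, hfl⟩, ?_⟩
  have h1 := Nat.floor_le hu0
  have h2 := (Nat.lt_floor_add_one u).le
  have e : t - gridPoint t₀ n ⟨⌊u⌋₊, hfl⟩ = t₀ / n * (u - ⌊u⌋₊) := by
    simp only [gridPoint, hu]; field_simp; ring
  rw [e, abs_mul, abs_of_pos (by positivity)]
  have : |u - ⌊u⌋₊| ≤ 1 := by rw [abs_le]; constructor <;> linarith
  have h3 : 0 < t₀ / n := by positivity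
  nlinarith

/-- A union bound handles only finitely many `t`. Between grid points, at distance at most `t₀/n`,
the crude `ℓ²` Lipschitz bound suffices because `l2norm f ≤ √n φ ≤ n φ`; this adds `4ωφ`. -/
theorem resolvent_entrywise_of_grid {x : Edge n → ℝ} {b t₀ ω φ V τ ℓ : ℝ} (hn : 0 < n) (hb : 0 ≤ b)
    (hφ : 0 ≤ φ) (hV : 0 ≤ V) (hτ : 0 ≤ τ) (hℓ : 0 ≤ ℓ) (ht₀ : 0 < t₀)
    (hW : ∀ v, l2norm (symMat x *ᵥ v) ≤ b * l2norm v) (htb : t₀ * b ≤ ω)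
    (htV : t₀ * Real.sqrt (V * ℓ * n) ≤ ω) (htτ : t₀ * (τ * ℓ) ≤ ω) (hω : ω ≤ 1 / 200)
    {f : Fin n → ℝ} (hf : ∀ i, |f i| ≤ φ)
    (hrow : ∀ i k, |∑ j, resolventVec (gridPoint t₀ n k) (symMat (dropVertex i x)) f j *
        symMat x i j| ≤
      13 * bernsteinScale V τ ℓ (resolventVec (gridPoint t₀ n k) (symMat (dropVertex i x)) f))
    {t : ℝ} (ht : |t| ≤ t₀) (i : Fin n) :
    |resolventVec t (symMat x) f i - f i| ≤ 76 * (ω * φ) := by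
  have hn' : (0 : ℝ) < n := by exact_mod_cast hn
  obtain ⟨k, hk⟩ := exists_gridPoint_near ht₀ hn ht
  set s := gridPoint t₀ n k with hs
  have hst : |s| ≤ t₀ := abs_gridPoint_le ht₀.le hn k
  have htb' : |t| * b ≤ ω := le_trans (by gcongr) htb
  have hsb' : |s| * b ≤ ω := le_trans (by gcongr) htb
  have hgt := resolventVec_spec hW (htb'.trans (by linarith)) f
  have hgs := resolventVec_spec hW (hsb'.trans (by linarith)) f
  have h1 := resolvent_entrywise hb hφ hV hℓ hW hsb'
    (le_trans (by gcongr) htV) (le_trans (by gcongr) htτ) hω hf hgs (fun i => hrow i k) i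
  set g := resolventVec t (symMat x) f
  set h := resolventVec s (symMat x) f
  have hdiff : (g - h) - t • symMat x *ᵥ (g - h) = (t - s) • symMat x *ᵥ h := by
    have e : g - t • symMat x *ᵥ g = h - s • symMat x *ᵥ h := hgt.trans hgs.symm
    rw [mulVec_sub, smul_sub, sub_smul]
    have e' : g = h - s • symMat x *ᵥ h + t • symMat x *ᵥ g := by rw [← e]; simp
    nth_rewrite 1 [e']
    abel
  have h2 := l2norm_le_two_mul_of_sub_eq hW (htb'.trans (by linarith)) hdiff
  have h3 := l2norm_le_two_mul_of_sub_eq hW (hsb'.trans (by linarith)) hgs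
  have h4 := l2norm_le_of_abs_le hφ hf
  rw [Fintype.card_fin] at h4
  rw [l2norm_smul] at h2
  have hsqrt : Real.sqrt n ≤ n := by
    rw [Real.sqrt_le_left (by positivity)]
    have : (1 : ℝ) ≤ n := by exact_mod_cast hn
    nlinarith
  have h5 : l2norm (g - h) ≤ 4 * (ω * φ) := by
    calc l2norm (g - h) ≤ 2 * (|t - s| * l2norm (symMat x *ᵥ h)) := h2
      _ ≤ 2 * ((t₀ / n) * (b * (2 * (n * φ)))) := by
          have := l2norm_nonneg (symMat x *ᵥ h)
          gcongr
          refine (hW h).trans ?_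
          gcongr
          exact h3.trans (by gcongr; exact h4.trans (by gcongr))
      _ = 4 * ((t₀ * b) * φ) := by field_simp; ring
      _ ≤ _ := by gcongr
  have h6 := (abs_le_l2norm (g - h) i).trans h5
  rw [Pi.sub_apply] at h6
  have e : g i - f i = (g i - h i) + (h i - f i) := by ring
  rw [e]
  exact (abs_add_le _ _).trans (by linarith)

end Resolvent

/-! ### Existence of outputs of the algorithm -/

section Existence

open Matrix

theorem exists_isLeadingEigen {n K : ℕ} (hK : K ≤ n) {A : Matrix (Fin n) (Fin n) ℝ}
    (hA : Aᵀ = A) : ∃ (U : Matrix (Fin n) (Fin K) ℝ) (lam : Fin K → ℝ), IsLeadingEigen A U lam := by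
  have hH : A.IsHermitian := by
    rw [IsHermitian, conjTranspose_eq_transpose_of_trivial, hA]
  obtain ⟨V, d, hV, hV', hAV⟩ := hH.exists_orthogonal_diagonal
  have hAV2 : A * V = V * diagonal d := by
    rw [hAV, Matrix.mul_assoc, hV, Matrix.mul_one]
  -- Sorting `-|d|` increasingly lists the eigenvalues by decreasing magnitude.
  set σ := Tuple.sort (fun i => -|d i|) with hσ
  have hmono : Monotone ((fun i => -|d i|) ∘ σ) := Tuple.monotone_sort _
  set e : Fin K → Fin n := fun k => σ (Fin.castLE hK k) with he
  have heinj : Function.Injective e := σ.injective.comp (Fin.castLE_injective hK)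
  refine ⟨V.submatrix id e, fun k => d (e k), ?_, ?_, ?_, ?_⟩
  · ext k l
    have := congrFun (congrFun hV (e k)) (e l)
    simp only [Matrix.mul_apply, transpose_apply, submatrix_apply, id, one_apply] at this ⊢
    rw [this]
    simp [heinj.eq_iff]
  · ext i k
    have := congrFun (congrFun hAV2 i) (e k)
    rw [mul_diagonal] at this ⊢
    simpa [Matrix.mul_apply] using this
  · intro k l hkl
    have := hmono (show Fin.castLE hK k ≤ Fin.castLE hK l from hkl)
    simp only [Function.comp] at this
    simpa using this
  · intro v ν hv hAv hUv k
    set c := Vᵀ *ᵥ v with hc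
    have hvc : v = V *ᵥ c := by rw [hc, mulVec_mulVec, hV', one_mulVec]
    have hc0 : c ≠ 0 := by
      intro h; apply hv; rw [hvc, h, mulVec_zero]
    obtain ⟨j, hj⟩ := Function.ne_iff.1 hc0
    have hdc : d j * c j = ν * c j := by
      have h1 : Vᵀ *ᵥ (A *ᵥ v) = ν • c := by rw [hAv, mulVec_smul]
      have h2 : Vᵀ *ᵥ (A *ᵥ v) = diagonal d *ᵥ c := by
        rw [hvc, mulVec_mulVec, mulVec_mulVec, Matrix.mul_assoc, hAV2, ← Matrix.mul_assoc, hV, Matrix.one_mul]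
      have := congrFun (h2.symm.trans h1) j
      simpa [mulVec_diagonal] using this
    have hdν : d j = ν := mul_right_cancel₀ hj hdc
    -- A nonzero coordinate at one of the first `K` positions would contradict orthogonality to the
    -- chosen columns.
    have hjn : K ≤ (σ.symm j : ℕ) := by
      by_contra hlt
      push Not at hlt
      apply hj
      have := congrFun hUv ⟨σ.symm j, hlt⟩
      have hej : e ⟨σ.symm j, hlt⟩ = j := by
        simp only [he]
        have : Fin.castLE hK ⟨σ.symm j, hlt⟩ = σ.symm j := by ext; simp
        rw [this, Equiv.apply_symm_apply]
      simp only [mulVec, dotProduct, transpose_apply, submatrix_apply, id, hej,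
        Pi.zero_apply] at this
      simpa [hc, mulVec, dotProduct] using this
    have hle : Fin.castLE hK k ≤ σ.symm j := by
      rw [Fin.le_def]; simp; omega
    have := hmono hle
    simp only [Function.comp, Equiv.apply_symm_apply, neg_le_neg_iff] at this
    rw [← hdν]
    exact this

variable {n K : ℕ}

/-- The smallest inner product is a continuous function of `w` and attains its maximum on the
compact unit ball. -/
theorem exists_isOneClassSVM [NeZero n] (x : Fin n → EuclideanSpace ℝ (Fin K)) :
    ∃ w b, IsOneClassSVM x w b := by
  set f : EuclideanSpace ℝ (Fin K) → ℝ :=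
    fun w => Finset.univ.inf' Finset.univ_nonempty fun i => inner ℝ w (x i) with hf
  have hfc : Continuous f := by
    refine Continuous.finset_inf'_apply _ fun i _ => ?_
    fun_prop
  obtain ⟨w, hw, hmax⟩ := (isCompact_closedBall (0 : EuclideanSpace ℝ (Fin K)) 1).exists_isMaxOn
    ⟨0, by simp⟩ hfc.continuousOn
  refine ⟨w, f w, by simpa using hw, fun i => Finset.inf'_le _ (Finset.mem_univ i), ?_⟩
  intro w' b' hw' hb'
  have h1 : b' ≤ f w' := (Finset.le_inf'_iff _ _).2 fun i _ => hb' i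
  exact h1.trans (hmax (by simpa using hw'))

/-- The least inner product is itself a feasible margin, so optimality forces it to be at most `b`.
-/
theorem nearHyperplane_nonempty [NeZero n] {x : Fin n → EuclideanSpace ℝ (Fin K)}
    {w : EuclideanSpace ℝ (Fin K)} {b δ : ℝ} (h : IsOneClassSVM x w b) (hδ : 0 ≤ δ) :
    (nearHyperplane x w b δ).Nonempty := by
  obtain ⟨i, -, hi⟩ := Finset.exists_min_image Finset.univ (fun i => inner ℝ w (x i))
    Finset.univ_nonempty
  refine ⟨i, ?_⟩
  have := h.optimal w (inner ℝ w (x i)) h.norm_le fun j => hi j (Finset.mem_univ j)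
  simp only [nearHyperplane, Finset.mem_filter, Finset.mem_univ, true_and]
  linarith

theorem exists_isFarthestFirst (x : Fin n → EuclideanSpace ℝ (Fin K)) {N : Finset (Fin n)}
    (hN : N.Nonempty) : ∃ s : Fin K → Fin n, IsFarthestFirst x N s := by
  -- Seeds indexed by `ℕ` allow one seed at a time to be appended without touching the earlier ones.
  have key : ∀ m : ℕ, ∃ s : ℕ → Fin n, ∀ k < m, s k ∈ N ∧
      ∀ i ∈ N, Metric.infDist (x i) {y | ∃ j < k, y = x (s j)} ≤
        Metric.infDist (x (s k)) {y | ∃ j < k, y = x (s j)} := by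
    intro m
    induction m with
    | zero => exact ⟨fun _ => hN.choose, fun k hk => absurd hk (Nat.not_lt_zero k)⟩
    | succ m ih =>
      obtain ⟨s, hs⟩ := ih
      obtain ⟨i₀, hi₀, hmax⟩ := Finset.exists_max_image N
        (fun i => Metric.infDist (x i) {y | ∃ j < m, y = x (s j)}) hN
      refine ⟨Function.update s m i₀, fun k hk => ?_⟩
      have hset : {y | ∃ j < k, y = x (Function.update s m i₀ j)} =
          {y | ∃ j < k, y = x (s j)} := by
        ext y
        constructor <;> rintro ⟨j, hj, rfl⟩ <;> refine ⟨j, hj, ?_⟩ <;>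
          rw [Function.update_of_ne (by omega)]
      rw [hset]
      rcases Nat.lt_succ_iff_lt_or_eq.1 hk with h | h
      · rw [Function.update_of_ne (by omega)]
        exact hs k h
      · subst h
        rw [Function.update_self]
        exact ⟨hi₀, hmax⟩
  obtain ⟨s, hs⟩ := key K
  refine ⟨fun k => s k, fun k => ?_⟩
  have hset : {y | ∃ j < k, y = x (s j)} = {y | ∃ j < (k : ℕ), y = x (s j)} := by
    ext y
    constructor
    · rintro ⟨j, hj, rfl⟩; exact ⟨j, hj, rfl⟩
    · rintro ⟨j, hj, rfl⟩; exact ⟨⟨j, hj.trans k.2⟩, hj, rfl⟩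
  rw [hset]
  exact hs k k.2

theorem exists_isNearestLabelling [NeZero K] (x : Fin n → EuclideanSpace ℝ (Fin K))
    (N : Finset (Fin n)) (m : Fin K → EuclideanSpace ℝ (Fin K)) :
    ∃ c, IsNearestLabelling x N m c := by
  have h : ∀ i, ∃ k, ∀ l, dist (x i) (m k) ≤ dist (x i) (m l) := by
    intro i
    obtain ⟨k, -, hk⟩ := Finset.exists_min_image Finset.univ (fun k => dist (x i) (m k))
      Finset.univ_nonempty
    exact ⟨k, fun l => hk l (Finset.mem_univ l)⟩
  choose c hc using h
  exact ⟨c, fun i _ => hc i⟩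

theorem exists_isSVMCone [NeZero n] [NeZero K] (x : Fin n → EuclideanSpace ℝ (Fin K)) {δ : ℝ}
    (hδ : 0 ≤ δ) : ∃ I, IsSVMCone x δ I := by
  classical
  obtain ⟨w, b, hwb⟩ := exists_isOneClassSVM x
  have hN := nearHyperplane_nonempty hwb hδ
  obtain ⟨s, hs⟩ := exists_isFarthestFirst x hN
  obtain ⟨c, hc⟩ := exists_isNearestLabelling x (nearHyperplane x w b δ) fun k => x (s k)
  have hI : ∀ k, ∃ j, j ∈ nearHyperplane x w b δ ∧
      ((∃ i ∈ nearHyperplane x w b δ, c i = k) → c j = k) := by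
    intro k
    by_cases h : ∃ i ∈ nearHyperplane x w b δ, c i = k
    · obtain ⟨i, hi, hik⟩ := h
      exact ⟨i, hi, fun _ => hik⟩
    · obtain ⟨i, hi⟩ := hN
      exact ⟨i, hi, fun h' => absurd h' h⟩
  choose I hI using hI
  exact ⟨I, w, b, c, hwb, ⟨_, .seed s hs, hc⟩, hI⟩

theorem exists_isScD (hn : 0 < n) (hK : 0 < K) (hKn : K ≤ n) {A : Matrix (Fin n) (Fin n) ℝ}
    (hA : Aᵀ = A) {δ : ℝ} (hδ : 0 ≤ δ) : ∃ Pihat : Matrix (Fin n) (Fin K) ℝ, IsScD A δ Pihat := by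
  have : NeZero n := ⟨hn.ne'⟩
  have : NeZero K := ⟨hK.ne'⟩
  obtain ⟨U, lam, hU⟩ := exists_isLeadingEigen hKn hA
  obtain ⟨I, hI⟩ := exists_isSVMCone (rowVec (rowNormalize U)) hδ
  exact ⟨Matrix.of fun i k => zMatrix U lam I i k / ∑ l, |zMatrix U lam I i l|, U, lam, I, hU, hI,
    fun i k => rfl⟩

/-- Each row is normalized, or zero by the convention for division by zero; this feeds the trivial
error bound. -/
theorem sum_abs_row_le_one_of_isScD {A : Matrix (Fin n) (Fin n) ℝ} {δ : ℝ}
    {Pihat : Matrix (Fin n) (Fin K) ℝ} (h : IsScD A δ Pihat) (i : Fin n) :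
    ∑ k, |Pihat i k| ≤ 1 := by
  obtain ⟨U, lam, I, -, -, h⟩ := h
  simp only [h, abs_div]
  rw [← Finset.sum_div, abs_of_nonneg (Finset.sum_nonneg fun l _ => abs_nonneg _)]
  exact div_self_le_one _

end Existence

/-! ### Correctness of k-means on well separated groups -/

section KMeans

variable {n K : ℕ}

theorem norm_centroid_sub_le {E : Type*} [NormedAddCommGroup E] [NormedSpace ℝ E] {ι : Type*}
    (s : Finset ι) (hs : s.Nonempty) (x : ι → E) (v : E) {η : ℝ} (h : ∀ i ∈ s, ‖x i - v‖ ≤ η) :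
    ‖(s.card : ℝ)⁻¹ • ∑ i ∈ s, x i - v‖ ≤ η := by
  have hc : (0 : ℝ) < s.card := by exact_mod_cast hs.card_pos
  have e : (s.card : ℝ)⁻¹ • ∑ i ∈ s, x i - v = (s.card : ℝ)⁻¹ • ∑ i ∈ s, (x i - v) := by
    rw [Finset.sum_sub_distrib, Finset.sum_const, smul_sub, ← Nat.cast_smul_eq_nsmul ℝ,
      smul_smul, inv_mul_cancel₀ hc.ne', one_smul]
  rw [e, norm_smul, Real.norm_of_nonneg (by positivity)]
  calc (s.card : ℝ)⁻¹ * ‖∑ i ∈ s, (x i - v)‖ ≤ (s.card : ℝ)⁻¹ * ∑ i ∈ s, η := by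
        gcongr; exact norm_sum_le_of_le _ h
    _ = η := by rw [Finset.sum_const, nsmul_eq_mul]; field_simp

/-- The points of `N` form tight groups around the well separated points `v l`. -/
structure IsSeparated (x : Fin n → EuclideanSpace ℝ (Fin K)) (N : Finset (Fin n))
    (v : Fin K → EuclideanSpace ℝ (Fin K)) (L : Fin n → Fin K) (η : ℝ) : Prop where
  near : ∀ i ∈ N, ‖x i - v (L i)‖ ≤ η
  surj : ∀ l, ∃ i ∈ N, L i = l
  sep : ∀ k l, k ≠ l → 4 * η < ‖v k - v l‖

variable {x : Fin n → EuclideanSpace ℝ (Fin K)} {N : Finset (Fin n)}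
    {v : Fin K → EuclideanSpace ℝ (Fin K)} {L : Fin n → Fin K} {η : ℝ}

/-- The center of the right group is within `2η` of the point. A center of another group at least as
close would put two of the `v l` within `4η` of each other. -/
theorem IsSeparated.labelling (h : IsSeparated x N v L η) {m : Fin K → EuclideanSpace ℝ (Fin K)}
    {π : Equiv.Perm (Fin K)} (hm : ∀ k, ‖m k - v (π k)‖ ≤ η) {c : Fin n → Fin K}
    (hc : IsNearestLabelling x N m c) {i : Fin n} (hi : i ∈ N) : π (c i) = L i := by
  by_contra hne
  have h1 := hc i hi (π.symm (L i))
  have h2 := hm (π.symm (L i))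
  rw [Equiv.apply_symm_apply] at h2
  have h3 := hm (c i)
  have h4 := h.near i hi
  have h5 := h.sep _ _ hne
  rw [dist_eq_norm, dist_eq_norm] at h1
  have h6 : ‖x i - m (π.symm (L i))‖ ≤ 2 * η := by
    calc ‖x i - m (π.symm (L i))‖ = ‖(x i - v (L i)) - (m (π.symm (L i)) - v (L i))‖ := by
          congr 1; abel
      _ ≤ _ := (norm_sub_le _ _).trans (by linarith)
  have h7 : ‖v (π (c i)) - v (L i)‖ ≤ ‖m (c i) - v (π (c i))‖ + ‖x i - m (c i)‖ +
      ‖x i - v (L i)‖ := by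
    calc ‖v (π (c i)) - v (L i)‖
        = ‖-(m (c i) - v (π (c i))) - (x i - m (c i)) + (x i - v (L i))‖ := by
          congr 1; abel
      _ ≤ ‖-(m (c i) - v (π (c i))) - (x i - m (c i))‖ + ‖x i - v (L i)‖ := norm_add_le _ _
      _ ≤ _ := by
          gcongr
          refine (norm_sub_le _ _).trans ?_
          rw [norm_neg]
  linarith

/-- While some group has no seed, its points are farther than `2η` from all seeds, whereas points of
a seeded group are within `2η` of one; so farthest-first seeding hits every group once. A Lloyd step
preserves this, since each cluster is one group and its centroid stays within `η` of `v (π k)`. -/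
theorem IsSeparated.centers (h : IsSeparated x N v L η) {m : Fin K → EuclideanSpace ℝ (Fin K)}
    (hm : IsKMeansCenters x N m) : ∃ π : Equiv.Perm (Fin K), ∀ k, ‖m k - v (π k)‖ ≤ η := by
  induction hm with
  | seed s hs =>
    have hinj : Function.Injective fun k => L (s k) := by
      have key : ∀ j k : Fin K, j < k → L (s j) ≠ L (s k) := by
        intro j k hjk hL
        obtain ⟨hk, hmax⟩ := hs k
        -- some group contains none of the earlier seeds
        obtain ⟨l, hl⟩ : ∃ l, ∀ j < k, L (s j) ≠ l := by
          by_contra hcon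
          push Not at hcon
          have hsub : (Finset.univ : Finset (Fin K)) ⊆
              (Finset.univ.filter fun j => j < k).image fun j => L (s j) := by
            intro l _
            obtain ⟨j, hj, hjl⟩ := hcon l
            exact Finset.mem_image.2 ⟨j, by simp [hj], hjl⟩
          have h1 := (Finset.card_le_card hsub).trans Finset.card_image_le
          have h2 : (Finset.univ.filter fun j => j < k).card < K := by
            have : (Finset.univ.filter fun j => j < k) ⊂ (Finset.univ : Finset (Fin K)) := by
              refine Finset.filter_ssubset.2 ⟨k, Finset.mem_univ k, by simp⟩
            simpa using Finset.card_lt_card this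
          simp only [Finset.card_univ, Fintype.card_fin] at h1
          omega
        obtain ⟨i, hi, hil⟩ := h.surj l
        have h1 := hmax i hi
        have h2 : Metric.infDist (x (s k)) {y | ∃ j < k, y = x (s j)} ≤ 2 * η := by
          have hmem : x (s j) ∈ {y | ∃ j < k, y = x (s j)} := ⟨j, hjk, rfl⟩
          refine (Metric.infDist_le_dist_of_mem hmem).trans ?_
          rw [dist_eq_norm]
          have a1 := h.near _ hk
          have a2 := h.near _ (hs j).1
          rw [hL] at a2
          calc ‖x (s k) - x (s j)‖ = ‖(x (s k) - v (L (s k))) - (x (s j) - v (L (s k)))‖ := by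
                congr 1; abel
            _ ≤ _ := (norm_sub_le _ _).trans (by linarith)
        have h3 : 2 * η < Metric.infDist (x i) {y | ∃ j < k, y = x (s j)} := by
          have hfin : {y | ∃ j < k, y = x (s j)}.Finite := by
            refine (Set.finite_range fun j => x (s j)).subset ?_
            rintro y ⟨j, -, rfl⟩; exact ⟨j, rfl⟩
          obtain ⟨y, ⟨j', hj', rfl⟩, hy⟩ := hfin.isCompact.exists_infDist_eq_dist
            ⟨x (s j), j, hjk, rfl⟩ (x i)
          rw [hy, dist_eq_norm]
          have a1 := h.near _ hi
          have a2 := h.near _ (hs j').1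
          have a3 := h.sep _ _ (hl j' hj')
          rw [hil] at a1
          have : ‖v (L (s j')) - v l‖ ≤ ‖x (s j') - v (L (s j'))‖ + ‖x i - x (s j')‖ +
              ‖x i - v l‖ := by
            calc ‖v (L (s j')) - v l‖
                = ‖-(x (s j') - v (L (s j'))) - (x i - x (s j')) + (x i - v l)‖ := by
                  congr 1; abel
              _ ≤ ‖-(x (s j') - v (L (s j'))) - (x i - x (s j'))‖ + ‖x i - v l‖ := norm_add_le _ _
              _ ≤ _ := by
                  gcongr
                  refine (norm_sub_le _ _).trans ?_
                  rw [norm_neg]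
          linarith
        linarith
      intro j k hjk
      by_contra hne
      rcases lt_or_gt_of_ne hne with hlt | hlt
      · exact key j k hlt hjk
      · exact key k j hlt hjk.symm
    refine ⟨Equiv.ofBijective _ (Finite.injective_iff_bijective.1 hinj), fun k => ?_⟩
    exact h.near _ (hs k).1
  | step m c hm hc ih =>
    obtain ⟨π, hπ⟩ := ih
    refine ⟨π, fun k => ?_⟩
    unfold centroids
    split_ifs with hne
    · refine norm_centroid_sub_le _ hne x _ fun i hi => ?_
      rw [Finset.mem_filter] at hi
      have := h.labelling hπ hc hi.1
      rw [hi.2] at this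
      rw [this]
      exact h.near i hi.1
    · exact hπ k

theorem IsSeparated.exists_perm (h : IsSeparated x N v L η) {c : Fin n → Fin K}
    (hc : IsKMeans x N c) {I : Fin K → Fin n}
    (hI : ∀ k, I k ∈ N ∧ ((∃ i ∈ N, c i = k) → c (I k) = k)) :
    ∃ π : Equiv.Perm (Fin K), ∀ k, ‖x (I k) - v (π k)‖ ≤ η := by
  obtain ⟨m, hm, hmc⟩ := hc
  obtain ⟨π, hπ⟩ := h.centers hm
  refine ⟨π, fun k => ?_⟩
  obtain ⟨i, hi, hik⟩ := h.surj (π k)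
  have hci : c i = k := π.injective ((h.labelling hπ hmc hi).trans hik)
  have h1 := h.labelling hπ hmc (hI k).1
  rw [(hI k).2 ⟨i, hi, hci⟩] at h1
  rw [h1]
  exact h.near _ (hI k).1

end KMeans

/-! ### The one-class SVM on a perturbed simplicial cone -/

section SVM

open scoped RealInnerProductSpace

variable {n K : ℕ}

/-- Unit vectors `v l` that span a simplicial cone, with their dual vectors `v' l`, whose Gram
matrix is `g`; all the quantities involved are controlled by `M`. -/
structure IsConeFrame (v v' : Fin K → EuclideanSpace ℝ (Fin K)) (g : Fin K → Fin K → ℝ)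
    (M : ℝ) : Prop where
  one_le : 1 ≤ M
  card_le : (K : ℝ) ≤ M
  norm_eq : ∀ l, ‖v l‖ = 1
  dual : ∀ k l, ⟪v' k, v l⟫ = if k = l then 1 else 0
  dual_eq : ∀ k, v' k = ∑ m, g k m • v m
  norm_dual : ∀ k, ‖v' k‖ ≤ M
  gram_le : ∀ k m, |g k m| ≤ M
  row_sum : ∀ k, M⁻¹ ≤ ∑ m, g k m

variable {v v' : Fin K → EuclideanSpace ℝ (Fin K)} {g : Fin K → Fin K → ℝ} {M : ℝ}

namespace IsConeFrame

theorem gram_eq (h : IsConeFrame v v' g M) (k m : Fin K) : g k m = ⟪v' k, v' m⟫ := by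
  conv_rhs => rw [h.dual_eq k]
  rw [sum_inner]
  simp only [real_inner_smul_left]
  rw [Finset.sum_eq_single m]
  · rw [real_inner_comm, h.dual]; simp
  · intro b _ hb
    rw [real_inner_comm, h.dual, if_neg (Ne.symm hb), mul_zero]
  · simp

theorem gram_symm (h : IsConeFrame v v' g M) (k m : Fin K) : g k m = g m k := by
  rw [h.gram_eq, h.gram_eq, real_inner_comm]

theorem sum_dual_eq (h : IsConeFrame v v' g M) : ∑ k, v' k = ∑ m, (∑ k, g m k) • v m := by
  simp only [Finset.sum_smul]
  rw [Finset.sum_comm]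
  refine Finset.sum_congr rfl fun k _ => ?_
  rw [h.dual_eq k]
  exact Finset.sum_congr rfl fun m _ => by rw [h.gram_symm]

/-- The sum of the dual vectors is normal to the hyperplane through the corners, and normalized it
is the ideal SVM solution. Its coefficients in the corners are the row sums of `g`; their positivity
is what makes every corner a support vector. -/
theorem inner_sum_dual (h : IsConeFrame v v' g M) (l : Fin K) : ⟪∑ k, v' k, v l⟫ = 1 := by
  rw [sum_inner]; simp [h.dual]

theorem inner_sum_dual_right (h : IsConeFrame v v' g M) (w : EuclideanSpace ℝ (Fin K)) :
    ⟪∑ k, v' k, w⟫ = ∑ m, (∑ k, g m k) * ⟪w, v m⟫ := by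
  rw [h.sum_dual_eq, sum_inner]
  exact Finset.sum_congr rfl fun m _ => by rw [real_inner_smul_left, real_inner_comm]

theorem norm_sq_sum_dual (h : IsConeFrame v v' g M) : ‖∑ k, v' k‖ ^ 2 = ∑ m, ∑ k, g m k := by
  rw [← real_inner_self_eq_norm_sq, h.inner_sum_dual_right]
  simp [h.inner_sum_dual]

theorem one_le_norm_sum_dual (h : IsConeFrame v v' g M) (l : Fin K) : 1 ≤ ‖∑ k, v' k‖ := by
  have h1 := real_inner_le_norm (∑ k, v' k) (v l)
  rwa [h.inner_sum_dual, h.norm_eq, mul_one] at h1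

theorem norm_sum_dual_le (h : IsConeFrame v v' g M) : ‖∑ k, v' k‖ ≤ M ^ 2 := by
  have h1 := h.one_le
  calc ‖∑ k, v' k‖ ≤ ∑ _k : Fin K, M := norm_sum_le_of_le _ fun k _ => h.norm_dual k
    _ = K * M := by simp
    _ ≤ M ^ 2 := by nlinarith [h.card_le]

theorem norm_sq_sum_dual_le (h : IsConeFrame v v' g M) : ‖∑ k, v' k‖ ^ 2 ≤ M ^ 3 := by
  have h1 := h.one_le
  have h2 : (0 : ℝ) ≤ K := Nat.cast_nonneg _
  rw [h.norm_sq_sum_dual]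
  calc ∑ m, ∑ k, g m k ≤ ∑ _m : Fin K, ∑ _k : Fin K, M :=
        Finset.sum_le_sum fun m _ => Finset.sum_le_sum fun k _ => (le_abs_self _).trans
          (h.gram_le m k)
    _ = K * K * M := by simp; ring
    _ ≤ M * M * M := by gcongr <;> exact h.card_le
    _ = M ^ 3 := by ring

theorem inv_le_norm_sub (h : IsConeFrame v v' g M) {k l : Fin K} (hkl : k ≠ l) :
    M⁻¹ ≤ ‖v k - v l‖ := by
  have hM : 0 < M := lt_of_lt_of_le one_pos h.one_le
  have h1 := real_inner_le_norm (v' k) (v k - v l)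
  rw [inner_sub_right, h.dual, h.dual, if_pos rfl, if_neg hkl, sub_zero] at h1
  have h2 : 1 ≤ M * ‖v k - v l‖ := h1.trans (by gcongr; exact h.norm_dual k)
  rw [inv_le_iff_one_le_mul₀ hM]
  linarith

theorem inv_sq_le_one_sub_inner (h : IsConeFrame v v' g M) {k l : Fin K} (hkl : k ≠ l) :
    (2 * M ^ 2)⁻¹ ≤ 1 - ⟪v k, v l⟫ := by
  have hM : 0 < M := lt_of_lt_of_le one_pos h.one_le
  have h1 := norm_sub_sq_real (v k) (v l)
  rw [h.norm_eq, h.norm_eq] at h1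
  have h2 : (M⁻¹) ^ 2 ≤ ‖v k - v l‖ ^ 2 := pow_le_pow_left₀ (by positivity)
    (h.inv_le_norm_sub hkl) 2
  have h3 : (2 * M ^ 2)⁻¹ = (M⁻¹) ^ 2 / 2 := by field_simp
  rw [h3]; linarith

/-- A unit vector of the cone whose coordinate sum is close to one is close to a corner. -/
theorem exists_corner (h : IsConeFrame v v' g M) {α : Fin K → ℝ} (hα : ∀ l, 0 ≤ α l)
    (hx : ‖∑ l, α l • v l‖ = 1) {ζ : ℝ} (hζ0 : 0 ≤ ζ) (hζ1 : ζ ≤ 1)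
    (hsum : ∑ l, α l ≤ 1 + ζ) :
    ∃ k, ‖∑ l, α l • v l - v k‖ ≤ 7 * M ^ 4 * ζ := by
  have hM1 := h.one_le
  have hM : 0 < M := lt_of_lt_of_le one_pos hM1
  have hs1 : 1 ≤ ∑ l, α l := by
    rw [← hx]
    refine (norm_sum_le _ _).trans (Finset.sum_le_sum fun l _ => ?_)
    rw [norm_smul, h.norm_eq, mul_one, Real.norm_of_nonneg (hα l)]
  have hne : (Finset.univ : Finset (Fin K)).Nonempty := by
    by_contra hne
    rw [Finset.not_nonempty_iff_eq_empty] at hne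
    rw [hne, Finset.sum_empty] at hs1
    linarith
  -- The candidate corner carries the largest coordinate, which is at least `M⁻¹` as the coordinates
  -- sum to at least one.
  obtain ⟨k, -, hk⟩ := Finset.exists_max_image Finset.univ α hne
  have hαk : M⁻¹ ≤ α k := by
    have h1 : ∑ l, α l ≤ K * α k := by
      calc ∑ l, α l ≤ ∑ _l : Fin K, α k := Finset.sum_le_sum fun l _ => hk l (Finset.mem_univ l)
        _ = _ := by simp
    rw [inv_le_iff_one_le_mul₀ hM]
    nlinarith [h.card_le, hα k]
  have hprod : ∀ l, l ≠ k → α k * α l ≤ 3 * M ^ 2 * ζ := by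
    intro l hl
    have e1 : ‖∑ l, α l • v l‖ ^ 2 = ∑ i, ∑ j, α i * α j * ⟪v i, v j⟫ := by
      rw [← real_inner_self_eq_norm_sq, sum_inner]
      refine Finset.sum_congr rfl fun i _ => ?_
      rw [inner_sum]
      refine Finset.sum_congr rfl fun j _ => ?_
      rw [real_inner_smul_left, real_inner_smul_right]; ring
    have e2 : (∑ l, α l) ^ 2 = ∑ i, ∑ j, α i * α j := by
      rw [sq, Finset.sum_mul_sum]
    -- For unit corners and a unit combination this sum equals `(∑ α)² - 1 ≤ 3ζ`. All its terms are
    -- nonnegative and `1 - ⟪v i, v j⟫` is bounded below off the diagonal, so products of different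
    -- coordinates are small.
    have e3 : ∑ i, ∑ j, α i * α j * (1 - ⟪v i, v j⟫) ≤ 3 * ζ := by
      have : ∑ i, ∑ j, α i * α j * (1 - ⟪v i, v j⟫) = (∑ l, α l) ^ 2 - 1 := by
        have e1' : (1 : ℝ) = ∑ i, ∑ j, α i * α j * ⟪v i, v j⟫ := by rw [← e1, hx, one_pow]
        rw [e2]
        nth_rewrite 2 [e1']
        rw [← Finset.sum_sub_distrib]
        refine Finset.sum_congr rfl fun i _ => ?_
        rw [← Finset.sum_sub_distrib]
        exact Finset.sum_congr rfl fun j _ => by ring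
      rw [this]
      nlinarith
    have hnn : ∀ i j, 0 ≤ α i * α j * (1 - ⟪v i, v j⟫) := by
      intro i j
      have : ⟪v i, v j⟫ ≤ 1 := by
        have := real_inner_le_norm (v i) (v j)
        rwa [h.norm_eq, h.norm_eq, one_mul] at this
      exact mul_nonneg (mul_nonneg (hα i) (hα j)) (by linarith)
    have e4 : α k * α l * (1 - ⟪v k, v l⟫) + α l * α k * (1 - ⟪v l, v k⟫) ≤
        ∑ i, ∑ j, α i * α j * (1 - ⟪v i, v j⟫) := by
      have a1 : α k * α l * (1 - ⟪v k, v l⟫) ≤ ∑ j, α k * α j * (1 - ⟪v k, v j⟫) :=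
        Finset.single_le_sum (f := fun j => α k * α j * (1 - ⟪v k, v j⟫)) (fun j _ => hnn k j)
          (Finset.mem_univ l)
      have a2 : α l * α k * (1 - ⟪v l, v k⟫) ≤ ∑ j, α l * α j * (1 - ⟪v l, v j⟫) :=
        Finset.single_le_sum (f := fun j => α l * α j * (1 - ⟪v l, v j⟫)) (fun j _ => hnn l j)
          (Finset.mem_univ k)
      have a3 := Finset.add_le_sum (f := fun i => ∑ j, α i * α j * (1 - ⟪v i, v j⟫))
        (fun i _ => Finset.sum_nonneg fun j _ => hnn i j) (Finset.mem_univ k) (Finset.mem_univ l)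
        (Ne.symm hl)
      linarith
    rw [real_inner_comm (v k) (v l), mul_comm (α l)] at e4
    have e5 := h.inv_sq_le_one_sub_inner (Ne.symm hl)
    have e6 : α k * α l * (2 * M ^ 2)⁻¹ ≤ 3 * ζ / 2 := by
      have := mul_le_mul_of_nonneg_left e5 (mul_nonneg (hα k) (hα l))
      linarith
    rw [← div_eq_mul_inv, div_le_iff₀ (by positivity)] at e6
    linarith
  have hothers : ∀ l, l ≠ k → α l ≤ 3 * M ^ 3 * ζ := by
    intro l hl
    have h1 := hprod l hl
    have h2 : M⁻¹ * α l ≤ 3 * M ^ 2 * ζ := (mul_le_mul_of_nonneg_right hαk (hα l)).trans h1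
    rw [inv_mul_le_iff₀ hM] at h2
    linarith
  have hrest : ∑ l ∈ Finset.univ.erase k, α l ≤ 3 * M ^ 4 * ζ := by
    calc ∑ l ∈ Finset.univ.erase k, α l ≤ ∑ _l ∈ Finset.univ.erase k, 3 * M ^ 3 * ζ :=
          Finset.sum_le_sum fun l hl => hothers l (Finset.ne_of_mem_erase hl)
      _ ≤ ∑ _l : Fin K, 3 * M ^ 3 * ζ := Finset.sum_le_sum_of_subset_of_nonneg
          (Finset.erase_subset _ _) fun _ _ _ => by positivity
      _ = K * (3 * M ^ 3 * ζ) := by simp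
      _ ≤ M * (3 * M ^ 3 * ζ) := by gcongr; exact h.card_le
      _ = _ := by ring
  refine ⟨k, ?_⟩
  rw [← Finset.add_sum_erase _ _ (Finset.mem_univ k)] at hsum hs1
  rw [← Finset.add_sum_erase _ _ (Finset.mem_univ k)]
  have hrest0 : 0 ≤ ∑ l ∈ Finset.univ.erase k, α l := Finset.sum_nonneg fun l _ => hα l
  have e : α k • v k + ∑ l ∈ Finset.univ.erase k, α l • v l - v k =
      (α k - 1) • v k + ∑ l ∈ Finset.univ.erase k, α l • v l := by
    rw [sub_smul, one_smul]; abel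
  rw [e]
  have hM4 : 1 ≤ M ^ 4 := one_le_pow₀ hM1
  calc ‖(α k - 1) • v k + ∑ l ∈ Finset.univ.erase k, α l • v l‖
      ≤ |α k - 1| + ∑ l ∈ Finset.univ.erase k, α l := by
        refine (norm_add_le _ _).trans (add_le_add ?_ ?_)
        · rw [norm_smul, h.norm_eq, mul_one, Real.norm_eq_abs]
        · refine norm_sum_le_of_le _ fun l _ => ?_
          rw [norm_smul, h.norm_eq, mul_one, Real.norm_of_nonneg (hα l)]
    _ ≤ (ζ + 3 * M ^ 4 * ζ) + 3 * M ^ 4 * ζ := by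
        gcongr
        rw [abs_le]; constructor <;> nlinarith
    _ ≤ 7 * M ^ 4 * ζ := by nlinarith

/-- The points near the SVM hyperplane of a perturbed cone are near the corners, and every corner
is near one of them. -/
theorem svm_near_corners (h : IsConeFrame v v' g M) {ε δ : ℝ} (hε0 : 0 ≤ ε)
    (hε : ε ≤ 1 / (500 * M ^ 12)) (hδ0 : 0 ≤ δ) (hδ : δ ≤ M * ε)
    {α : Fin n → Fin K → ℝ} (hα : ∀ i l, 0 ≤ α i l) (hα1 : ∀ i, ‖∑ l, α i l • v l‖ = 1)
    (hpure : ∀ l, ∃ i, ∑ m, α i m • v m = v l)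
    {x : Fin n → EuclideanSpace ℝ (Fin K)} (hx : ∀ i, ‖x i - ∑ l, α i l • v l‖ ≤ ε)
    {w : EuclideanSpace ℝ (Fin K)} {b : ℝ} (hwb : IsOneClassSVM x w b) :
    (∀ i ∈ nearHyperplane x w b δ, ∃ l, ‖x i - v l‖ ≤ 71 * M ^ 7 * ε) ∧
    ∀ l, ∃ i ∈ nearHyperplane x w b δ, ‖x i - v l‖ ≤ 71 * M ^ 7 * ε := by
  have hM1 := h.one_le
  have hM : 0 < M := lt_of_lt_of_le one_pos hM1
  rcases isEmpty_or_nonempty (Fin K) with hK | ⟨⟨l₀⟩⟩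
  · refine ⟨fun i _ => ?_, fun l => hK.elim l⟩
    have := hα1 i
    simp at this
  set u := ∑ k, v' k with hu
  set q := ‖u‖ with hq
  have hq1 : 1 ≤ q := h.one_le_norm_sum_dual l₀
  have hq0 : 0 < q := by linarith
  have hqM : q ≤ M ^ 2 := h.norm_sum_dual_le
  have hq2M : q ^ 2 ≤ M ^ 3 := h.norm_sq_sum_dual_le
  set κ := q⁻¹ with hκ
  have hκ0 : 0 < κ := by positivity
  have hκM : (M ^ 2)⁻¹ ≤ κ := inv_anti₀ hq0 hqM
  have hκ1 : κ ≤ 1 := inv_le_one_of_one_le₀ hq1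
  set β : Fin K → ℝ := fun m => ∑ k, g m k with hβ
  have hβsum : ∑ m, β m = q ^ 2 := (h.norm_sq_sum_dual).symm
  have hβpos : ∀ m, 0 < β m := fun m => lt_of_lt_of_le (by positivity) (h.row_sum m)
  -- size of ε
  have hεM : ∀ j : ℕ, j ≤ 12 → M ^ j * ε ≤ 1 / 500 := by
    intro j hj
    have h1 : M ^ j * ε ≤ M ^ 12 * (1 / (500 * M ^ 12)) := by
      gcongr
    refine h1.trans (le_of_eq ?_)
    field_simp
  have hsum1 : ∀ i, 1 ≤ ∑ l, α i l := by
    intro i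
    rw [← hα1 i]
    refine (norm_sum_le _ _).trans (Finset.sum_le_sum fun l _ => ?_)
    rw [norm_smul, h.norm_eq, mul_one, Real.norm_of_nonneg (hα i l)]
  have hpert : ∀ (y : EuclideanSpace ℝ (Fin K)) i, ‖y‖ ≤ 1 →
      |⟪y, x i⟫ - ⟪y, ∑ l, α i l • v l⟫| ≤ ε := by
    intro y i hy
    rw [← inner_sub_right]
    calc |⟪y, x i - ∑ l, α i l • v l⟫| ≤ ‖y‖ * ‖x i - ∑ l, α i l • v l‖ :=
          abs_real_inner_le_norm _ _
      _ ≤ 1 * ε := by gcongr; exact hx i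
      _ = ε := one_mul _
  -- lower bound for the margin
  have hblow : κ - ε ≤ b := by
    -- The unit vector `κ • u` has inner product `κ ∑ α i l ≥ κ` with every exact point; perturbing
    -- the point costs `ε`.
    refine hwb.optimal (κ • u) (κ - ε) ?_ fun i => ?_
    · rw [norm_smul, Real.norm_of_nonneg hκ0.le, hκ, inv_mul_cancel₀ hq0.ne']
    · have h1 := hpert (κ • u) i (by
        rw [norm_smul, Real.norm_of_nonneg hκ0.le, hκ, inv_mul_cancel₀ hq0.ne'])
      have h2 : ⟪κ • u, ∑ l, α i l • v l⟫ = κ * ∑ l, α i l := by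
        rw [real_inner_smul_left, inner_sum]
        congr 1
        refine Finset.sum_congr rfl fun l _ => ?_
        rw [real_inner_smul_right, hu, h.inner_sum_dual, mul_one]
      rw [h2] at h1
      have h3 := (abs_le.1 h1).1
      nlinarith [hsum1 i]
  -- `w` at the corners
  have hwv : ∀ l, b - ε ≤ ⟪w, v l⟫ := by
    intro l
    obtain ⟨i, hi⟩ := hpure l
    have h1 := hpert w i hwb.norm_le
    rw [hi] at h1
    have := hwb.le_inner i
    linarith [(abs_le.1 h1).2]
  have hwu : ∑ m, β m * ⟪w, v m⟫ ≤ q := by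
    rw [← h.inner_sum_dual_right w]
    calc ⟪u, w⟫ ≤ ‖u‖ * ‖w‖ := real_inner_le_norm _ _
      _ ≤ q * 1 := by gcongr; exact hwb.norm_le
      _ = q := mul_one q
  have hκq : κ * q ^ 2 = q := by rw [hκ]; field_simp
  -- The mean of `⟪w, v m⟫` with weights `β m` is `⟪u, w⟫ / q² ≤ κ`, while each term is at least `b
  -- - ε`.
  have hbup : b ≤ κ + ε := by
    have h1 : (b - ε) * q ^ 2 ≤ q := by
      rw [← hβsum, Finset.mul_sum]
      refine le_trans (Finset.sum_le_sum fun m _ => ?_) hwu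
      rw [mul_comm]
      exact mul_le_mul_of_nonneg_left (hwv m) (hβpos m).le
    have h2 : (b - ε) * q ^ 2 ≤ κ * q ^ 2 := by rw [hκq]; exact h1
    have := le_of_mul_le_mul_right h2 (by positivity)
    linarith
  have helow : ∀ l, -(2 * ε) ≤ ⟪w, v l⟫ - κ := fun l => by linarith [hwv l]
  -- The deviations from `κ` are at least `-2ε` and have weighted sum at most zero; since the
  -- weights are at least `M⁻¹`, no deviation can be large.
  have heup : ∀ l, ⟪w, v l⟫ - κ ≤ 2 * M ^ 4 * ε := by
    intro l
    have h1 : ∑ m, β m * (⟪w, v m⟫ - κ + 2 * ε) ≤ 2 * ε * q ^ 2 := by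
      have : ∑ m, β m * (⟪w, v m⟫ - κ + 2 * ε) =
          ∑ m, β m * ⟪w, v m⟫ - κ * q ^ 2 + 2 * ε * q ^ 2 := by
        rw [← hβsum, Finset.mul_sum, Finset.mul_sum, ← Finset.sum_sub_distrib,
          ← Finset.sum_add_distrib]
        exact Finset.sum_congr rfl fun m _ => by ring
      rw [this, hκq]; linarith
    have h2 : β l * (⟪w, v l⟫ - κ + 2 * ε) ≤ 2 * ε * q ^ 2 :=
      le_trans (Finset.single_le_sum (f := fun m => β m * (⟪w, v m⟫ - κ + 2 * ε))
        (fun m _ => mul_nonneg (hβpos m).le (by linarith [helow m])) (Finset.mem_univ l)) h1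
    have h3 : M⁻¹ * (⟪w, v l⟫ - κ + 2 * ε) ≤ 2 * ε * M ^ 3 :=
      le_trans (mul_le_mul_of_nonneg_right (h.row_sum l) (by linarith [helow l]))
        (h2.trans (by gcongr))
    rw [inv_mul_le_iff₀ hM] at h3
    have e : M * (2 * ε * M ^ 3) = 2 * M ^ 4 * ε := by ring
    rw [e] at h3
    linarith
  -- points near the hyperplane are near corners
  have hnear : ∀ i ∈ nearHyperplane x w b δ, ∃ l, ‖x i - v l‖ ≤ 71 * M ^ 7 * ε := by
    intro i hi
    simp only [nearHyperplane, Finset.mem_filter, Finset.mem_univ, true_and] at hi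
    have h1 := (abs_le.1 (hpert w i hwb.norm_le)).1
    have h2 : ⟪w, ∑ l, α i l • v l⟫ = ∑ l, α i l * ⟪w, v l⟫ := by
      rw [inner_sum]
      exact Finset.sum_congr rfl fun l _ => by rw [real_inner_smul_right]
    have h3 : (κ - 2 * ε) * ∑ l, α i l ≤ ∑ l, α i l * ⟪w, v l⟫ := by
      rw [Finset.mul_sum]
      refine Finset.sum_le_sum fun l _ => ?_
      rw [mul_comm]
      exact mul_le_mul_of_nonneg_left (by linarith [helow l]) (hα i l)
    have h4 : (κ - 2 * ε) * ∑ l, α i l ≤ κ + 3 * M * ε := by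
      have : (κ - 2 * ε) * ∑ l, α i l ≤ κ + 2 * ε + M * ε := by
        rw [h2] at h1; linarith
      nlinarith
    have hMκ : 1 ≤ M ^ 2 * κ := by
      have := mul_le_mul_of_nonneg_left hκM (by positivity : (0:ℝ) ≤ M ^ 2)
      rwa [mul_inv_cancel₀ (by positivity)] at this
    have hεκ : 4 * ε ≤ κ := by
      have h5 := hεM 2 (by norm_num)
      have h6 : 4 * (M ^ 2 * ε) ≤ M ^ 2 * κ := by linarith
      have h7 : M ^ 2 * (4 * ε) ≤ M ^ 2 * κ := by linarith
      exact le_of_mul_le_mul_left h7 (by positivity)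
    -- The inequality `(κ - 2ε) ∑ α ≤ κ + 3Mε` with `κ ≥ M⁻²` leaves an excess of order `M³ε`.
    have hζ : ∑ l, α i l ≤ 1 + 10 * M ^ 3 * ε := by
      by_contra hcon
      push Not at hcon
      have h5 : (κ - 2 * ε) * (1 + 10 * M ^ 3 * ε) < κ + 3 * M * ε :=
        lt_of_lt_of_le (mul_lt_mul_of_pos_left hcon (by linarith)) h4
      have h6 : κ / 2 * (10 * M ^ 3 * ε) ≤ (κ - 2 * ε) * (10 * M ^ 3 * ε) := by
        gcongr; linarith
      have h7 : 5 * M * ε ≤ κ / 2 * (10 * M ^ 3 * ε) := by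
        have : κ / 2 * (10 * M ^ 3 * ε) = 5 * M * ε * (M ^ 2 * κ) := by ring
        rw [this]
        exact le_mul_of_one_le_right (by positivity) hMκ
      nlinarith
    obtain ⟨k, hk⟩ := h.exists_corner (hα i) (hα1 i) (ζ := 10 * M ^ 3 * ε) (by positivity)
      (by have := hεM 3 (by norm_num); linarith) hζ
    refine ⟨k, ?_⟩
    have hM7 : 1 ≤ M ^ 7 := one_le_pow₀ hM1
    calc ‖x i - v k‖ = ‖(x i - ∑ l, α i l • v l) + (∑ l, α i l • v l - v k)‖ := by
          congr 1; abel
      _ ≤ ε + 7 * M ^ 4 * (10 * M ^ 3 * ε) := (norm_add_le _ _).trans (add_le_add (hx i) hk)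
      _ = ε + 70 * M ^ 7 * ε := by ring
      _ ≤ _ := by nlinarith
  refine ⟨hnear, fun k => ?_⟩
  -- otherwise `w` could be improved
  by_contra hcon
  push Not at hcon
  -- The direction `d = u - T v' k` has inner product one with every corner but `k`. The size of `T`
  -- makes `T ⟪w, v' k⟫`, about `2κM³`, exceed `⟪w, u⟫ ≤ κM³`, so moving along `d` does not lengthen
  -- `w`.
  set T := 2 * M ^ 4 with hT
  set d := u - T • v' k with hd
  have hdv : ∀ l, l ≠ k → ⟪d, v l⟫ = 1 := by
    intro l hl
    rw [hd, inner_sub_left, real_inner_smul_left, hu, h.inner_sum_dual, h.dual,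
      if_neg (Ne.symm hl)]
    simp
  have hdn : ‖d‖ ≤ 3 * M ^ 5 := by
    calc ‖d‖ ≤ ‖u‖ + ‖T • v' k‖ := norm_sub_le _ _
      _ ≤ M ^ 2 + T * M := by
          refine add_le_add hqM ?_
          rw [norm_smul, Real.norm_of_nonneg (by positivity)]
          gcongr; exact h.norm_dual k
      _ ≤ M ^ 5 + T * M := by gcongr; first | exact hM1 | norm_num
      _ = 3 * M ^ 5 := by rw [hT]; ring
  have hdw : ⟪w, d⟫ < 0 := by
    have h1 : ⟪w, v' k⟫ ≥ κ * M⁻¹ - 2 * M ^ 6 * ε := by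
      have e1 : ⟪w, v' k⟫ = ∑ m, g k m * ⟪w, v m⟫ := by
        rw [h.dual_eq k, inner_sum]
        exact Finset.sum_congr rfl fun m _ => by rw [real_inner_smul_right]
      have e2 : ∑ m, g k m * ⟪w, v m⟫ = κ * β k + ∑ m, g k m * (⟪w, v m⟫ - κ) := by
        rw [hβ, Finset.mul_sum, ← Finset.sum_add_distrib]
        exact Finset.sum_congr rfl fun m _ => by ring
      have e3 : |∑ m, g k m * (⟪w, v m⟫ - κ)| ≤ 2 * M ^ 6 * ε := by
        calc |∑ m, g k m * (⟪w, v m⟫ - κ)| ≤ ∑ m, |g k m * (⟪w, v m⟫ - κ)| :=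
              Finset.abs_sum_le_sum_abs _ _
          _ ≤ ∑ _m : Fin K, M * (2 * M ^ 4 * ε) := by
              refine Finset.sum_le_sum fun m _ => ?_
              rw [abs_mul]
              refine mul_le_mul (h.gram_le k m) ?_ (abs_nonneg _) hM.le
              rw [abs_le]
              refine ⟨?_, heup m⟩
              have hM4 : 1 ≤ M ^ 4 := one_le_pow₀ hM1
              nlinarith [helow m]
          _ = K * (M * (2 * M ^ 4 * ε)) := by simp
          _ ≤ M * (M * (2 * M ^ 4 * ε)) := by gcongr; exact h.card_le
          _ = _ := by ring
      have e4 : κ * M⁻¹ ≤ κ * β k := mul_le_mul_of_nonneg_left (h.row_sum k) hκ0.le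
      rw [e1, e2]
      linarith [(abs_le.1 e3).1]
    have h2 : ⟪w, u⟫ ≤ κ * M ^ 3 := by
      have : ⟪w, u⟫ ≤ q := by
        calc ⟪w, u⟫ ≤ ‖w‖ * ‖u‖ := real_inner_le_norm _ _
          _ ≤ 1 * q := by gcongr; exact hwb.norm_le
          _ = q := one_mul q
      refine this.trans ?_
      rw [← hκq]; gcongr
    rw [hd, inner_sub_right, real_inner_smul_right]
    have h3 : T * (κ * M⁻¹ - 2 * M ^ 6 * ε) = 2 * (κ * M ^ 3) - 4 * M ^ 10 * ε := by
      rw [hT]; field_simp; ring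
    have h4 : T * (κ * M⁻¹ - 2 * M ^ 6 * ε) ≤ T * ⟪w, v' k⟫ := by gcongr
    have h5 : 4 * M ^ 10 * ε < κ * M ^ 3 := by
      have h6 : M ≤ κ * M ^ 3 := by
        have := mul_le_mul_of_nonneg_right hκM (by positivity : (0:ℝ) ≤ M ^ 3)
        have e : (M ^ 2)⁻¹ * M ^ 3 = M := by field_simp
        rwa [e] at this
      have := hεM 10 (by norm_num)
      nlinarith
    linarith
  have hdx : ∀ i ∈ nearHyperplane x w b δ, 1 / 2 < ⟪x i, d⟫ := by
    intro i hi
    obtain ⟨l, hl⟩ := hnear i hi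
    have hlk : l ≠ k := by
      rintro rfl
      exact absurd hl (not_le.2 (hcon i hi))
    have h1 : |⟪x i - v l, d⟫| ≤ 71 * M ^ 7 * ε * (3 * M ^ 5) :=
      (abs_real_inner_le_norm _ _).trans (mul_le_mul hl hdn (norm_nonneg _) (by positivity))
    rw [inner_sub_left, real_inner_comm d (v l), hdv l hlk] at h1
    have h2 := hεM 12 le_rfl
    have h3 : 71 * M ^ 7 * ε * (3 * M ^ 5) = 213 * (M ^ 12 * ε) := by ring
    rw [h3] at h1
    linarith [(abs_le.1 h1).1]
  have hev1 : ∀ᶠ t in nhdsWithin (0 : ℝ) (Set.Ioi 0), 2 * ⟪w, d⟫ + t * ‖d‖ ^ 2 < 0 := by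
    have hc : Filter.Tendsto (fun t : ℝ => 2 * ⟪w, d⟫ + t * ‖d‖ ^ 2) (nhds 0)
        (nhds (2 * ⟪w, d⟫ + 0 * ‖d‖ ^ 2)) := Continuous.tendsto (by fun_prop) 0
    exact (hc.eventually (gt_mem_nhds (by linarith))).filter_mono nhdsWithin_le_nhds
  -- Points off the near-hyperplane set have strict slack even when `δ = 0`, and keep it for small
  -- `t`.
  have hev2 : ∀ᶠ t in nhdsWithin (0 : ℝ) (Set.Ioi 0), ∀ i, i ∉ nearHyperplane x w b δ →
      b + t / 2 < ⟪w, x i⟫ + t * ⟪x i, d⟫ := by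
    rw [Filter.eventually_all]
    intro i
    by_cases hi : i ∈ nearHyperplane x w b δ
    · exact Filter.Eventually.of_forall fun t hne => absurd hi hne
    · have hi' : b + δ < ⟪w, x i⟫ := by
        simpa [nearHyperplane] using hi
      have hc : Filter.Tendsto (fun t : ℝ => ⟪w, x i⟫ + t * ⟪x i, d⟫ - (b + t / 2)) (nhds 0)
          (nhds (⟪w, x i⟫ + 0 * ⟪x i, d⟫ - (b + 0 / 2))) := Continuous.tendsto (by fun_prop) 0
      have := (hc.eventually (lt_mem_nhds (a := 0) (by simp; linarith))).filter_mono
        (nhdsWithin_le_nhds (s := Set.Ioi 0))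
      filter_upwards [this] with t ht _
      linarith
  obtain ⟨t, ht1, ht2, ht0⟩ := (hev1.and (hev2.and self_mem_nhdsWithin)).exists
  have ht0' : 0 < t := ht0
  have hopt := hwb.optimal (w + t • d) (b + t / 2) ?_ ?_
  · linarith
  · have e : ‖w + t • d‖ ^ 2 ≤ 1 := by
      rw [norm_add_sq_real, real_inner_smul_right, norm_smul, Real.norm_of_nonneg ht0'.le,
        mul_pow]
      have h1 : ‖w‖ ^ 2 ≤ 1 := pow_le_one₀ (norm_nonneg _) hwb.norm_le
      have h2 : t * (2 * ⟪w, d⟫ + t * ‖d‖ ^ 2) ≤ 0 :=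
        mul_nonpos_of_nonneg_of_nonpos ht0'.le ht1.le
      linarith
    exact (sq_le_one_iff₀ (norm_nonneg _)).1 e
  · intro i
    rw [inner_add_left, real_inner_smul_left]
    by_cases hi : i ∈ nearHyperplane x w b δ
    · have h1 := hwb.le_inner i
      have h2 := hdx i hi
      have h3 : t * (1 / 2) ≤ t * ⟪x i, d⟫ := mul_le_mul_of_nonneg_left h2.le ht0'.le
      rw [real_inner_comm (x i) d]
      linarith
    · have := ht2 i hi
      rw [real_inner_comm (x i) d]
      exact this.le

end IsConeFrame

end SVM

/-! ### Recovery of the memberships from an approximate frame -/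

section Recovery

open scoped RealInnerProductSpace

theorem norm_normalize_sub_le {E : Type*} [NormedAddCommGroup E] [NormedSpace ℝ E] (y : E) {z : E}
    (hz : z ≠ 0) : ‖‖y‖⁻¹ • y - ‖z‖⁻¹ • z‖ ≤ 2 * (‖y - z‖ / ‖z‖) := by
  have hz0 : 0 < ‖z‖ := norm_pos_iff.2 hz
  have h1 : ‖‖y‖⁻¹ • y - ‖z‖⁻¹ • y‖ ≤ ‖y - z‖ / ‖z‖ := by
    rcases eq_or_ne y 0 with rfl | hy
    · simp [div_nonneg]
    · have hy0 : 0 < ‖y‖ := norm_pos_iff.2 hy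
      rw [← sub_smul, norm_smul, Real.norm_eq_abs]
      have e : (‖y‖⁻¹ - ‖z‖⁻¹) = (‖z‖ - ‖y‖) / (‖y‖ * ‖z‖) := by field_simp
      rw [e, abs_div, abs_of_pos (mul_pos hy0 hz0), div_mul_eq_mul_div, div_le_div_iff₀
        (by positivity) hz0]
      have := abs_norm_sub_norm_le z y
      rw [norm_sub_rev] at this
      calc |‖z‖ - ‖y‖| * ‖y‖ * ‖z‖ ≤ ‖y - z‖ * ‖y‖ * ‖z‖ := by gcongr
        _ = ‖y - z‖ * (‖y‖ * ‖z‖) := by ring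
  have h2 : ‖‖z‖⁻¹ • y - ‖z‖⁻¹ • z‖ = ‖y - z‖ / ‖z‖ := by
    rw [← smul_sub, norm_smul, Real.norm_of_nonneg (by positivity), div_eq_inv_mul]
  calc ‖‖y‖⁻¹ • y - ‖z‖⁻¹ • z‖
      = ‖(‖y‖⁻¹ • y - ‖z‖⁻¹ • y) + (‖z‖⁻¹ • y - ‖z‖⁻¹ • z)‖ := by congr 1; abel
    _ ≤ _ := (norm_add_le _ _).trans (by rw [h2]; linarith)

theorem abs_sqrt_sub_le (t : ℝ) {u : ℝ} (hu : 0 < u) : |Real.sqrt t - u| ≤ |t - u ^ 2| / u := by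
  rw [le_div_iff₀ hu]
  rcases le_total 0 t with ht | ht
  · have h1 := Real.sq_sqrt ht
    have h2 := Real.sqrt_nonneg t
    have e : t - u ^ 2 = (Real.sqrt t - u) * (Real.sqrt t + u) := by nlinarith
    rw [e, abs_mul, abs_of_pos (by linarith : 0 < Real.sqrt t + u)]
    gcongr; linarith
  · rw [Real.sqrt_eq_zero_of_nonpos ht, zero_sub, abs_neg, abs_of_pos hu,
      abs_of_nonpos (by nlinarith)]
    nlinarith

variable {n K : ℕ}

theorem rowVec_rowNormalize (U : Matrix (Fin n) (Fin K) ℝ) (i : Fin n) :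
    rowVec (rowNormalize U) i = ‖rowVec U i‖⁻¹ • rowVec U i := by
  ext k
  simp [rowVec, rowNormalize, div_eq_inv_mul]

theorem normalize_smul {E : Type*} [NormedAddCommGroup E] [NormedSpace ℝ E] {s : ℝ} (hs : 0 < s)
    (x : E) : ‖s • x‖⁻¹ • (s • x) = ‖x‖⁻¹ • x := by
  rw [norm_smul, Real.norm_of_nonneg hs.le, smul_smul]
  congr 1
  field_simp

/-- Biorthogonal vectors `h` and `j` that are almost orthonormalized by a nonnegative matrix. -/
structure IsBiorthogonal (h j : Fin K → EuclideanSpace ℝ (Fin K)) (M ε : ℝ) : Prop where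
  two_le : 2 ≤ M
  card_le : (K : ℝ) ≤ M
  dual : ∀ k l, ⟪j k, h l⟫ = if k = l then 1 else 0
  norm_le : ∀ l, ‖h l‖ ≤ M
  norm_dual : ∀ l, ‖j l‖ ≤ M
  almost_nonneg : ∀ k l, k ≠ l → -ε ≤ ⟪j k, j l⟫

namespace IsBiorthogonal

variable {h j : Fin K → EuclideanSpace ℝ (Fin K)} {M ε : ℝ}

/-- Biorthogonality makes one square matrix a left inverse of the other; being also a right inverse,
it yields the expansion. -/
theorem expansion (H : IsBiorthogonal h j M ε) (x : EuclideanSpace ℝ (Fin K)) :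
    x = ∑ m, ⟪x, j m⟫ • h m := by
  set Hm : Matrix (Fin K) (Fin K) ℝ := Matrix.of fun l a => h l a with hHm
  set Jm : Matrix (Fin K) (Fin K) ℝ := Matrix.of fun l a => j l a with hJm
  have h1 : Jm * Hm.transpose = 1 := by
    ext k l
    have := H.dual k l
    rw [PiLp.inner_apply] at this
    simp only [Matrix.mul_apply, Matrix.transpose_apply, hHm, hJm, Matrix.of_apply,
      Matrix.one_apply]
    rw [← this]
    exact Finset.sum_congr rfl fun a _ => by simp [mul_comm]
  have h2 : Hm.transpose * Jm = 1 := mul_eq_one_comm.1 h1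
  ext a
  have h3 : ∀ b, ∑ l, h l a * j l b = if a = b then 1 else 0 := by
    intro b
    have := congrFun (congrFun h2 a) b
    simpa [Matrix.mul_apply, hHm, hJm, Matrix.one_apply] using this
  have h4 : (∑ m, ⟪x, j m⟫ • h m) a = ∑ m, ⟪x, j m⟫ * h m a := by
    simp
  rw [h4]
  simp only [PiLp.inner_apply, Finset.sum_mul]
  rw [Finset.sum_comm]
  have h5 : ∀ b, ∑ m, inner ℝ (x b) (j m b) * h m a = x b * (if a = b then 1 else 0) := by
    intro b
    rw [← h3 b, Finset.mul_sum]
    exact Finset.sum_congr rfl fun m _ => by simp; ring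
  rw [Finset.sum_congr rfl fun b _ => h5 b]
  simp

theorem inv_le_norm (H : IsBiorthogonal h j M ε) (l : Fin K) : M⁻¹ ≤ ‖h l‖ := by
  have hM : 0 < M := by linarith [H.two_le]
  have h1 := real_inner_le_norm (j l) (h l)
  rw [H.dual, if_pos rfl] at h1
  rw [inv_le_iff_one_le_mul₀ hM]
  have := mul_le_mul_of_nonneg_right (H.norm_dual l) (norm_nonneg (h l))
  linarith

theorem norm_pos (H : IsBiorthogonal h j M ε) (l : Fin K) : 0 < ‖h l‖ :=
  lt_of_lt_of_le (inv_pos.2 (by linarith [H.two_le])) (H.inv_le_norm l)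

/-- For the row sums, the diagonal term is at least one by Cauchy–Schwarz applied to `⟪j k, h k⟫ =
1`, and each remaining term is at least `-M²ε`. -/
theorem isConeFrame (H : IsBiorthogonal h j M ε) (hε0 : 0 ≤ ε) (hε : M ^ 3 * ε ≤ 1 / 2) :
    IsConeFrame (fun l => ‖h l‖⁻¹ • h l) (fun l => ‖h l‖ • j l)
      (fun k m => ‖h k‖ * ‖h m‖ * ⟪j k, j m⟫) (M ^ 4) := by
  have hM2 := H.two_le
  have hM : 0 < M := by linarith
  have hM4 : M ≤ M ^ 4 := by
    calc M = M ^ 1 := (pow_one M).symm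
      _ ≤ M ^ 4 := pow_le_pow_right₀ (by linarith) (by norm_num)
  have hM24 : M ^ 2 ≤ M ^ 4 := pow_le_pow_right₀ (by linarith) (by norm_num)
  refine ⟨by linarith, H.card_le.trans hM4, fun l => ?_, fun k l => ?_, fun k => ?_, fun k => ?_,
    fun k m => ?_, fun k => ?_⟩
  · rw [norm_smul, norm_inv, norm_norm, inv_mul_cancel₀ (H.norm_pos l).ne']
  · rw [real_inner_smul_left, real_inner_smul_right, H.dual]
    split_ifs with hkl
    · subst hkl
      rw [mul_one, mul_inv_cancel₀ (H.norm_pos k).ne']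
    · simp
  · conv_lhs => rw [H.expansion (j k)]
    rw [Finset.smul_sum]
    refine Finset.sum_congr rfl fun m _ => ?_
    rw [smul_smul, smul_smul]
    congr 1
    have := (H.norm_pos m).ne'
    field_simp
  · rw [norm_smul, norm_norm]
    calc ‖h k‖ * ‖j k‖ ≤ M * M := mul_le_mul (H.norm_le k) (H.norm_dual k) (norm_nonneg _) hM.le
      _ = M ^ 2 := by ring
      _ ≤ _ := hM24
  · have h1 := abs_real_inner_le_norm (j k) (j m)
    rw [abs_mul, abs_of_nonneg (by positivity)]
    calc ‖h k‖ * ‖h m‖ * |⟪j k, j m⟫| ≤ M * M * (M * M) := by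
          gcongr
          · exact H.norm_le k
          · exact H.norm_le m
          · exact h1.trans (by gcongr <;> exact H.norm_dual _)
      _ = M ^ 4 := by ring
  · have h1 : ∀ m, (if m = k then (1 : ℝ) else 0) - M ^ 2 * ε ≤ ‖h k‖ * ‖h m‖ * ⟪j k, j m⟫ := by
      intro m
      split_ifs with hmk
      · subst hmk
        have h2 := real_inner_le_norm (j m) (h m)
        rw [H.dual, if_pos rfl] at h2
        rw [real_inner_self_eq_norm_sq]
        have : 0 ≤ M ^ 2 * ε := by positivity
        nlinarith
      · have h2 := H.almost_nonneg k m (Ne.symm hmk)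
        have h3 : ‖h k‖ * ‖h m‖ ≤ M ^ 2 := by
          rw [sq]; exact mul_le_mul (H.norm_le k) (H.norm_le m) (norm_nonneg _) hM.le
        have h4 : 0 ≤ ‖h k‖ * ‖h m‖ := by positivity
        nlinarith
    have h2 := Finset.sum_le_sum fun m (_ : m ∈ Finset.univ) => h1 m
    rw [Finset.sum_sub_distrib, Finset.sum_const, Finset.card_univ, Fintype.card_fin,
      nsmul_eq_mul, Finset.sum_ite_eq', if_pos (Finset.mem_univ k)] at h2
    have h3 : (K : ℝ) * (M ^ 2 * ε) ≤ M * (M ^ 2 * ε) := by gcongr; exact H.card_le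
    have h4 : (M ^ 4)⁻¹ ≤ 1 / 2 := by
      rw [inv_le_comm₀ (by positivity) (by norm_num)]
      norm_num; linarith
    nlinarith

end IsBiorthogonal

/-- The rows of `U` are, up to scaling and a small error, the images of the rows of `Pi` under a
well conditioned linear map. -/
structure IsApproxFactor (U : Matrix (Fin n) (Fin K) ℝ) (Pi : Matrix (Fin n) (Fin K) ℝ)
    (a : Fin n → ℝ) (h : Fin K → EuclideanSpace ℝ (Fin K)) (s M ε : ℝ) : Prop where
  scale_pos : 0 < s
  nonneg : ∀ i k, 0 ≤ Pi i k
  sum_one : ∀ i, ∑ k, Pi i k = 1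
  pure_node : ∀ k, ∃ i, Pi i k = 1
  le_weight : ∀ i, M⁻¹ ≤ a i
  weight_le : ∀ i, a i ≤ M
  approx : ∀ i, ‖s • rowVec U i - a i • ∑ l, Pi i l • h l‖ ≤ ε

variable {U Pi : Matrix (Fin n) (Fin K) ℝ} {a : Fin n → ℝ}
  {h j : Fin K → EuclideanSpace ℝ (Fin K)} {s M ε : ℝ}

/-- The dual vectors read off the memberships, which sum to one, so the combination cannot be short.
This keeps row normalization stable. -/
theorem inv_sq_le_norm_sum (H : IsBiorthogonal h j M ε) (F : IsApproxFactor U Pi a h s M ε)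
    (i : Fin n) : (M ^ 2)⁻¹ ≤ ‖∑ l, Pi i l • h l‖ := by
  have hM : 0 < M := by linarith [H.two_le]
  have h1 : ∀ l, Pi i l ≤ M * ‖∑ l, Pi i l • h l‖ := by
    intro l
    have e : ⟪j l, ∑ m, Pi i m • h m⟫ = Pi i l := by
      rw [inner_sum]
      simp [real_inner_smul_right, H.dual]
    calc Pi i l = ⟪j l, ∑ m, Pi i m • h m⟫ := e.symm
      _ ≤ ‖j l‖ * ‖∑ m, Pi i m • h m‖ := real_inner_le_norm _ _
      _ ≤ _ := by gcongr; exact H.norm_dual l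
  have h2 := Finset.sum_le_sum fun l (_ : l ∈ Finset.univ) => h1 l
  rw [F.sum_one, Finset.sum_const, Finset.card_univ, Fintype.card_fin, nsmul_eq_mul] at h2
  have h3 : (K : ℝ) * (M * ‖∑ l, Pi i l • h l‖) ≤ M * (M * ‖∑ l, Pi i l • h l‖) := by
    gcongr; exact H.card_le
  rw [inv_le_iff_one_le_mul₀ (by positivity)]
  nlinarith

/-- The index set chosen by SVM-cone hits every corner once. -/
theorem svmCone_corners (H : IsBiorthogonal h j M ε) (F : IsApproxFactor U Pi a h s M ε)
    (hε0 : 0 ≤ ε) (hε : M ^ 51 * ε ≤ 1 / 4000) {δ : ℝ} (hδ0 : 0 ≤ δ) (hδ : δ ≤ M * ε)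
    {I : Fin K → Fin n} (hI : IsSVMCone (rowVec (rowNormalize U)) δ I) :
    ∃ π : Equiv.Perm (Fin K), ∀ k,
      ‖rowVec (rowNormalize U) (I k) - ‖h (π k)‖⁻¹ • h (π k)‖ ≤ 142 * M ^ 31 * ε := by
  rcases isEmpty_or_nonempty (Fin K) with hK | hK
  · exact ⟨Equiv.refl _, fun k => hK.elim k⟩
  have hM2 := H.two_le
  have hM1 : 1 ≤ M := by linarith
  have hM : 0 < M := by linarith
  have hεM : ∀ m : ℕ, m ≤ 51 → M ^ m * ε ≤ 1 / 4000 := fun m hm =>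
    le_trans (by gcongr) hε
  have C := H.isConeFrame hε0 ((hεM 3 (by norm_num)).trans (by norm_num))
  set p : Fin n → EuclideanSpace ℝ (Fin K) := fun i => ∑ l, Pi i l • h l with hp
  have hp0 : ∀ i, 0 < ‖p i‖ := fun i =>
    lt_of_lt_of_le (by positivity) (inv_sq_le_norm_sum H F i)
  have ha0 : ∀ i, 0 < a i := fun i => lt_of_lt_of_le (by positivity) (F.le_weight i)
  -- These are the coordinates of the normalized ideal row with respect to the normalized corners.
  set α : Fin n → Fin K → ℝ := fun i l => Pi i l * ‖h l‖ / ‖p i‖ with hα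
  have hαv : ∀ i, ∑ l, α i l • (‖h l‖⁻¹ • h l) = ‖p i‖⁻¹ • p i := by
    intro i
    change _ = ‖p i‖⁻¹ • ∑ l, Pi i l • h l
    rw [Finset.smul_sum]
    refine Finset.sum_congr rfl fun l _ => ?_
    rw [smul_smul, smul_smul]
    congr 1
    have := (H.norm_pos l).ne'
    have := (hp0 i).ne'
    simp only [hα]
    field_simp
  obtain ⟨w, b, c, hwb, hc, hIc⟩ := hI
  have hx : ∀ i, ‖rowVec (rowNormalize U) i - ∑ l, α i l • (‖h l‖⁻¹ • h l)‖ ≤ 2 * M ^ 3 * ε := by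
    intro i
    rw [hαv, rowVec_rowNormalize, ← normalize_smul F.scale_pos, ← normalize_smul (ha0 i) (p i)]
    have hne : a i • p i ≠ 0 := smul_ne_zero (ha0 i).ne' (norm_pos_iff.1 (hp0 i))
    refine (norm_normalize_sub_le _ hne).trans ?_
    have h1 : (M ^ 3)⁻¹ ≤ ‖a i • p i‖ := by
      rw [norm_smul, Real.norm_of_nonneg (ha0 i).le]
      have e : (M ^ 3)⁻¹ = M⁻¹ * (M ^ 2)⁻¹ := by field_simp
      rw [e]
      exact mul_le_mul (F.le_weight i) (inv_sq_le_norm_sum H F i) (by positivity) (ha0 i).le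
    have h2 : ‖s • rowVec U i - a i • p i‖ / ‖a i • p i‖ ≤ ε / (M ^ 3)⁻¹ := by
      gcongr
      exact F.approx i
    rw [div_inv_eq_mul] at h2
    linarith
  -- The frame constant is `M^4` and the perturbation `2M³ε`, hence the exponents `51 = 48 + 3` in
  -- the smallness condition and `31 = 28 + 3` in the error.
  have hnear := C.svm_near_corners (ε := 2 * M ^ 3 * ε) (δ := δ) (by positivity)
    (by
      rw [le_div_iff₀ (by positivity)]
      calc 2 * M ^ 3 * ε * (500 * (M ^ 4) ^ 12) = 1000 * (M ^ 51 * ε) := by ring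
        _ ≤ 1 := by linarith) hδ0
    (hδ.trans (by
      calc M * ε = 1 * (M ^ 1 * ε) := by ring
        _ ≤ 2 * (M ^ 7 * ε) := by gcongr <;> first | exact hM1 | norm_num
        _ = _ := by ring))
    (α := α) (fun i l => by
      simp only [hα]
      have := F.nonneg i l
      have := (hp0 i).le
      positivity)
    (fun i => by rw [hαv, norm_smul, norm_inv, norm_norm, inv_mul_cancel₀ (hp0 i).ne'])
    (fun l => by
      obtain ⟨i, hi⟩ := F.pure_node l
      refine ⟨i, ?_⟩
      have h0 : ∀ m, m ≠ l → Pi i m = 0 := by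
        intro m hm
        have h1 := F.sum_one i
        rw [← Finset.add_sum_erase _ _ (Finset.mem_univ l), hi] at h1
        have h2 : ∑ m ∈ Finset.univ.erase l, Pi i m = 0 := by linarith
        exact (Finset.sum_eq_zero_iff_of_nonneg fun m _ => F.nonneg i m).1 h2 m
          (Finset.mem_erase.2 ⟨hm, Finset.mem_univ m⟩)
      have : p i = h l := by
        simp only [hp]
        rw [Finset.sum_eq_single l]
        · rw [hi, one_smul]
        · intro m _ hm; rw [h0 m hm, zero_smul]
        · simp
      rw [hαv, this])
    hx hwb
  set η := 142 * M ^ 31 * ε with hη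
  have hηe : 71 * (M ^ 4) ^ 7 * (2 * M ^ 3 * ε) = η := by rw [hη]; ring
  rw [hηe] at hnear
  obtain ⟨hn1, hn2⟩ := hnear
  have hsepη : 4 * η < (M ^ 4)⁻¹ := by
    rw [← one_div, lt_div_iff₀ (by positivity)]
    calc 4 * η * M ^ 4 = 568 * (M ^ 35 * ε) := by rw [hη]; ring
      _ < 1 := by linarith [hεM 35 (by norm_num)]
  classical
  choose! L hL using hn1
  have hsep : IsSeparated (rowVec (rowNormalize U)) (nearHyperplane (rowVec (rowNormalize U)) w b δ)
      (fun l => ‖h l‖⁻¹ • h l) L η := by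
    refine ⟨hL, fun l => ?_, fun k l hkl => lt_of_lt_of_le hsepη (C.inv_le_norm_sub hkl)⟩
    obtain ⟨i, hi, hil⟩ := hn2 l
    refine ⟨i, hi, ?_⟩
    by_contra hne
    have h1 := C.inv_le_norm_sub hne
    have h2 := hL i hi
    have h3 : ‖‖h (L i)‖⁻¹ • h (L i) - ‖h l‖⁻¹ • h l‖ ≤ 2 * η := by
      calc _ = ‖(rowVec (rowNormalize U) i - ‖h l‖⁻¹ • h l) -
            (rowVec (rowNormalize U) i - ‖h (L i)‖⁻¹ • h (L i))‖ := by congr 1; abel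
        _ ≤ _ := (norm_sub_le _ _).trans (by linarith)
    have hη0 : 0 ≤ η := by positivity
    linarith
  exact hsep.exists_perm hc hIc

end Recovery

/-! ### From the selected corners to the memberships. -/

section RecoverMemberships

open scoped RealInnerProductSpace

variable {n K : ℕ}

/-- The total mass of `y` differs from `a` by at most `χ`. If it is zero, the normalized vector is
zero and the error is `1 ≤ χ/a`. -/
theorem sum_abs_normalize_sub_le {ι : Type*} [Fintype ι] {y p : ι → ℝ} {a χ : ℝ} (ha : 0 < a)
    (hy : ∀ k, 0 ≤ y k) (hp1 : ∑ k, p k = 1) (hp : ∀ k, 0 ≤ p k)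
    (h : ∑ k, |y k - a * p k| ≤ χ) : ∑ k, |y k / ∑ l, |y l| - p k| ≤ 2 * (χ / a) := by
  have hχ : 0 ≤ χ := le_trans (Finset.sum_nonneg fun _ _ => abs_nonneg _) h
  have hY : ∑ l, |y l| = ∑ l, y l := Finset.sum_congr rfl fun l _ => abs_of_nonneg (hy l)
  rw [hY]
  set Y := ∑ l, y l with hYdef
  have hY0 : 0 ≤ Y := Finset.sum_nonneg fun l _ => hy l
  have hYa : |Y - a| ≤ χ := by
    have e : Y - a = ∑ k, (y k - a * p k) := by
      rw [Finset.sum_sub_distrib, ← Finset.mul_sum, hp1, mul_one]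
    rw [e]
    exact (Finset.abs_sum_le_sum_abs _ _).trans h
  rcases hY0.eq_or_lt with h0 | h0
  · have h1 : ∑ k, |y k / Y - p k| = 1 := by
      rw [← hp1]
      refine Finset.sum_congr rfl fun k _ => ?_
      rw [← h0, div_zero, zero_sub, abs_neg, abs_of_nonneg (hp k)]
    rw [h1]
    rw [← h0, zero_sub, abs_neg, abs_of_pos ha] at hYa
    have : 1 ≤ χ / a := by rwa [le_div_iff₀ ha, one_mul]
    linarith
  · have h1 : ∀ k, |y k / Y - p k| ≤ |y k - a * p k| / a + y k * (χ / (Y * a)) := by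
      intro k
      have e : y k / Y - p k = (y k - a * p k) / a + y k * ((a - Y) / (Y * a)) := by
        field_simp
        ring
      rw [e]
      refine (abs_add_le _ _).trans ?_
      rw [abs_div, abs_of_pos ha, abs_mul, abs_of_nonneg (hy k), abs_div,
        abs_of_pos (mul_pos h0 ha), abs_sub_comm a Y]
      have := hy k
      gcongr
    refine (Finset.sum_le_sum fun k _ => h1 k).trans ?_
    rw [Finset.sum_add_distrib, ← Finset.sum_div, ← Finset.sum_mul, ← hYdef]
    have e : Y * (χ / (Y * a)) = χ / a := by field_simp
    rw [e, two_mul]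
    gcongr

theorem norm_rowVec_rowNormalize_le (U : Matrix (Fin n) (Fin K) ℝ) (i : Fin n) :
    ‖rowVec (rowNormalize U) i‖ ≤ 1 := by
  rw [rowVec_rowNormalize, norm_smul, norm_inv, norm_norm]
  exact inv_mul_le_one

theorem abs_quadratic_sub_le {l : Fin K → ℝ} {M : ℝ} (hl : ∀ a, |l a| ≤ M)
    (x y : EuclideanSpace ℝ (Fin K)) :
    |∑ a, l a * x a ^ 2 - ∑ a, l a * y a ^ 2| ≤ M * (‖x - y‖ * ‖x + y‖) := by
  rcases isEmpty_or_nonempty (Fin K) with hK | ⟨⟨a₀⟩⟩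
  · simp [Subsingleton.elim x 0, Subsingleton.elim y 0]
  have hM : 0 ≤ M := (abs_nonneg _).trans (hl a₀)
  rw [← Finset.sum_sub_distrib]
  refine (Finset.abs_sum_le_sum_abs _ _).trans ?_
  have h1 : ∀ a, |l a * x a ^ 2 - l a * y a ^ 2| ≤ M * (|(x - y) a| * |(x + y) a|) := by
    intro a
    have e : l a * x a ^ 2 - l a * y a ^ 2 = l a * ((x - y) a * (x + y) a) := by
      simp only [PiLp.sub_apply, PiLp.add_apply]; ring
    rw [e, abs_mul, abs_mul]
    gcongr
    exact hl a
  refine (Finset.sum_le_sum fun a _ => h1 a).trans ?_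
  rw [← Finset.mul_sum]
  gcongr
  have h2 := Real.sum_mul_le_sqrt_mul_sqrt Finset.univ (fun a => |(x - y) a|) fun a => |(x + y) a|
  simpa [EuclideanSpace.norm_eq] using h2

variable {U Pi : Matrix (Fin n) (Fin K) ℝ} {a : Fin n → ℝ}
  {h j : Fin K → EuclideanSpace ℝ (Fin K)} {s M ε : ℝ}

/-- For exact corners the dual vectors read off the coefficients; replacing corners by the nearby `x
k` costs a fraction of the left side, absorbed by `M³η ≤ 1/2`. It yields both the invertibility of
the selected submatrix and the stability of coefficients. -/
theorem sum_abs_le_norm_sum (H : IsBiorthogonal h j M ε) {η : ℝ} (hη : M ^ 3 * η ≤ 1 / 2)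
    {π : Equiv.Perm (Fin K)} {x : Fin K → EuclideanSpace ℝ (Fin K)}
    (hx : ∀ k, ‖x k - ‖h (π k)‖⁻¹ • h (π k)‖ ≤ η) (c : Fin K → ℝ) :
    ∑ k, |c k| ≤ 2 * M ^ 3 * ‖∑ k, c k • x k‖ := by
  have hM : 0 < M := by linarith [H.two_le]
  set y := ∑ k, c k • (‖h (π k)‖⁻¹ • h (π k)) with hy
  have h1 : ∀ k, |c k| ≤ M ^ 2 * ‖y‖ := by
    intro k
    have e : ⟪‖h (π k)‖ • j (π k), y⟫ = c k := by
      rw [hy, inner_sum, Finset.sum_eq_single k]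
      · rw [real_inner_smul_left, real_inner_smul_right, real_inner_smul_right, H.dual,
          if_pos rfl]
        have := (H.norm_pos (π k)).ne'
        field_simp
      · intro m _ hm
        rw [real_inner_smul_left, real_inner_smul_right, real_inner_smul_right, H.dual,
          if_neg fun hh => hm (π.injective hh).symm]
        simp
      · simp
    rw [← e]
    refine (abs_real_inner_le_norm _ _).trans ?_
    rw [norm_smul, norm_norm, sq]
    gcongr
    · exact H.norm_le _
    · exact H.norm_dual _
  have h2 : ∑ k, |c k| ≤ M ^ 3 * ‖y‖ := by
    refine (Finset.sum_le_sum fun k _ => h1 k).trans ?_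
    rw [Finset.sum_const, Finset.card_univ, Fintype.card_fin, nsmul_eq_mul]
    calc (K : ℝ) * (M ^ 2 * ‖y‖) ≤ M * (M ^ 2 * ‖y‖) := by gcongr; exact H.card_le
      _ = _ := by ring
  have h3 : ‖y‖ ≤ ‖∑ k, c k • x k‖ + (∑ k, |c k|) * η := by
    have e : y = ∑ k, c k • x k - ∑ k, c k • (x k - ‖h (π k)‖⁻¹ • h (π k)) := by
      rw [hy, ← Finset.sum_sub_distrib]
      refine Finset.sum_congr rfl fun k _ => ?_
      rw [← smul_sub]; simp
    rw [e]
    refine (norm_sub_le _ _).trans ?_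
    gcongr
    refine (norm_sum_le _ _).trans ?_
    rw [Finset.sum_mul]
    refine Finset.sum_le_sum fun k _ => ?_
    rw [norm_smul, Real.norm_eq_abs]
    gcongr
    exact hx k
  have h4 : 0 ≤ ∑ k, |c k| := Finset.sum_nonneg fun _ _ => abs_nonneg _
  have h5 : M ^ 3 * ‖y‖ ≤ M ^ 3 * (‖∑ k, c k • x k‖ + (∑ k, |c k|) * η) := by gcongr
  nlinarith

/-- The memberships are recovered up to a permutation with an error of order `ε`. -/
theorem recovery (H : IsBiorthogonal h j M ε) (F : IsApproxFactor U Pi a h s M ε)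
    (hε0 : 0 ≤ ε) (hε : M ^ 51 * ε ≤ 1 / 4000) {δ : ℝ} (hδ0 : 0 ≤ δ) (hδ : δ ≤ M * ε)
    {lam l : Fin K → ℝ} {c : ℝ} (hc : 0 < c) (hlam : ∀ k, lam k = c * l k)
    (hl : ∀ k, |l k| ≤ M) (hT : ∀ m, |∑ k, l k * h m k ^ 2 - 1| ≤ ε)
    {I : Fin K → Fin n} (hI : IsSVMCone (rowVec (rowNormalize U)) δ I) :
    ∃ π : Equiv.Perm (Fin K), ∀ i,
      ∑ k, |zMatrix U lam I i k / ∑ m, |zMatrix U lam I i m| - Pi i (π k)| ≤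
        2556 * M ^ 38 * ε := by
  obtain ⟨π, hπ⟩ := svmCone_corners H F hε0 hε hδ0 hδ hI
  refine ⟨π, fun i => ?_⟩
  have hM2 := H.two_le
  have hM1 : 1 ≤ M := by linarith
  have hM : 0 < M := by linarith
  set η := 142 * M ^ 31 * ε with hη
  have hη0 : 0 ≤ η := by positivity
  have hεη : ε ≤ η := by
    have : 1 * ε ≤ 142 * M ^ 31 * ε := by
      gcongr
      have : 1 ≤ M ^ 31 := one_le_pow₀ hM1
      linarith
    linarith
  have hηM : M ^ 3 * η ≤ 1 / 2 := by
    have : M ^ 34 * ε ≤ M ^ 51 * ε := by gcongr ?_ * ε; exact pow_le_pow_right₀ hM1 (by norm_num)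
    calc M ^ 3 * η = 142 * (M ^ 34 * ε) := by rw [hη]; ring
      _ ≤ 1 / 2 := by linarith
  set x : Fin K → EuclideanSpace ℝ (Fin K) := fun k => rowVec (rowNormalize U) (I k) with hx
  set V : Matrix (Fin K) (Fin K) ℝ := (rowNormalize U).submatrix I id with hV
  have hVx : ∀ k b, V k b = x k b := fun k b => rfl
  have hcoef := sum_abs_le_norm_sum H hηM hπ
  have hsumV : ∀ q : Fin K → ℝ, ∑ k, q k • x k = WithLp.toLp 2 (Matrix.vecMul q V) := by
    intro q
    ext b
    simp [Matrix.vecMul, dotProduct, hVx]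
  have hunit : IsUnit V := by
    rw [← Matrix.vecMul_injective_iff_isUnit]
    refine (injective_iff_map_eq_zero (Matrix.vecMulLinear V)).2 fun q hq => ?_
    have hq' : Matrix.vecMul q V = 0 := hq
    have h1 := hcoef q
    change _ ≤ 2 * M ^ 3 * ‖∑ k, q k • x k‖ at h1
    rw [hsumV, hq'] at h1
    simp only [WithLp.toLp_zero, norm_zero, mul_zero] at h1
    have h2 := (Finset.sum_eq_zero_iff_of_nonneg fun k _ => abs_nonneg (q k)).1
      (le_antisymm h1 (Finset.sum_nonneg fun _ _ => abs_nonneg _))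
    ext k
    exact abs_eq_zero.1 (h2 k (Finset.mem_univ k))
  have hdet : IsUnit V.det := (Matrix.isUnit_iff_isUnit_det V).1 hunit
  -- The coordinates of row `i` of `U` in the selected normalized rows.
  set q : Fin K → ℝ := Matrix.vecMul (U i) V⁻¹ with hq
  have hqx : ∑ k, q k • x k = rowVec U i := by
    rw [hsumV, hq, Matrix.vecMul_vecMul, Matrix.nonsing_inv_mul _ hdet, Matrix.vecMul_one]
    rfl
  set T : Fin K → ℝ := fun k => ∑ b, l b * x k b ^ 2 with hT'
  -- The positive factor `√c / s` is common to all columns, so it drops out in the final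
  -- normalization.
  have hz : ∀ k, zMatrix U lam I i k = Real.sqrt c / s * max 0 (s * q k * Real.sqrt (T k)) := by
    intro k
    have e1 : (V * Matrix.diagonal lam * V.transpose) k k = c * T k := by
      rw [Matrix.mul_apply]
      simp only [Matrix.mul_diagonal, Matrix.transpose_apply, hT', hVx, hlam,
        Finset.mul_sum]
      exact Finset.sum_congr rfl fun b _ => by ring
    have e2 : (U * V⁻¹) i k = q k := rfl
    have e3 : zMatrix U lam I i k = max 0 (q k * Real.sqrt (c * T k)) := by
      rw [← e1, ← e2, zMatrix, Matrix.map_apply, Matrix.mul_diagonal]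
    have hs := F.scale_pos
    rw [e3, Real.sqrt_mul hc.le, mul_max_of_nonneg _ _ (by positivity), mul_zero]
    congr 1
    field_simp
  set u : Fin K → ℝ := fun k => ‖h (π k)‖⁻¹ with hu
  have hu0 : ∀ k, 0 < u k := fun k => inv_pos.2 (H.norm_pos _)
  have huM : ∀ k, u k ≤ M := fun k => by
    have := inv_anti₀ (inv_pos.2 hM) (H.inv_le_norm (π k))
    rwa [inv_inv] at this
  -- The quadratic form of `l` is almost one at `h (π k)`, hence almost `‖h (π k)‖⁻²` at the
  -- normalized corner.
  have hTk : ∀ k, |T k - u k ^ 2| ≤ 2 * M ^ 2 * η := by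
    intro k
    set v := u k • h (π k) with hv
    have hv1 : ‖v‖ = 1 := by
      rw [hv, norm_smul, Real.norm_of_nonneg (hu0 k).le]
      exact inv_mul_cancel₀ (H.norm_pos _).ne'
    have h1 := abs_quadratic_sub_le hl (x k) v
    have h2 : ‖x k - v‖ * ‖x k + v‖ ≤ η * 2 := by
      gcongr
      · exact hπ k
      · refine (norm_add_le _ _).trans ?_
        have := norm_rowVec_rowNormalize_le U (I k)
        rw [hv1]
        change ‖x k‖ ≤ 1 at this
        linarith
    have h3 : ∑ b, l b * v b ^ 2 - u k ^ 2 = u k ^ 2 * (∑ b, l b * h (π k) b ^ 2 - 1) := by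
      rw [mul_sub, mul_one, Finset.mul_sum]
      congr 1
      refine Finset.sum_congr rfl fun b _ => ?_
      rw [hv, PiLp.smul_apply, smul_eq_mul]; ring
    have h4 : |∑ b, l b * v b ^ 2 - u k ^ 2| ≤ M ^ 2 * ε := by
      rw [h3, abs_mul, abs_of_nonneg (by positivity)]
      have := hu0 k
      gcongr
      · exact huM k
      · exact hT _
    calc |T k - u k ^ 2| = |(T k - ∑ b, l b * v b ^ 2) + (∑ b, l b * v b ^ 2 - u k ^ 2)| := by
          congr 1; ring
      _ ≤ M * (η * 2) + M ^ 2 * ε := (abs_add_le _ _).trans (by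
          gcongr
          exact h1.trans (by gcongr))
      _ ≤ M * (η * M) + M ^ 2 * η := by gcongr
      _ = _ := by ring
  have hS : ∀ k, |Real.sqrt (T k) - u k| ≤ 2 * M ^ 3 * η := by
    intro k
    refine (abs_sqrt_sub_le _ (hu0 k)).trans ?_
    have e : (u k)⁻¹ = ‖h (π k)‖ := inv_inv _
    rw [div_eq_mul_inv, e]
    calc |T k - u k ^ 2| * ‖h (π k)‖ ≤ 2 * M ^ 2 * η * M := by
          gcongr
          · exact hTk k
          · exact H.norm_le _
      _ = _ := by ring
  have hS2 : ∀ k, Real.sqrt (T k) ≤ 2 * M := fun k => by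
    have := (abs_le.1 (hS k)).2
    have := huM k
    linarith
  have ha0 : 0 < a i := lt_of_lt_of_le (by positivity) (F.le_weight i)
  set p : Fin K → ℝ := fun k => Pi i (π k) with hp
  have hp0 : ∀ k, 0 ≤ p k := fun k => F.nonneg _ _
  have hp1 : ∑ k, p k = 1 := by rw [← F.sum_one i]; exact Equiv.sum_comp π fun k => Pi i k
  -- The ideal coordinates with respect to normalized corners; multiplying by `u k` restores `a i *
  -- p k`.
  set r : Fin K → ℝ := fun k => a i * p k * ‖h (π k)‖ with hr
  have hr0 : ∀ k, 0 ≤ r k := fun k => by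
    have := hp0 k
    positivity
  have hrsum : ∑ k, r k ≤ M ^ 2 := by
    calc ∑ k, r k ≤ ∑ k, M * p k * M := Finset.sum_le_sum fun k _ => by
          have := hp0 k
          simp only [hr]
          gcongr
          · exact F.weight_le i
          · exact H.norm_le _
      _ = M ^ 2 := by rw [← Finset.sum_mul, ← Finset.mul_sum, hp1]; ring
  have hqr : ∑ k, |s * q k - r k| ≤ 4 * M ^ 5 * η := by
    have h1 := hcoef fun k => s * q k - r k
    have e1 : ∑ k, r k • (u k • h (π k)) = a i • ∑ m, Pi i m • h m := by
      rw [← Equiv.sum_comp π fun m => Pi i m • h m, Finset.smul_sum]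
      refine Finset.sum_congr rfl fun k _ => ?_
      rw [smul_smul, smul_smul]
      congr 1
      have := (H.norm_pos (π k)).ne'
      simp only [hr, hp, hu]
      field_simp
    have e2 : ∑ k, (s * q k - r k) • x k = (s • rowVec U i - a i • ∑ m, Pi i m • h m) -
        ∑ k, r k • (x k - u k • h (π k)) := by
      rw [← hqx, ← e1, Finset.smul_sum]
      rw [← Finset.sum_sub_distrib, ← Finset.sum_sub_distrib]
      refine Finset.sum_congr rfl fun k _ => ?_
      rw [sub_smul, smul_sub, mul_smul]
      abel
    have h2 : ‖∑ k, (s * q k - r k) • x k‖ ≤ ε + M ^ 2 * η := by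
      rw [e2]
      refine (norm_sub_le _ _).trans ?_
      gcongr
      · exact F.approx i
      · refine (norm_sum_le _ _).trans ?_
        calc ∑ k, ‖r k • (x k - u k • h (π k))‖ ≤ ∑ k, r k * η := by
              refine Finset.sum_le_sum fun k _ => ?_
              rw [norm_smul, Real.norm_of_nonneg (hr0 k)]
              exact mul_le_mul_of_nonneg_left (hπ k) (hr0 k)
          _ ≤ _ := by rw [← Finset.sum_mul]; gcongr
    have h3 : ε ≤ M ^ 2 * η := by
      calc ε ≤ 1 * η := by linarith
        _ ≤ M ^ 2 * η := by gcongr; exact one_le_pow₀ hM1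
    refine h1.trans ?_
    calc 2 * M ^ 3 * ‖∑ k, (s * q k - r k) • x k‖ ≤ 2 * M ^ 3 * (M ^ 2 * η + M ^ 2 * η) := by
          gcongr; linarith
      _ = _ := by ring
  set y : Fin K → ℝ := fun k => max 0 (s * q k * Real.sqrt (T k)) with hy
  have hy0 : ∀ k, 0 ≤ y k := fun k => le_max_left _ _
  have hyap : ∑ k, |y k - a i * p k| ≤ 9 * M ^ 6 * η := by
    have h1 : ∀ k, |y k - a i * p k| ≤ |s * q k - r k| * (2 * M) + r k * (2 * M ^ 3 * η) := by
      intro k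
      have h2 : |y k - a i * p k| ≤ |s * q k * Real.sqrt (T k) - a i * p k| := by
        have h3 : 0 ≤ a i * p k := mul_nonneg ha0.le (hp0 k)
        have := abs_max_sub_max_le_abs (s * q k * Real.sqrt (T k)) (a i * p k) 0
        rw [max_eq_left h3, max_comm] at this
        exact this
      have e : s * q k * Real.sqrt (T k) - a i * p k =
          (s * q k - r k) * Real.sqrt (T k) + r k * (Real.sqrt (T k) - u k) := by
        have : r k * u k = a i * p k := by
          have := (H.norm_pos (π k)).ne'
          simp only [hr, hu]
          field_simp
        linear_combination this
      rw [e] at h2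
      refine h2.trans ((abs_add_le _ _).trans ?_)
      rw [abs_mul, abs_mul, abs_of_nonneg (Real.sqrt_nonneg _), abs_of_nonneg (hr0 k)]
      gcongr
      · exact hS2 k
      · exact hr0 k
      · exact hS k
    refine (Finset.sum_le_sum fun k _ => h1 k).trans ?_
    rw [Finset.sum_add_distrib, ← Finset.sum_mul, ← Finset.sum_mul]
    calc (∑ k, |s * q k - r k|) * (2 * M) + (∑ k, r k) * (2 * M ^ 3 * η)
        ≤ 4 * M ^ 5 * η * (2 * M) + M ^ 2 * (2 * M ^ 3 * η) := by gcongr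
      _ = 8 * M ^ 6 * η + 2 * (M ^ 5 * η) := by ring
      _ ≤ 8 * M ^ 6 * η + M * (M ^ 5 * η) := by gcongr
      _ = _ := by ring
  have hfin := sum_abs_normalize_sub_le ha0 hy0 hp1 hp0 hyap
  have e : ∀ k, zMatrix U lam I i k / ∑ m, |zMatrix U lam I i m| = y k / ∑ m, |y m| := by
    intro k
    have hs := F.scale_pos
    have hκ : 0 < Real.sqrt c / s := div_pos (Real.sqrt_pos.2 hc) hs
    simp only [hz]
    have : ∑ m, |Real.sqrt c / s * max 0 (s * q m * Real.sqrt (T m))| =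
        Real.sqrt c / s * ∑ m, |y m| := by
      rw [Finset.mul_sum]
      refine Finset.sum_congr rfl fun m _ => ?_
      rw [abs_mul, abs_of_pos hκ]
    rw [this, mul_div_mul_left _ _ hκ.ne']
  simp only [e]
  refine hfin.trans ?_
  rw [div_eq_mul_inv]
  have hinv : (a i)⁻¹ ≤ M := by
    have := inv_anti₀ (inv_pos.2 hM) (F.le_weight i)
    rwa [inv_inv] at this
  calc 2 * (9 * M ^ 6 * η * (a i)⁻¹) ≤ 2 * (9 * M ^ 6 * η * M) := by gcongr
    _ = _ := by rw [hη]; ring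

end RecoverMemberships

/-! ### Leading eigenvectors of a perturbed low rank matrix -/

section LeadingEigenvectors

open Matrix

variable {n K : ℕ}

theorem IsLeadingEigen.smul {A : Matrix (Fin n) (Fin n) ℝ} {U : Matrix (Fin n) (Fin K) ℝ}
    {lam : Fin K → ℝ} (h : IsLeadingEigen A U lam) {c : ℝ} (hc : c ≠ 0) :
    IsLeadingEigen (c • A) U (c • lam) where
  orthonormal := h.orthonormal
  eigen := by
    rw [smul_mul, h.eigen, diagonal_smul, Matrix.mul_smul]
  ordered := fun k l hkl => by
    have := h.ordered hkl
    simp only [Pi.smul_apply, smul_eq_mul, abs_mul] at this ⊢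
    gcongr
  leading := fun v ν hv hν hU k => by
    have h1 : A *ᵥ v = (c⁻¹ * ν) • v := by
      rw [smul_mulVec] at hν
      rw [mul_smul, ← hν, smul_smul, inv_mul_cancel₀ hc, one_smul]
    have h2 := h.leading v _ hv h1 hU k
    rw [abs_mul, abs_inv] at h2
    rw [Pi.smul_apply, smul_eq_mul, abs_mul]
    have hc' : 0 < |c| := abs_pos.2 hc
    calc |ν| = |c| * (|c|⁻¹ * |ν|) := by field_simp
      _ ≤ _ := by gcongr

theorem l2norm_mulVec_of_orthogonal {m : ℕ} {V : Matrix (Fin m) (Fin n) ℝ} (hV : Vᵀ * V = 1)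
    (x : Fin n → ℝ) : l2norm (V *ᵥ x) = l2norm x := by
  have h : l2norm (V *ᵥ x) ^ 2 = l2norm x ^ 2 := by
    rw [← dotProduct_self_eq_l2norm_sq, ← dotProduct_self_eq_l2norm_sq, dotProduct_mulVec,
      vecMul_mulVec, hV, vecMul_one]
  exact (sq_eq_sq₀ (l2norm_nonneg _) (l2norm_nonneg _)).1 h

theorem IsLeadingEigen.column_spec {A : Matrix (Fin n) (Fin n) ℝ} {U : Matrix (Fin n) (Fin K) ℝ}
    {lam : Fin K → ℝ} (h : IsLeadingEigen A U lam) (k : Fin K) :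
    A *ᵥ (fun i => U i k) = lam k • fun i => U i k := by
  ext i
  have := congrFun (congrFun h.eigen i) k
  rw [mul_diagonal] at this
  simp only [Pi.smul_apply, smul_eq_mul]
  rw [mul_comm, ← this]
  rfl

theorem IsLeadingEigen.l2norm_column {A : Matrix (Fin n) (Fin n) ℝ} {U : Matrix (Fin n) (Fin K) ℝ}
    {lam : Fin K → ℝ} (h : IsLeadingEigen A U lam) (k : Fin K) :
    l2norm (fun i => U i k) = 1 := by
  have h1 : l2norm (fun i => U i k) ^ 2 = 1 := by
    rw [← dotProduct_self_eq_l2norm_sq]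
    have := congrFun (congrFun h.orthonormal k) k
    rwa [one_apply_eq] at this
  have := l2norm_nonneg fun i => U i k
  nlinarith

/-- On vectors orthogonal to all but one of the leading eigenvectors, the matrix is controlled by
the remaining leading eigenvalue. -/
theorem IsLeadingEigen.l2norm_mulVec_le {A : Matrix (Fin n) (Fin n) ℝ}
    {U : Matrix (Fin n) (Fin K) ℝ} {lam : Fin K → ℝ} (h : IsLeadingEigen A U lam) (hA : Aᵀ = A)
    (k : Fin K) {x : Fin n → ℝ} (hx : ∀ m, m ≠ k → (Uᵀ *ᵥ x) m = 0) :
    l2norm (A *ᵥ x) ≤ 2 * |lam k| * l2norm x := by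
  -- Eigenvectors of the deflated matrix with nonzero eigenvalue are orthogonal to `U` and are
  -- eigenvectors of `A`, so `leading` bounds all its eigenvalues by `|lam k|`.
  set B := A - U * diagonal lam * Uᵀ with hB
  have hBsymm : Bᵀ = B := by
    rw [hB, transpose_sub, transpose_mul, transpose_mul, transpose_transpose, diagonal_transpose,
      hA, Matrix.mul_assoc]
  have hUA : Uᵀ * A = diagonal lam * Uᵀ := by
    have := congrArg transpose h.eigen
    rwa [transpose_mul, transpose_mul, diagonal_transpose, hA] at this
  have hUB : Uᵀ * B = 0 := by
    rw [hB, Matrix.mul_sub, hUA, ← Matrix.mul_assoc, ← Matrix.mul_assoc, h.orthonormal,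
      Matrix.one_mul, sub_self]
  obtain ⟨V, d, hV1, hV2, hBV⟩ := (IsHermitian.ext fun i j => by
    rw [star_trivial]
    exact congrFun (congrFun hBsymm i) j : B.IsHermitian).exists_orthogonal_diagonal
  have hd : ∀ a, |d a| ≤ |lam k| := by
    intro a
    rcases eq_or_ne (d a) 0 with h0 | h0
    · rw [h0, abs_zero]; exact abs_nonneg _
    set v : Fin n → ℝ := fun i => V i a with hv
    have hBv : B *ᵥ v = d a • v := by
      have h1 : B * V = V * diagonal d := by
        rw [hBV, Matrix.mul_assoc, hV1, Matrix.mul_one]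
      ext i
      have := congrFun (congrFun h1 i) a
      rw [mul_diagonal] at this
      simp only [Pi.smul_apply, smul_eq_mul]
      rw [mul_comm, ← this]
      rfl
    have hUv : Uᵀ *ᵥ v = 0 := by
      have h1 : Uᵀ *ᵥ (B *ᵥ v) = 0 := by rw [mulVec_mulVec, hUB, zero_mulVec]
      rw [hBv, mulVec_smul] at h1
      exact (smul_eq_zero.1 h1).resolve_left h0
    have hv0 : v ≠ 0 := by
      intro h1
      have h2 := congrFun (congrFun hV1 a) a
      rw [one_apply_eq, mul_apply] at h2
      have h3 : ∀ i, V i a = 0 := fun i => congrFun h1 i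
      simp [h3] at h2
    refine h.leading v (d a) hv0 ?_ hUv k
    have : A *ᵥ v = B *ᵥ v := by
      rw [hB, sub_mulVec, ← mulVec_mulVec, hUv, mulVec_zero, sub_zero]
    rw [this, hBv]
  have hBx : l2norm (B *ᵥ x) ≤ |lam k| * l2norm x := by
    rw [hBV, ← mulVec_mulVec, ← mulVec_mulVec, l2norm_mulVec_of_orthogonal hV1]
    have hVt : l2norm (Vᵀ *ᵥ x) = l2norm x :=
      l2norm_mulVec_of_orthogonal (by rw [transpose_transpose, hV2]) x
    rw [← hVt, ← abs_of_nonneg (abs_nonneg (lam k)), ← l2norm_smul]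
    refine l2norm_le_of_abs_le_abs fun i => ?_
    rw [mulVec_diagonal, Pi.smul_apply, smul_eq_mul, abs_mul, abs_mul, abs_abs]
    exact mul_le_mul_of_nonneg_right (hd i) (abs_nonneg _)
  have hAx : A *ᵥ x = B *ᵥ x + (lam k * (Uᵀ *ᵥ x) k) • fun i => U i k := by
    have h1 : (U * diagonal lam * Uᵀ) *ᵥ x = (lam k * (Uᵀ *ᵥ x) k) • fun i => U i k := by
      rw [← mulVec_mulVec, ← mulVec_mulVec]
      ext i
      rw [mulVec, dotProduct, Finset.sum_eq_single k]
      · rw [mulVec_diagonal, Pi.smul_apply, smul_eq_mul]; ring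
      · intro m _ hm
        rw [mulVec_diagonal, hx m hm]; simp
      · simp
    rw [← h1, hB, sub_mulVec, sub_add_cancel]
  have hUx : |(Uᵀ *ᵥ x) k| ≤ l2norm x := by
    have := abs_dotProduct_le (fun i => U i k) x
    rw [h.l2norm_column, one_mul] at this
    exact this
  rw [hAx]
  refine (l2norm_add_le _ _).trans ?_
  rw [l2norm_smul, h.l2norm_column, mul_one, abs_mul]
  have : |lam k| * |(Uᵀ *ᵥ x) k| ≤ |lam k| * l2norm x := by gcongr
  linarith

theorem abs_mul_apply_le {ι κ : Type*} {X : Matrix ι (Fin K) ℝ} {Y : Matrix (Fin K) κ ℝ}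
    {x y : ℝ} (hx : 0 ≤ x) (hX : ∀ i k, |X i k| ≤ x) (hY : ∀ k j, |Y k j| ≤ y) (i : ι) (j : κ) :
    |(X * Y) i j| ≤ K * (x * y) := by
  rw [mul_apply]
  refine (Finset.abs_sum_le_sum_abs _ _).trans ?_
  refine (Finset.sum_le_sum fun k _ => (?_ : |X i k * Y k j| ≤ x * y)).trans ?_
  · rw [abs_mul]
    exact mul_le_mul (hX i k) (hY k j) (abs_nonneg _) hx
  · simp

/-- Bounds for the quantities of the degree corrected mixed membership model. -/
structure IsFactorModel (Pi : Matrix (Fin n) (Fin K) ℝ) (P : Matrix (Fin K) (Fin K) ℝ)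
    (a : Fin n → ℝ) (M : ℝ) : Prop where
  two_le : 2 ≤ M
  n_pos : 0 < n
  card_le : (K : ℝ) ≤ M
  nonneg : ∀ i k, 0 ≤ Pi i k
  sum_one : ∀ i, ∑ k, Pi i k = 1
  pure_node : ∀ k, ∃ i, Pi i k = 1
  P_symm : Pᵀ = P
  P_diag : ∀ k, P k k = 1
  P_le : ∀ k l, |P k l| ≤ M
  le_mulVec : ∀ x, l2norm x ≤ M * l2norm (P *ᵥ x)
  le_weight : ∀ i, M⁻¹ ≤ a i
  weight_le : ∀ i, a i ≤ M
  le_Pi_mulVec : ∀ x, n * l2norm x ^ 2 ≤ M * l2norm (Pi *ᵥ x) ^ 2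

namespace IsFactorModel

variable {Pi : Matrix (Fin n) (Fin K) ℝ} {P : Matrix (Fin K) (Fin K) ℝ} {a : Fin n → ℝ} {M : ℝ}

theorem pos (S : IsFactorModel Pi P a M) : 0 < M := by linarith [S.two_le]

theorem weight_pos (S : IsFactorModel Pi P a M) (i : Fin n) : 0 < a i :=
  lt_of_lt_of_le (inv_pos.2 S.pos) (S.le_weight i)

theorem loading_nonneg (S : IsFactorModel Pi P a M) (i : Fin n) (l : Fin K) :
    0 ≤ (diagonal a * Pi) i l := by
  rw [diagonal_mul]
  exact mul_nonneg (S.weight_pos i).le (S.nonneg i l)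

theorem loading_sum_le (S : IsFactorModel Pi P a M) (i : Fin n) :
    ∑ l, (diagonal a * Pi) i l ≤ M := by
  simp only [diagonal_mul]
  rw [← Finset.mul_sum, S.sum_one, mul_one]
  exact S.weight_le i

theorem abs_loading_le (S : IsFactorModel Pi P a M) (i : Fin n) (l : Fin K) :
    |(diagonal a * Pi) i l| ≤ M := by
  rw [abs_of_nonneg (S.loading_nonneg i l)]
  exact (Finset.single_le_sum (fun l _ => S.loading_nonneg i l) (Finset.mem_univ l)).trans
    (S.loading_sum_le i)

theorem abs_loading_mulVec_le (S : IsFactorModel Pi P a M) {x : Fin K → ℝ} {φ : ℝ}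
    (hx : ∀ l, |x l| ≤ φ) (hφ : 0 ≤ φ) (i : Fin n) : |((diagonal a * Pi) *ᵥ x) i| ≤ M * φ := by
  rw [mulVec, dotProduct]
  refine (Finset.abs_sum_le_sum_abs _ _).trans ?_
  calc ∑ l, |(diagonal a * Pi) i l * x l| ≤ ∑ l, (diagonal a * Pi) i l * φ := by
        refine Finset.sum_le_sum fun l _ => ?_
        rw [abs_mul, abs_of_nonneg (S.loading_nonneg i l)]
        exact mul_le_mul_of_nonneg_left (hx l) (S.loading_nonneg i l)
    _ ≤ _ := by
        rw [← Finset.sum_mul]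
        gcongr
        exact S.loading_sum_le i

theorem l2norm_loading_mulVec_le (S : IsFactorModel Pi P a M) {x : Fin K → ℝ} {φ : ℝ}
    (hx : ∀ l, |x l| ≤ φ) (hφ : 0 ≤ φ) :
    l2norm ((diagonal a * Pi) *ᵥ x) ≤ Real.sqrt n * (M * φ) := by
  have hM := S.pos
  have := l2norm_le_of_abs_le (by positivity) (S.abs_loading_mulVec_le hx hφ)
  rwa [Fintype.card_fin] at this

theorem abs_transpose_mulVec_le (S : IsFactorModel Pi P a M) (x : Fin n → ℝ) (l : Fin K) :
    |((diagonal a * Pi)ᵀ *ᵥ x) l| ≤ Real.sqrt n * M * l2norm x := by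
  have h1 := abs_dotProduct_le (fun i => (diagonal a * Pi) i l) x
  have h2 := l2norm_le_of_abs_le S.pos.le fun i => S.abs_loading_le i l
  rw [Fintype.card_fin] at h2
  have := l2norm_nonneg x
  exact h1.trans (by gcongr)

theorem abs_P_mulVec_le (S : IsFactorModel Pi P a M) {x : Fin K → ℝ} {φ : ℝ}
    (hx : ∀ l, |x l| ≤ φ) (hφ : 0 ≤ φ) (l : Fin K) : |(P *ᵥ x) l| ≤ M ^ 2 * φ := by
  have hM := S.pos
  rw [mulVec, dotProduct]
  refine (Finset.abs_sum_le_sum_abs _ _).trans ?_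
  calc ∑ m, |P l m * x m| ≤ ∑ _m : Fin K, M * φ := by
        refine Finset.sum_le_sum fun m _ => ?_
        rw [abs_mul]
        exact mul_le_mul (S.P_le l m) (hx m) (abs_nonneg _) hM.le
    _ = K * (M * φ) := by simp
    _ ≤ M * (M * φ) := by gcongr; exact S.card_le
    _ = _ := by ring

theorem le_l2norm_loading_mulVec (S : IsFactorModel Pi P a M) (x : Fin K → ℝ) :
    n * l2norm x ^ 2 ≤ M ^ 3 * l2norm ((diagonal a * Pi) *ᵥ x) ^ 2 := by
  have hM := S.pos
  have h1 : l2norm (Pi *ᵥ x) ≤ M * l2norm ((diagonal a * Pi) *ᵥ x) := by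
    rw [← abs_of_pos hM, ← l2norm_smul]
    refine l2norm_le_of_abs_le_abs fun i => ?_
    rw [← mulVec_mulVec, _root_.Pi.smul_apply, mulVec_diagonal, smul_eq_mul, ← mul_assoc, abs_mul]
    have h2 : 1 ≤ |M * a i| := by
      have := (inv_le_iff_one_le_mul₀' hM).1 (S.le_weight i)
      exact this.trans (le_abs_self _)
    exact le_mul_of_one_le_left (abs_nonneg _) h2
  have h3 := S.le_Pi_mulVec x
  have h4 := l2norm_nonneg (Pi *ᵥ x)
  calc _ ≤ M * l2norm (Pi *ᵥ x) ^ 2 := h3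
    _ ≤ M * (M * l2norm ((diagonal a * Pi) *ᵥ x)) ^ 2 := by gcongr
    _ = _ := by ring

end IsFactorModel

end LeadingEigenvectors

/-! ### Eigenvalues and eigenvectors of the perturbed factor model. -/

section EigenvectorStructure

open Matrix

open scoped RealInnerProductSpace

variable {n K : ℕ} {Pi : Matrix (Fin n) (Fin K) ℝ} {P : Matrix (Fin K) (Fin K) ℝ} {a : Fin n → ℝ}
  {M ω : ℝ} {A W : Matrix (Fin n) (Fin n) ℝ} {U : Matrix (Fin n) (Fin K) ℝ} {lam : Fin K → ℝ}

/-- A min-max argument: some nonzero `x = F y` is orthogonal to all leading eigenvectors but the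
`k`-th, so `A x` is at most of size `2|lam k| l2norm x`, whereas the conditioning of `F` and `P`
bounds the signal part of `A x` from below. -/
theorem IsFactorModel.inv_le_abs_eigenvalue (S : IsFactorModel Pi P a M)
    (hA : A = (n : ℝ)⁻¹ • (diagonal a * Pi * P * (diagonal a * Pi)ᵀ) + W) (hAs : Aᵀ = A)
    (hW : ∀ x, l2norm (W *ᵥ x) ≤ ω * l2norm x) (hω0 : 0 ≤ ω) (hω : M ^ 9 * ω ≤ 1)
    (h : IsLeadingEigen A U lam) (k : Fin K) : (M ^ 9)⁻¹ ≤ |lam k| := by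
  have hM := S.pos
  have hM2 := S.two_le
  have hn : (0 : ℝ) < n := Nat.cast_pos.2 S.n_pos
  set F := diagonal a * Pi with hF
  -- Zeroing row `k` makes `Uᵀ F` singular; a kernel vector meets the other `K - 1` orthogonality
  -- conditions.
  obtain ⟨y, hy0, hy⟩ := exists_mulVec_eq_zero_iff.2
    (det_eq_zero_of_row_eq_zero (A := (Uᵀ * F).updateRow k 0) k fun j => by simp)
  have hx : ∀ m, m ≠ k → (Uᵀ *ᵥ (F *ᵥ y)) m = 0 := by
    intro m hm
    have := congrFun hy m
    rw [mulVec, updateRow_ne hm] at this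
    rw [mulVec_mulVec]
    exact this
  have h1 := h.l2norm_mulVec_le hAs k hx
  set x := F *ᵥ y with hxdef
  set z := Fᵀ *ᵥ x with hz
  set w := P *ᵥ z with hw
  have hY : 0 < l2norm y := lt_of_le_of_ne (l2norm_nonneg y) fun h0 => hy0 (l2norm_eq_zero.1 h0.symm)
  have hnz : n * l2norm y ≤ M ^ 3 * l2norm z := by
    have e1 : y ⬝ᵥ z = l2norm x ^ 2 := by
      rw [← dotProduct_self_eq_l2norm_sq, hz, dotProduct_mulVec, vecMul_transpose]
    have e2 := (le_abs_self _).trans (abs_dotProduct_le y z)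
    have e3 := S.le_l2norm_loading_mulVec y
    rw [← hF, ← hxdef, ← e1] at e3
    have e4 : l2norm y * (n * l2norm y) ≤ l2norm y * (M ^ 3 * l2norm z) := by
      calc l2norm y * (n * l2norm y) = n * l2norm y ^ 2 := by ring
        _ ≤ M ^ 3 * (y ⬝ᵥ z) := e3
        _ ≤ M ^ 3 * (l2norm y * l2norm z) := by gcongr
        _ = _ := by ring
    exact le_of_mul_le_mul_left e4 hY
  have hzw : l2norm z ≤ M * l2norm w := S.le_mulVec z
  have hFw := S.le_l2norm_loading_mulVec w
  rw [← hF] at hFw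
  have hAx : A *ᵥ x = (n : ℝ)⁻¹ • (F *ᵥ w) + W *ᵥ x := by
    rw [hA, add_mulVec, smul_mulVec, ← mulVec_mulVec, ← mulVec_mulVec]
  have hFwle : l2norm (F *ᵥ w) ≤ n * ((2 * |lam k| + ω) * l2norm x) := by
    have e1 : F *ᵥ w = (n : ℝ) • (A *ᵥ x - W *ᵥ x) := by
      rw [hAx, add_sub_cancel_right, smul_smul, mul_inv_cancel₀ hn.ne', one_smul]
    rw [e1, l2norm_smul, abs_of_pos hn]
    gcongr
    refine (l2norm_sub_le _ _).trans ?_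
    linarith [hW x]
  have hxy : l2norm x ≤ Real.sqrt n * (M * l2norm y) :=
    S.l2norm_loading_mulVec_le (fun l => abs_le_l2norm y l) hY.le
  set q := 2 * |lam k| + ω with hq
  have hq0 : 0 ≤ q := by positivity
  have hx0 := l2norm_nonneg x
  have hw0 := l2norm_nonneg w
  have hz0 := l2norm_nonneg z
  have hFw0 := l2norm_nonneg (F *ᵥ w)
  have hsq : Real.sqrt n ^ 2 = n := Real.sq_sqrt hn.le
  have hmain : (n : ℝ) ^ 3 * l2norm y ^ 2 * 1 ≤ n ^ 3 * l2norm y ^ 2 * (M ^ 13 * q ^ 2) := by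
    calc (n : ℝ) ^ 3 * l2norm y ^ 2 * 1 = n * (n * l2norm y) ^ 2 := by ring
      _ ≤ n * (M ^ 3 * (M * l2norm w)) ^ 2 := by
          gcongr (n : ℝ) * ?_ ^ 2
          exact hnz.trans (by gcongr)
      _ = M ^ 8 * (n * l2norm w ^ 2) := by ring
      _ ≤ M ^ 8 * (M ^ 3 * (n * (q * (Real.sqrt n * (M * l2norm y)))) ^ 2) := by
          gcongr M ^ 8 * ?_
          refine hFw.trans ?_
          gcongr M ^ 3 * ?_ ^ 2
          exact hFwle.trans (by gcongr)
      _ = M ^ 13 * q ^ 2 * n ^ 2 * Real.sqrt n ^ 2 * l2norm y ^ 2 := by ring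
      _ = _ := by rw [hsq]; ring
  have h2 := le_of_mul_le_mul_left hmain (by positivity)
  have h3 : M ^ 13 * q ^ 2 ≤ (M ^ 7 * q) ^ 2 := by
    calc M ^ 13 * q ^ 2 ≤ M ^ 14 * q ^ 2 := by
          gcongr ?_ * q ^ 2
          exact pow_le_pow_right₀ (by linarith) (by norm_num)
      _ = _ := by ring
  have h4 : 1 ≤ M ^ 7 * q := by
    by_contra hlt
    push Not at hlt
    have : (M ^ 7 * q) ^ 2 < 1 := by
      have : 0 ≤ M ^ 7 * q := by positivity
      nlinarith
    linarith
  have h5 : ∀ t : ℝ, 0 ≤ t → 4 * (M ^ 7 * t) ≤ M ^ 9 * t := by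
    intro t ht
    calc 4 * (M ^ 7 * t) = 2 ^ 2 * (M ^ 7 * t) := by norm_num
      _ ≤ M ^ 2 * (M ^ 7 * t) := by gcongr
      _ = _ := by ring
  have h6 := h5 ω hω0
  have h7 := h5 |lam k| (abs_nonneg _)
  rw [inv_le_iff_one_le_mul₀' (by positivity)]
  rw [hq, mul_add] at h4
  linarith

theorem IsFactorModel.abs_eigenvalue_le (S : IsFactorModel Pi P a M)
    (hA : A = (n : ℝ)⁻¹ • (diagonal a * Pi * P * (diagonal a * Pi)ᵀ) + W)
    (hW : ∀ x, l2norm (W *ᵥ x) ≤ ω * l2norm x) (hω : ω ≤ 1)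
    (h : IsLeadingEigen A U lam) (k : Fin K) : |lam k| ≤ M ^ 5 := by
  have hM := S.pos
  have hM2 := S.two_le
  have hn : (0 : ℝ) < n := Nat.cast_pos.2 S.n_pos
  set u : Fin n → ℝ := fun i => U i k with hu
  have hu1 : l2norm u = 1 := h.l2norm_column k
  have h1 : |lam k| = l2norm (A *ᵥ u) := by rw [h.column_spec k, l2norm_smul, hu1, mul_one]
  rw [h1, hA, add_mulVec, smul_mulVec, ← mulVec_mulVec, ← mulVec_mulVec]
  refine (l2norm_add_le _ _).trans ?_
  have h2 : l2norm ((diagonal a * Pi) *ᵥ P *ᵥ (diagonal a * Pi)ᵀ *ᵥ u) ≤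
      Real.sqrt n * (M * (M ^ 2 * (Real.sqrt n * M))) := by
    refine S.l2norm_loading_mulVec_le (S.abs_P_mulVec_le (fun l => ?_) (by positivity))
      (by positivity)
    have := S.abs_transpose_mulVec_le u l
    rwa [hu1, mul_one] at this
  have h3 : l2norm ((n : ℝ)⁻¹ • ((diagonal a * Pi) *ᵥ P *ᵥ (diagonal a * Pi)ᵀ *ᵥ u)) ≤ M ^ 4 := by
    rw [l2norm_smul, abs_of_pos (inv_pos.2 hn), inv_mul_le_iff₀ hn]
    refine h2.trans (le_of_eq ?_)
    calc _ = Real.sqrt n ^ 2 * M ^ 4 := by ring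
      _ = _ := by rw [Real.sq_sqrt hn.le]
  have h4 := hW u
  rw [hu1, mul_one] at h4
  have h5 : 1 ≤ M ^ 4 := one_le_pow₀ (by linarith)
  calc _ ≤ M ^ 4 + M ^ 4 := by linarith
    _ = 2 * M ^ 4 := by ring
    _ ≤ M * M ^ 4 := by gcongr
    _ = _ := by ring

theorem resolventVec_mulVec (t : ℝ) (W : Matrix (Fin n) (Fin n) ℝ) (F : Matrix (Fin n) (Fin K) ℝ)
    (x : Fin K → ℝ) (i : Fin n) :
    resolventVec t W (F *ᵥ x) i = ∑ l, resolventVec t W (fun i => F i l) i * x l := by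
  rw [resolventVec, mulVec_mulVec]
  rfl

theorem norm_toLp_le_of_abs_le {x : Fin K → ℝ} {φ : ℝ} (hM : 1 ≤ M) (hK : (K : ℝ) ≤ M)
    (hφ : 0 ≤ φ) (hx : ∀ k, |x k| ≤ φ) : ‖(WithLp.toLp 2 x : EuclideanSpace ℝ (Fin K))‖ ≤ M * φ := by
  have h1 := l2norm_le_of_abs_le hφ hx
  rw [Fintype.card_fin] at h1
  refine h1.trans ?_
  gcongr
  rw [Real.sqrt_le_iff]
  exact ⟨by linarith, by nlinarith⟩

/-- The rows of the leading eigenvectors of a perturbed factor model are close to a linear image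
of the rows of the membership matrix. -/
theorem IsFactorModel.eigenvector_structure (S : IsFactorModel Pi P a M)
    (hA : A = (n : ℝ)⁻¹ • (diagonal a * Pi * P * (diagonal a * Pi)ᵀ) + W) (hAs : Aᵀ = A)
    (hW : ∀ x, l2norm (W *ᵥ x) ≤ ω * l2norm x) (hω0 : 0 ≤ ω) (hω : M ^ 9 * ω ≤ 1 / 2)
    (h : IsLeadingEigen A U lam) {e : ℝ} (he0 : 0 ≤ e) (he : M ^ 32 * e ≤ 1 / 4)
    (hR : ∀ t, |t| ≤ M ^ 9 → ∀ l i, |resolventVec t W (fun i => (diagonal a * Pi) i l) i -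
      (diagonal a * Pi) i l| ≤ e) :
    ∃ f g : Fin K → EuclideanSpace ℝ (Fin K), IsBiorthogonal f g (M ^ 13) (M ^ 32 * e) ∧
      IsApproxFactor U Pi a f (Real.sqrt n) (M ^ 13) (M ^ 32 * e) ∧ (∀ k, |lam k| ≤ M ^ 13) ∧
      ∀ m, |∑ k, lam k * f m k ^ 2 - 1| ≤ M ^ 32 * e := by
  have hM := S.pos
  have hM2 := S.two_le
  have hM1 : 1 ≤ M := by linarith
  have hpow : ∀ {p q : ℕ}, p ≤ q → M ^ p ≤ M ^ q := fun hpq => pow_le_pow_right₀ hM1 hpq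
  have hKM := S.card_le
  have hn : (0 : ℝ) < n := Nat.cast_pos.2 S.n_pos
  have hlow := S.inv_le_abs_eigenvalue hA hAs hW hω0 (by linarith) h
  have hlam0 : ∀ k, lam k ≠ 0 := fun k => abs_pos.1 (lt_of_lt_of_le (by positivity) (hlow k))
  have hω1 : ω ≤ 1 := by
    have : 1 * ω ≤ M ^ 9 * ω := by gcongr; exact one_le_pow₀ hM1
    linarith
  have hup := S.abs_eigenvalue_le hA hW hω1 h
  have hinvlam : ∀ k, |(lam k)⁻¹| ≤ M ^ 9 := fun k => by
    rw [abs_inv]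
    have := inv_anti₀ (by positivity) (hlow k)
    rwa [inv_inv] at this
  set F := diagonal a * Pi with hF
  set N := Real.sqrt n with hN
  have hN0 : 0 < N := Real.sqrt_pos.2 hn
  have hNN : N * N = n := Real.mul_self_sqrt hn.le
  set κ : Matrix (Fin K) (Fin K) ℝ := N⁻¹ • (Fᵀ * U) with hκ
  have hκM : ∀ m k, |κ m k| ≤ M := by
    intro m k
    have h1 := S.abs_transpose_mulVec_le (fun i => U i k) m
    rw [h.l2norm_column, mul_one] at h1
    rw [hκ, Matrix.smul_apply, smul_eq_mul, abs_mul, abs_of_pos (inv_pos.2 hN0),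
      inv_mul_le_iff₀ hN0]
    exact h1
  set H : Matrix (Fin K) (Fin K) ℝ := P * κ * diagonal (fun k => (lam k)⁻¹) with hH
  have hHlam : ∀ l k, lam k * H l k = (P * κ) l k := by
    intro l k
    rw [hH, mul_diagonal]
    have := hlam0 k
    field_simp
  have hPκ : ∀ l k, |(P * κ) l k| ≤ M ^ 3 := fun l k => by
    refine (abs_mul_apply_le hM.le S.P_le hκM l k).trans ?_
    calc (K : ℝ) * (M * M) ≤ M * (M * M) := by gcongr
      _ = _ := by ring
  have hHM : ∀ l k, |H l k| ≤ M ^ 12 := by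
    intro l k
    rw [hH, mul_diagonal, abs_mul]
    calc |(P * κ) l k| * |(lam k)⁻¹| ≤ M ^ 3 * M ^ 9 := by
          gcongr
          · exact hPκ l k
          · exact hinvlam k
      _ = _ := by ring
  set E : Matrix (Fin n) (Fin K) ℝ := N • U - F * H with hE
  set e₁ := M ^ 13 * e with he₁
  have he₁0 : 0 ≤ e₁ := by positivity
  have hEe : ∀ i k, |E i k| ≤ e₁ := by
    intro i k
    set t := (lam k)⁻¹ with ht
    set u : Fin n → ℝ := fun i => U i k with hu
    -- The eigenvector equation divided by the eigenvalue; the low rank part of `A` is absorbed into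
    -- column `k` of `H`.
    have h1 : u - t • W *ᵥ u = N⁻¹ • (F *ᵥ fun l => H l k) := by
      have e1 : W *ᵥ u = lam k • u - (n : ℝ)⁻¹ • (F *ᵥ P *ᵥ Fᵀ *ᵥ u) := by
        rw [← h.column_spec k, hA, add_mulVec, smul_mulVec, ← mulVec_mulVec, ← mulVec_mulVec]
        abel
      have e2 : (fun l => H l k) = (t * N⁻¹) • (P *ᵥ Fᵀ *ᵥ u) := by
        ext l
        have : (P * κ) l k = N⁻¹ * (P *ᵥ Fᵀ *ᵥ u) l := by
          rw [hκ, Matrix.mul_smul, Matrix.smul_apply, smul_eq_mul, mulVec_mulVec, ← Matrix.mul_assoc]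
          rfl
        rw [hH, mul_diagonal, this, _root_.Pi.smul_apply, smul_eq_mul]
        ring
      have e3 : t * lam k = 1 := inv_mul_cancel₀ (hlam0 k)
      have e4 : N⁻¹ * (t * N⁻¹) = t * (n : ℝ)⁻¹ := by rw [← hNN]; field_simp
      rw [e1, e2, mulVec_smul, smul_smul, smul_sub, smul_smul, smul_smul, e3, one_smul, e4]
      abel
    have hunit := isUnit_det_one_sub_smul (t := t) hW (by
      calc |t| * ω ≤ M ^ 9 * ω := by gcongr; exact hinvlam k
        _ ≤ 1 / 2 := hω)
    have h2 : N • u = resolventVec t W (F *ᵥ fun l => H l k) := by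
      have e1 : (1 - t • W) *ᵥ (N • u) = F *ᵥ fun l => H l k := by
        rw [mulVec_smul, sub_mulVec, one_mulVec, smul_mulVec, h1, smul_smul,
          mul_inv_cancel₀ hN0.ne', one_smul]
      rw [resolventVec, ← e1, mulVec_mulVec, nonsing_inv_mul _ hunit, one_mulVec]
    have h3 : E i k = ∑ l, (resolventVec t W (fun i => F i l) i - F i l) * H l k := by
      have := congrFun h2 i
      rw [resolventVec_mulVec] at this
      have e1 : E i k = (N • u) i - ∑ l, F i l * H l k := rfl
      rw [e1, this, ← Finset.sum_sub_distrib]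
      exact Finset.sum_congr rfl fun l _ => by ring
    rw [h3]
    refine (Finset.abs_sum_le_sum_abs _ _).trans ?_
    calc ∑ l, |(resolventVec t W (fun i => F i l) i - F i l) * H l k| ≤
          ∑ _l : Fin K, e * M ^ 12 := by
          refine Finset.sum_le_sum fun l _ => ?_
          rw [abs_mul]
          exact mul_le_mul (hR t (hinvlam k) l i) (hHM l k) (abs_nonneg _) he0
      _ = K * (e * M ^ 12) := by simp
      _ ≤ M * (e * M ^ 12) := by gcongr
      _ = _ := by rw [he₁]; ring
  have hNU : N • U = F * H + E := by rw [hE]; abel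
  set Δ : Matrix (Fin K) (Fin K) ℝ := -(N⁻¹ • (Eᵀ * U)) with hΔ
  have hΔe : ∀ k l, |Δ k l| ≤ e₁ := by
    intro k l
    have h1 := abs_dotProduct_le (fun i => E i k) fun i => U i l
    rw [h.l2norm_column, mul_one] at h1
    have h2 := l2norm_le_of_abs_le he₁0 fun i => hEe i k
    rw [Fintype.card_fin] at h2
    rw [hΔ, Matrix.neg_apply, Matrix.smul_apply, smul_eq_mul, abs_neg, abs_mul,
      abs_of_pos (inv_pos.2 hN0), inv_mul_le_iff₀ hN0]
    exact h1.trans h2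
  -- Orthonormality of `U` with `√n U = F H + E`. Since `Δ` is small, `1 + Δ` is diagonally
  -- dominant, which makes `H` invertible.
  have hHκ : Hᵀ * κ = 1 + Δ := by
    have e1 : Hᵀ * Fᵀ = N • Uᵀ - Eᵀ := by
      rw [← transpose_mul, ← transpose_smul, hNU, transpose_add, add_sub_cancel_right]
    rw [hκ, Matrix.mul_smul, ← Matrix.mul_assoc, e1, Matrix.sub_mul, Matrix.smul_mul, h.orthonormal,
      smul_sub, smul_smul, inv_mul_cancel₀ hN0.ne', one_smul, hΔ, sub_eq_add_neg]
  have hKe : (K : ℝ) * e₁ ≤ 1 / 4 := by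
    calc (K : ℝ) * e₁ ≤ M * e₁ := by gcongr
      _ = M ^ 14 * e := by rw [he₁]; ring
      _ ≤ M ^ 32 * e := by gcongr ?_ * e; exact hpow (by norm_num)
      _ ≤ _ := he
  have hdet1 : (1 + Δ).det ≠ 0 := by
    refine det_ne_zero_of_sum_row_lt_diag fun k => ?_
    have hK1 : (1 : ℝ) ≤ K := by
      have : 0 < K := k.pos
      exact_mod_cast this
    have h1 : ∑ l ∈ Finset.univ.erase k, ‖(1 + Δ) k l‖ ≤ ∑ l ∈ Finset.univ.erase k, e₁ := by
      refine Finset.sum_le_sum fun l hl => ?_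
      rw [Matrix.add_apply, one_apply_ne (Finset.ne_of_mem_erase hl).symm, zero_add,
        Real.norm_eq_abs]
      exact hΔe k l
    have h2 : ∑ l ∈ Finset.univ.erase k, e₁ ≤ K * e₁ := by
      rw [Finset.sum_const, nsmul_eq_mul]
      gcongr
      exact (Finset.card_le_univ _).trans (by simp)
    have h3 : 3 / 4 ≤ ‖(1 + Δ) k k‖ := by
      rw [Matrix.add_apply, one_apply_eq, Real.norm_eq_abs]
      have := (abs_le.1 (hΔe k k)).1
      refine le_trans ?_ (le_abs_self _)
      nlinarith
    linarith
  have hdetH : IsUnit (Hᵀ).det := by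
    rw [← hHκ, det_mul] at hdet1
    exact (left_ne_zero_of_mul hdet1).isUnit
  set J : Matrix (Fin K) (Fin K) ℝ := (Hᵀ)⁻¹ with hJ
  have hJH : J * Hᵀ = 1 := nonsing_inv_mul _ hdetH
  have hHJ : H * Jᵀ = 1 := by
    have := congrArg transpose hJH
    rwa [transpose_mul, transpose_transpose, transpose_one] at this
  have hκJ : κ = J + J * Δ := by
    have : J * (Hᵀ * κ) = κ := by rw [← Matrix.mul_assoc, hJH, Matrix.one_mul]
    rw [← this, hHκ, Matrix.mul_add, Matrix.mul_one]
  -- From `J = κ - J Δ` with bounded `κ`; the `J Δ` term is absorbed into the row sum of `|J|`.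
  have hJM : ∀ m k, |J m k| ≤ M ^ 3 := by
    intro m k
    set σ := ∑ b, |J m b| with hσ
    have hσ0 : 0 ≤ σ := Finset.sum_nonneg fun _ _ => abs_nonneg _
    have h1 : ∀ k, |J m k| ≤ M + σ * e₁ := by
      intro k
      have e1 : J m k = κ m k - ∑ b, J m b * Δ b k := by
        have := congrFun (congrFun hκJ m) k
        rw [Matrix.add_apply, mul_apply] at this
        linarith
      rw [e1]
      refine (abs_sub _ _).trans (add_le_add (hκM m k) ?_)
      refine (Finset.abs_sum_le_sum_abs _ _).trans ?_
      rw [hσ, Finset.sum_mul]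
      refine Finset.sum_le_sum fun b _ => ?_
      rw [abs_mul]
      gcongr
      exact hΔe b k
    have h2 : σ ≤ K * (M + σ * e₁) := by
      calc σ ≤ ∑ _b : Fin K, (M + σ * e₁) := Finset.sum_le_sum fun b _ => h1 b
        _ = _ := by rw [Finset.sum_const, Finset.card_univ, Fintype.card_fin, nsmul_eq_mul]
    have h3 : (K : ℝ) * M ≤ M * M := by gcongr
    have h4 : σ * (K * e₁) ≤ σ * (1 / 4) := by gcongr
    have h5 : σ ≤ 2 * M ^ 2 := by nlinarith
    calc |J m k| ≤ σ := Finset.single_le_sum (f := fun b => |J m b|) (fun b _ => abs_nonneg _)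
          (Finset.mem_univ k)
      _ ≤ 2 * M ^ 2 := h5
      _ ≤ M * M ^ 2 := by gcongr
      _ = _ := by ring
  set G : Matrix (Fin K) (Fin K) ℝ := (n : ℝ)⁻¹ • (Fᵀ * F) with hG
  have hG0 : ∀ k l, 0 ≤ G k l := by
    intro k l
    rw [hG, Matrix.smul_apply, smul_eq_mul, mul_apply]
    refine mul_nonneg (inv_nonneg.2 hn.le) (Finset.sum_nonneg fun i _ => ?_)
    exact mul_nonneg (S.loading_nonneg i k) (S.loading_nonneg i l)
  set E₂ : Matrix (Fin K) (Fin K) ℝ := (n : ℝ)⁻¹ • (Fᵀ * E) with hE₂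
  have hE₂e : ∀ k l, |E₂ k l| ≤ M * e₁ := by
    intro k l
    rw [hE₂, Matrix.smul_apply, smul_eq_mul, abs_mul, abs_of_pos (inv_pos.2 hn),
      inv_mul_le_iff₀ hn]
    exact abs_mul_apply_le hM.le (fun k i => S.abs_loading_le i k) hEe k l
  have hκG : κ = G * H + E₂ := by
    have e1 : κ = (n : ℝ)⁻¹ • (Fᵀ * (N • U)) := by
      rw [hκ, Matrix.mul_smul, smul_smul, ← hNN]
      congr 1
      field_simp
    rw [e1, hNU, Matrix.mul_add, smul_add, ← Matrix.mul_assoc, hG, hE₂, Matrix.smul_mul]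
  have hJΔ : ∀ m k, |(J * Δ) m k| ≤ M ^ 4 * e₁ := fun m k => by
    refine (abs_mul_apply_le (by positivity) hJM hΔe m k).trans ?_
    calc (K : ℝ) * (M ^ 3 * e₁) ≤ M * (M ^ 3 * e₁) := by gcongr
      _ = _ := by ring
  -- Computing `κ Jᵀ` both from `κ = G H + E₂` and from `κ = J + J Δ` shows that `J Jᵀ` is `G` up to
  -- small errors, and `G` has nonnegative entries.
  have hJJ : ∀ k l, -(M ^ 32 * e) ≤ (J * Jᵀ) k l := by
    intro k l
    have e1 : J * Jᵀ = G + E₂ * Jᵀ - J * Δ * Jᵀ := by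
      have e2 : κ * Jᵀ = G + E₂ * Jᵀ := by
        rw [hκG, Matrix.add_mul, Matrix.mul_assoc, hHJ, Matrix.mul_one]
      have e3 : κ * Jᵀ = J * Jᵀ + J * Δ * Jᵀ := by
        conv_lhs => rw [hκJ]
        rw [Matrix.add_mul]
      rw [← e2, e3, add_sub_cancel_right]
    have h1 := abs_mul_apply_le (Y := Jᵀ) (by positivity) hE₂e (fun k j => hJM j k) k l
    have h2 := abs_mul_apply_le (Y := Jᵀ) (by positivity) hJΔ (fun k j => hJM j k) k l
    have h3 : (K : ℝ) * (M * e₁ * M ^ 3) ≤ M ^ 8 * e₁ := by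
      calc (K : ℝ) * (M * e₁ * M ^ 3) ≤ M * (M * e₁ * M ^ 3) := by gcongr
        _ = M ^ 5 * e₁ := by ring
        _ ≤ _ := by gcongr ?_ * e₁; exact hpow (by norm_num)
    have h4 : (K : ℝ) * (M ^ 4 * e₁ * M ^ 3) ≤ M ^ 8 * e₁ := by
      calc (K : ℝ) * (M ^ 4 * e₁ * M ^ 3) ≤ M * (M ^ 4 * e₁ * M ^ 3) := by gcongr
        _ = _ := by ring
    have h5 : 2 * (M ^ 8 * e₁) ≤ M ^ 32 * e := by
      calc 2 * (M ^ 8 * e₁) ≤ M * (M ^ 8 * e₁) := by gcongr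
        _ = M ^ 22 * e := by rw [he₁]; ring
        _ ≤ _ := by gcongr ?_ * e; exact hpow (by norm_num)
    rw [e1, Matrix.sub_apply, Matrix.add_apply]
    have := hG0 k l
    have := (abs_le.1 h1).1
    have := (abs_le.1 h2).2
    linarith
  refine ⟨fun l => WithLp.toLp 2 (H l), fun l => WithLp.toLp 2 (J l), ?_, ?_, ?_, ?_⟩
  · refine ⟨?_, ?_, fun k l => ?_, fun l => ?_, fun l => ?_, fun k l _ => ?_⟩
    · calc (2 : ℝ) ≤ M ^ 1 := by linarith
        _ ≤ _ := hpow (by norm_num)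
    · calc (K : ℝ) ≤ M ^ 1 := by linarith
        _ ≤ _ := hpow (by norm_num)
    · have := congrFun (congrFun hJH k) l
      rw [one_apply] at this
      rw [← this, EuclideanSpace.inner_toLp_toLp, star_trivial, dotProduct_comm]
      rfl
    · refine (norm_toLp_le_of_abs_le hM1 hKM (by positivity) (hHM l)).trans (le_of_eq ?_)
      ring
    · refine (norm_toLp_le_of_abs_le hM1 hKM (by positivity) (hJM l)).trans ?_
      calc M * M ^ 3 = M ^ 4 := by ring
        _ ≤ _ := hpow (by norm_num)
    · have : (inner ℝ (WithLp.toLp 2 (J k)) (WithLp.toLp 2 (J l)) : ℝ) = (J * Jᵀ) k l := by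
        rw [EuclideanSpace.inner_toLp_toLp, star_trivial, dotProduct_comm]
        rfl
      rw [this]
      exact hJJ k l
  · refine ⟨hN0, S.nonneg, S.sum_one, S.pure_node, fun i => ?_, fun i => ?_, fun i => ?_⟩
    · refine le_trans (inv_anti₀ hM ?_) (S.le_weight i)
      calc M = M ^ 1 := (pow_one M).symm
        _ ≤ _ := hpow (by norm_num)
    · refine (S.weight_le i).trans ?_
      calc M = M ^ 1 := (pow_one M).symm
        _ ≤ _ := hpow (by norm_num)
    · have e1 : N • rowVec U i - a i • ∑ l, Pi i l • (WithLp.toLp 2 (H l) :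
          EuclideanSpace ℝ (Fin K)) = WithLp.toLp 2 (E i) := by
        ext k
        have e2 : E i k = N * U i k - ∑ l, F i l * H l k := rfl
        simp only [PiLp.sub_apply, PiLp.smul_apply, smul_eq_mul, WithLp.ofLp_sum, Finset.sum_apply,
          rowVec, e2, WithLp.ofLp_smul, _root_.Pi.smul_apply, Finset.mul_sum]
        congr 1
        refine Finset.sum_congr rfl fun l _ => ?_
        rw [hF, diagonal_mul]; ring
      rw [e1]
      refine (norm_toLp_le_of_abs_le hM1 hKM he₁0 (hEe i)).trans ?_
      calc M * e₁ = M ^ 14 * e := by rw [he₁]; ring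
        _ ≤ _ := by gcongr ?_ * e; exact hpow (by norm_num)
  · exact fun k => (hup k).trans (hpow (by norm_num))
  · intro m
    -- The matrix `H Λ Hᵀ = P κ Hᵀ` is a perturbation of `P`, whose diagonal is one.
    have e1 : ∑ k, lam k * H m k ^ 2 = (P * κ * Hᵀ) m m := by
      rw [mul_apply]
      refine Finset.sum_congr rfl fun k _ => ?_
      rw [← hHlam, transpose_apply]; ring
    have e2 : P * κ * Hᵀ = P + P * (J * Δ * Hᵀ) := by
      have : κ * Hᵀ = 1 + J * Δ * Hᵀ := by
        conv_lhs => rw [hκJ]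
        rw [Matrix.add_mul, hJH]
      rw [Matrix.mul_assoc, this, Matrix.mul_add, Matrix.mul_one]
    change |∑ k, lam k * H m k ^ 2 - 1| ≤ _
    rw [e1, e2, Matrix.add_apply, S.P_diag, add_sub_cancel_left]
    have h1 := fun i j => abs_mul_apply_le (Y := Hᵀ) (by positivity) hJΔ (fun k j => hHM j k) i j
    refine (abs_mul_apply_le hM.le S.P_le h1 m m).trans ?_
    calc (K : ℝ) * (M * (K * (M ^ 4 * e₁ * M ^ 12))) ≤ M * (M * (M * (M ^ 4 * e₁ * M ^ 12))) := by
          gcongr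
      _ = _ := by rw [he₁]; ring

end EigenvectorStructure

/-! ### Conditioning of the model -/

section Conditioning

open Matrix

open scoped RealInnerProductSpace

variable {n K : ℕ}

theorem mul_l2norm_sq_le_of_eigenvalues {B : Matrix (Fin K) (Fin K) ℝ} (hB : Bᵀ = B) {c : ℝ}
    (hc : ∀ ν, Module.End.HasEigenvalue (toLin' B) ν → c ≤ ν) (x : Fin K → ℝ) :
    c * l2norm x ^ 2 ≤ x ⬝ᵥ B *ᵥ x := by
  obtain ⟨V, d, hV1, hV2, hBV⟩ := (IsHermitian.ext fun i j => by
    rw [star_trivial]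
    exact congrFun (congrFun hB i) j : B.IsHermitian).exists_orthogonal_diagonal
  have hd : ∀ a, c ≤ d a := by
    intro a
    refine hc _ (Module.End.hasEigenvalue_of_hasEigenvector (x := fun i => V i a)
      ⟨Module.End.mem_eigenspace_iff.2 ?_, fun h0 => ?_⟩)
    · have h1 : B * V = V * diagonal d := by
        rw [hBV, Matrix.mul_assoc, hV1, Matrix.mul_one]
      ext i
      have := congrFun (congrFun h1 i) a
      rw [mul_diagonal] at this
      rw [toLin'_apply, Pi.smul_apply, smul_eq_mul, mul_comm, ← this]
      rfl
    · have h2 := congrFun (congrFun hV1 a) a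
      rw [one_apply_eq, mul_apply] at h2
      have h3 : ∀ i, V i a = 0 := fun i => congrFun h0 i
      simp [h3] at h2
  set y := Vᵀ *ᵥ x with hy
  have hVt : l2norm y = l2norm x :=
    l2norm_mulVec_of_orthogonal (by rw [transpose_transpose, hV2]) x
  have h1 : x ⬝ᵥ B *ᵥ x = ∑ a, d a * y a ^ 2 := by
    rw [hBV, ← mulVec_mulVec, ← mulVec_mulVec, dotProduct_mulVec, ← mulVec_transpose, dotProduct]
    refine Finset.sum_congr rfl fun a _ => ?_
    rw [← hy, mulVec_diagonal]; ring
  rw [h1, ← hVt, l2norm_sq, Finset.mul_sum]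
  exact Finset.sum_le_sum fun a _ => mul_le_mul_of_nonneg_right (hd a) (sq_nonneg _)

/-- The `y i` are the coordinates of `x` in an orthonormal eigenbasis of the adjoint of `T` composed
with `T`. -/
theorem exists_sq_norm_eq_sum_singularValues {E : Type*} [NormedAddCommGroup E]
    [InnerProductSpace ℝ E] [FiniteDimensional ℝ E] (T : E →ₗ[ℝ] E) (x : E) :
    ∃ y : Fin (Module.finrank ℝ E) → ℝ, ‖x‖ ^ 2 = ∑ i, y i ^ 2 ∧
      ‖T x‖ ^ 2 = ∑ i : Fin (Module.finrank ℝ E), T.singularValues i ^ 2 * y i ^ 2 := by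
  have hS := T.isSymmetric_adjoint_comp_self
  set b := hS.eigenvectorBasis rfl with hb
  refine ⟨fun i => ⟪x, b i⟫, ?_, ?_⟩
  · rw [← real_inner_self_eq_norm_sq, ← b.sum_inner_mul_inner x x]
    refine Finset.sum_congr rfl fun i _ => ?_
    rw [real_inner_comm x (b i), sq]
  · have h1 : ‖T x‖ ^ 2 = ⟪(LinearMap.adjoint T ∘ₗ T) x, x⟫ := by
      rw [LinearMap.comp_apply, LinearMap.adjoint_inner_left, real_inner_self_eq_norm_sq]
    rw [h1, ← b.sum_inner_mul_inner]
    refine Finset.sum_congr rfl fun i _ => ?_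
    rw [hS x (b i), hb, hS.apply_eigenvectorBasis, ← hb, real_inner_comm x (b i),
      T.sq_singularValues_fin rfl]
    simp only [RCLike.ofReal_real_eq_id, id_eq, real_inner_smul_right]
    ring

theorem sval_mul_l2norm_le (P : Matrix (Fin K) (Fin K) ℝ) (x : Fin K → ℝ) :
    sval P K * l2norm x ≤ l2norm (P *ᵥ x) := by
  set T := toEuclideanLin P with hT
  obtain ⟨y, hy1, hy2⟩ := exists_sq_norm_eq_sum_singularValues T (WithLp.toLp 2 x)
  have h0 : 0 ≤ sval P K := T.singularValues_nonneg _
  have hsq : (sval P K * l2norm x) ^ 2 ≤ l2norm (P *ᵥ x) ^ 2 := by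
    have e1 : l2norm (P *ᵥ x) ^ 2 = ‖T (WithLp.toLp 2 x)‖ ^ 2 := by
      rw [hT, toLpLin_toLp]; rfl
    have e2 : l2norm x ^ 2 = ∑ i, y i ^ 2 := hy1
    rw [e1, hy2, mul_pow, e2, Finset.mul_sum]
    refine Finset.sum_le_sum fun i _ => ?_
    gcongr
    refine T.singularValues_antitone ?_
    have := i.2.trans_eq finrank_euclideanSpace_fin
    omega
  exact (abs_le_of_sq_le_sq' hsq (l2norm_nonneg _)).2

theorem l2norm_mulVec_le_sval (P : Matrix (Fin K) (Fin K) ℝ) (x : Fin K → ℝ) :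
    l2norm (P *ᵥ x) ≤ sval P 1 * l2norm x := by
  set T := toEuclideanLin P with hT
  obtain ⟨y, hy1, hy2⟩ := exists_sq_norm_eq_sum_singularValues T (WithLp.toLp 2 x)
  have h0 : 0 ≤ sval P 1 := T.singularValues_nonneg _
  have hsq : l2norm (P *ᵥ x) ^ 2 ≤ (sval P 1 * l2norm x) ^ 2 := by
    have e1 : l2norm (P *ᵥ x) ^ 2 = ‖T (WithLp.toLp 2 x)‖ ^ 2 := by
      rw [hT, toLpLin_toLp]; rfl
    have e2 : l2norm x ^ 2 = ∑ i, y i ^ 2 := hy1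
    rw [e1, hy2, mul_pow, e2, Finset.mul_sum]
    refine Finset.sum_le_sum fun i _ => ?_
    have := T.singularValues_nonneg i
    gcongr
    exact T.singularValues_antitone (by simp)
  exact (abs_le_of_sq_le_sq' hsq (mul_nonneg h0 (l2norm_nonneg _))).2

theorem sval_pos_of_rank_eq (hK : 0 < K) {P : Matrix (Fin K) (Fin K) ℝ} (hP : P.rank = K) :
    0 < sval P K := by
  have h : Module.finrank ℝ (LinearMap.range (toEuclideanLin P)) = K := by
    rw [toEuclideanLin_eq_toLin_orthonormal, ← rank_eq_finrank_range_toLin P (EuclideanSpace.basisFun _ ℝ).toBasis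
      (EuclideanSpace.basisFun _ ℝ).toBasis, hP]
  refine (LinearMap.singularValues_pos_iff_lt_finrank_range _).2 ?_
  rw [h]
  omega

/-- A unit diagonal entry forces `sval P 1 ≥ 1`, so a bounded condition number keeps the smallest
singular value away from zero. -/
theorem one_le_mul_sval {P : Matrix (Fin K) (Fin K) ℝ} (hK : 0 < K) (hP : P.rank = K)
    (hdiag : ∀ k, P k k = 1) {κ₀ : ℝ} (hκ : condNumber P ≤ κ₀) : 1 ≤ κ₀ * sval P K := by
  have h0 := sval_pos_of_rank_eq hK hP
  have h1 : 1 ≤ sval P 1 := by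
    have h2 := l2norm_mulVec_le_sval P (Pi.single ⟨0, hK⟩ 1)
    rw [l2norm_single, mul_one, mulVec_single_one] at h2
    have h3 := abs_le_l2norm (P *ᵥ Pi.single ⟨0, hK⟩ 1) ⟨0, hK⟩
    rw [mulVec_single_one, col_apply, hdiag, abs_one] at h3
    exact h3.trans h2
  rw [condNumber, div_le_iff₀ h0] at hκ
  linarith

theorem sval_le {P : Matrix (Fin K) (Fin K) ℝ} (hK : 0 < K) {B : ℝ} (hB : ∀ k l, |P k l| ≤ B) :
    sval P K ≤ Real.sqrt K * B := by
  have h1 := sval_mul_l2norm_le P (Pi.single ⟨0, hK⟩ 1)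
  rw [l2norm_single, mul_one, mulVec_single_one] at h1
  refine h1.trans ?_
  have := l2norm_le_of_abs_le ((abs_nonneg _).trans (hB ⟨0, hK⟩ ⟨0, hK⟩)) fun k =>
    (hB k ⟨0, hK⟩)
  rw [Fintype.card_fin] at this
  exact this

theorem meanMatrix_eq_smul (Pi : Matrix (Fin n) (Fin K) ℝ) (P : Matrix (Fin K) (Fin K) ℝ)
    (θ : Fin n → ℝ) {ρ : ℝ} (hρ : 0 < ρ) :
    meanMatrix Pi P θ = ρ • (diagonal (fun i => θ i / Real.sqrt ρ) * Pi * P *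
      (diagonal (fun i => θ i / Real.sqrt ρ) * Pi)ᵀ) := by
  have h1 : diagonal θ = Real.sqrt ρ • diagonal (fun i => θ i / Real.sqrt ρ) := by
    rw [← diagonal_smul]
    congr 1
    ext i
    have : Real.sqrt ρ ≠ 0 := (Real.sqrt_pos.2 hρ).ne'
    simp only [_root_.Pi.smul_apply, smul_eq_mul]
    field_simp
  rw [meanMatrix, h1, transpose_mul, diagonal_transpose]
  simp only [Matrix.smul_mul, Matrix.mul_smul, smul_smul, Real.mul_self_sqrt hρ.le,
    Matrix.mul_assoc]

/-- The model conditions with constants collected into a single bound. -/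
theorem isFactorModel_of_isDCMMDF {S : Type*} [MeasurableSpace S] {μ : Measure S}
    {Pi : Matrix (Fin n) (Fin K) ℝ} {P : Matrix (Fin K) (Fin K) ℝ} {θ : Fin n → ℝ}
    {A : S → Matrix (Fin n) (Fin n) ℝ} (h : IsDCMMDF μ Pi P θ A) {κ₀ B c₀ c₁ C₁ ρ M : ℝ}
    (hn : 0 < n) (hK : 0 < K) (hκ : condNumber P ≤ κ₀) (hB : ∀ k l, |P k l| ≤ B) (hc₀ : 0 < c₀)
    (hc₁ : 0 < c₁)
    (hev : ∀ ν, Module.End.HasEigenvalue (toLin' (Pi.transpose * Pi)) ν → c₀ * (n / K) ≤ ν)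
    (hρ : 0 < ρ) (hθ : ∀ i, c₁ * Real.sqrt ρ ≤ θ i ∧ θ i ≤ C₁ * Real.sqrt ρ)
    (hM2 : 2 ≤ M) (hMK : (K : ℝ) ≤ M) (hMκ : κ₀ ≤ M) (hMB : B ≤ M) (hMc₀ : K / c₀ ≤ M)
    (hMc₁ : c₁⁻¹ ≤ M) (hMC₁ : C₁ ≤ M) :
    IsFactorModel Pi P (fun i => θ i / Real.sqrt ρ) M where
  two_le := hM2
  n_pos := hn
  card_le := hMK
  nonneg := h.Pi_nonneg
  sum_one := h.Pi_sum
  pure_node := h.pure_node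
  P_symm := h.P_symm
  P_diag := h.P_diag
  P_le := fun k l => (hB k l).trans hMB
  le_mulVec := fun x => by
    have h1 := one_le_mul_sval hK h.rank_P h.P_diag hκ
    have h2 := sval_mul_l2norm_le P x
    have h3 := (sval_pos_of_rank_eq hK h.rank_P).le
    have h4 := l2norm_nonneg x
    calc l2norm x = 1 * l2norm x := (one_mul _).symm
      _ ≤ M * sval P K * l2norm x := by
          gcongr
          exact h1.trans (by gcongr)
      _ = M * (sval P K * l2norm x) := by ring
      _ ≤ _ := by gcongr
  le_weight := fun i => by
    have hs := Real.sqrt_pos.2 hρ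
    rw [le_div_iff₀ hs]
    refine le_trans ?_ (hθ i).1
    gcongr
    exact inv_le_of_inv_le₀ hc₁ hMc₁
  weight_le := fun i => by
    have hs := Real.sqrt_pos.2 hρ
    rw [div_le_iff₀ hs]
    exact (hθ i).2.trans (by gcongr)
  le_Pi_mulVec := fun x => by
    have h1 := mul_l2norm_sq_le_of_eigenvalues (B := Piᵀ * Pi)
      (by rw [transpose_mul, transpose_transpose]) hev x
    have e : x ⬝ᵥ (Piᵀ * Pi) *ᵥ x = l2norm (Pi *ᵥ x) ^ 2 := by
      rw [← dotProduct_self_eq_l2norm_sq, ← mulVec_mulVec, dotProduct_mulVec, vecMul_transpose]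
    rw [e] at h1
    have hK' : (0 : ℝ) < K := Nat.cast_pos.2 hK
    calc (n : ℝ) * l2norm x ^ 2 = K / c₀ * (c₀ * (n / K) * l2norm x ^ 2) := by field_simp
      _ ≤ K / c₀ * l2norm (Pi *ᵥ x) ^ 2 := by gcongr
      _ ≤ _ := by gcongr

end Conditioning

/-! ### The noise on a good event -/

section GoodEvent

open Matrix

variable {n K : ℕ} {S : Type*} [MeasurableSpace S] {μ : Measure S} [IsProbabilityMeasure μ]

/-- The noise matrix has small norm, and its rows are almost orthogonal to the leave-one-out
resolvents. -/
structure IsTame (x : Edge n → ℝ) (b t₀ V τ ℓ : ℝ) (f : Fin K → Fin n → ℝ) : Prop where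
  norm_le : ∀ v, l2norm (symMat x *ᵥ v) ≤ b * l2norm v
  row_le : ∀ l i k,
    |∑ j, resolventVec (gridPoint t₀ n k) (symMat (dropVertex i x)) (f l) j * symMat x i j| ≤
      13 * bernsteinScale V τ ℓ (resolventVec (gridPoint t₀ n k) (symMat (dropVertex i x)) (f l))

theorem measure_not_l2norm_mulVec_le (hn : 3 ≤ n) {X : Edge n → S → ℝ}
    (hX : ∀ e, Measurable (X e)) (hind : iIndepFun X μ) {τ V : ℝ} (hτ : 0 ≤ τ) (hV0 : 0 ≤ V)
    (hb : ∀ e ω, |X e ω| ≤ τ) (h0 : ∀ e, ∫ ω, X e ω ∂μ = 0)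
    (hV : ∀ e, ∫ ω, X e ω ^ 2 ∂μ ≤ V) (hτV : τ ^ 2 * Real.log n ≤ V * n) :
    μ {s | ¬ ∀ v, l2norm (symMat (fun e => X e s) *ᵥ v) ≤
      Real.sqrt (64 * Real.exp 9 * (V * n * Real.log n)) * l2norm v} ≤
      ENNReal.ofReal ((n : ℝ) ^ 6)⁻¹ := by
  -- For `V = 0` the sparsity condition forces `τ = 0`, so the noise vanishes.
  rcases hV0.eq_or_lt with hV0 | hV0
  · have hlog : 0 < Real.log n := Real.log_pos (by exact_mod_cast (by omega : 1 < n))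
    have hτ0 : τ = 0 := by
      rw [← hV0, zero_mul] at hτV
      by_contra hne
      have : 0 < τ ^ 2 := by positivity
      nlinarith
    have hX0 : ∀ s, symMat (fun e => X e s) = 0 := by
      intro s
      ext i j
      have := hb (mkEdge i j) s
      rw [hτ0, abs_nonpos_iff] at this
      exact this
    have : {s | ¬ ∀ v, l2norm (symMat (fun e => X e s) *ᵥ v) ≤
        Real.sqrt (64 * Real.exp 9 * (V * n * Real.log n)) * l2norm v} = ∅ := by
      refine Set.eq_empty_iff_forall_notMem.2 fun s hs => hs fun v => ?_
      rw [hX0, zero_mulVec, l2norm_eq_zero.2 rfl]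
      exact mul_nonneg (Real.sqrt_nonneg _) (l2norm_nonneg v)
    rw [this, measure_empty]
    exact zero_le
  · refine le_trans (measure_mono fun s hs => ?_)
      (measure_spectral_norm_gt_le hn hX hind hτ hV0 hb h0 hV hτV)
    exact fun h => hs (l2norm_mulVec_le_of_forall (Real.sqrt_nonneg _) h)

theorem measure_not_isTame_le (hn : 3 ≤ n) {X : Edge n → S → ℝ}
    (hX : ∀ e, Measurable (X e)) (hind : iIndepFun X μ) {τ V : ℝ} (hτ : 0 ≤ τ) (hV0 : 0 ≤ V)
    (hb : ∀ e ω, |X e ω| ≤ τ) (h0 : ∀ e, ∫ ω, X e ω ∂μ = 0)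
    (hV : ∀ e, ∫ ω, X e ω ^ 2 ∂μ ≤ V) (hτV : τ ^ 2 * Real.log n ≤ V * n) (t₀ : ℝ)
    (f : Fin K → Fin n → ℝ) :
    μ {s | ¬ IsTame (fun e => X e s) (Real.sqrt (64 * Real.exp 9 * (V * n * Real.log n))) t₀ V τ
      (Real.log n) f} ≤ ENNReal.ofReal ((1 + 6 * K) / (n : ℝ) ^ 6) := by
  have hn0 : (0 : ℝ) < n := by exact_mod_cast (by omega : 0 < n)
  have hn1 : (1 : ℝ) ≤ n := by exact_mod_cast (by omega : 1 ≤ n)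
  have hlog : 0 < Real.log n := Real.log_pos (by exact_mod_cast (by omega : 1 < n))
  set N := {s | ¬ ∀ v, l2norm (symMat (fun e => X e s) *ᵥ v) ≤
      Real.sqrt (64 * Real.exp 9 * (V * n * Real.log n)) * l2norm v} with hN
  set R : Fin K × Fin n × Fin (2 * n + 1) → Set S := fun p =>
    {s | 13 * bernsteinScale V τ (Real.log n) (resolventVec (gridPoint t₀ n p.2.2)
        (symMat (dropVertex p.2.1 fun e => X e s)) (f p.1)) <
      |∑ j, resolventVec (gridPoint t₀ n p.2.2)
        (symMat (dropVertex p.2.1 fun e => X e s)) (f p.1) j * symMat (fun e => X e s) p.2.1 j|}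
    with hR
  have hsub : {s | ¬ IsTame (fun e => X e s)
      (Real.sqrt (64 * Real.exp 9 * (V * n * Real.log n))) t₀ V τ (Real.log n) f} ⊆
      N ∪ ⋃ p, R p := by
    intro s hs
    by_contra hs'
    rw [Set.mem_union, not_or] at hs'
    refine hs ⟨?_, fun l i k => ?_⟩
    · by_contra h
      exact hs'.1 h
    · by_contra h
      exact hs'.2 (Set.mem_iUnion.2 ⟨(l, i, k), not_le.1 h⟩)
  have hRp : ∀ p, μ (R p) ≤ ENNReal.ofReal (2 * Real.exp (-(12 * Real.log n))) := fun p =>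
    measure_abs_row_dropVertex_gt_le hX hind hτ hV0 hlog hb h0 hV p.2.1
      (g := fun x => resolventVec (gridPoint t₀ n p.2.2) (symMat x) (f p.1))
      (measurable_resolventVec _ _)
  have hexp : Real.exp (-(12 * Real.log n)) = ((n : ℝ) ^ 12)⁻¹ := by
    rw [Real.exp_neg, show (12 : ℝ) * Real.log n = ((12 : ℕ) : ℝ) * Real.log n by norm_num,
      ← Real.log_pow, Real.exp_log (by positivity)]
  -- There are `K n (2n + 1) ≤ 3K n²` events, each of probability at most `2 n⁻¹²`.
  have hU : μ (⋃ p, R p) ≤ ENNReal.ofReal (6 * K / (n : ℝ) ^ 6) := by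
    refine (measure_iUnion_fintype_le μ R).trans ((Finset.sum_le_sum fun p _ => hRp p).trans ?_)
    rw [Finset.sum_const, Finset.card_univ, nsmul_eq_mul, ← ENNReal.ofReal_natCast,
      ← ENNReal.ofReal_mul (by positivity)]
    refine ENNReal.ofReal_le_ofReal ?_
    rw [Fintype.card_prod, Fintype.card_prod, Fintype.card_fin, Fintype.card_fin, Fintype.card_fin,
      hexp]
    push_cast
    have h1 : (2 * n + 1 : ℝ) ≤ 3 * n := by linarith
    have h2 : ((n : ℝ) ^ 10)⁻¹ ≤ ((n : ℝ) ^ 6)⁻¹ :=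
      inv_anti₀ (by positivity) (pow_le_pow_right₀ hn1 (by norm_num))
    calc (K : ℝ) * (n * (2 * n + 1)) * (2 * ((n : ℝ) ^ 12)⁻¹)
        ≤ K * (n * (3 * n)) * (2 * ((n : ℝ) ^ 12)⁻¹) := by gcongr
      _ = 6 * K * ((n : ℝ) ^ 10)⁻¹ := by field_simp; ring
      _ ≤ 6 * K * ((n : ℝ) ^ 6)⁻¹ := by gcongr
      _ = _ := by rw [div_eq_mul_inv]
  refine (measure_mono hsub).trans ((measure_union_le _ _).trans ?_)
  refine (add_le_add (measure_not_l2norm_mulVec_le hn hX hind hτ hV0 hb h0 hV hτV) hU).trans ?_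
  rw [← ENNReal.ofReal_add (by positivity) (by positivity)]
  refine ENNReal.ofReal_le_ofReal (le_of_eq ?_)
  field_simp

theorem resolventVec_smul (t c : ℝ) (W : Matrix (Fin n) (Fin n) ℝ) (f : Fin n → ℝ) :
    resolventVec t (c • W) f = resolventVec (t * c) W f := by
  rw [resolventVec, resolventVec, smul_smul]

end GoodEvent

/-! ### Reduction to noise that is bounded everywhere. -/

section Truncation

variable {n K : ℕ} {S : Type*} [MeasurableSpace S] {μ : Measure S} [IsProbabilityMeasure μ]
  {Pi : Matrix (Fin n) (Fin K) ℝ} {P : Matrix (Fin K) (Fin K) ℝ} {θ : Fin n → ℝ}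
  {A : S → Matrix (Fin n) (Fin n) ℝ} {τ : ℝ}

theorem meanMatrix_transpose (hP : P.transpose = P) :
    (meanMatrix Pi P θ).transpose = meanMatrix Pi P θ := by
  simp only [meanMatrix, Matrix.transpose_mul, Matrix.diagonal_transpose,
    Matrix.transpose_transpose, hP, Matrix.mul_assoc]

/-- The noise can be replaced by bounded independent centered variables. -/
theorem IsDCMMDF.exists_truncation (h : IsDCMMDF μ Pi P θ A)
    (hτ : ∀ i j, ∀ᵐ s ∂μ, |A s i j - meanMatrix Pi P θ i j| ≤ τ) (hτ0 : 0 ≤ τ) :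
    ∃ X : Edge n → S → ℝ, (∀ e, Measurable (X e)) ∧ iIndepFun X μ ∧ (∀ e s, |X e s| ≤ τ) ∧
      (∀ e, ∫ s, X e s ∂μ = 0) ∧
      (∀ e, ∫ s, X e s ^ 2 ∂μ = variance (fun s => A s e.1.1 e.1.2) μ) ∧
      ∀ᵐ s ∂μ, A s = meanMatrix Pi P θ + symMat fun e => X e s := by
  set Ω := meanMatrix Pi P θ with hΩ
  -- Clipping the centered entries to `[-τ, τ]` changes them on a null set only, and acts entrywise,
  -- so independence survives.
  set φ : Edge n → ℝ → ℝ := fun e t => max (-τ) (min τ (t - Ω e.1.1 e.1.2)) with hφ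
  have hφm : ∀ e, Measurable (φ e) := fun e => by
    have : Continuous (φ e) := by
      simp only [hφ]
      fun_prop
    exact this.measurable
  have hae : ∀ e : Edge n, (fun s => φ e (A s e.1.1 e.1.2)) =ᵐ[μ]
      fun s => A s e.1.1 e.1.2 - Ω e.1.1 e.1.2 := by
    intro e
    filter_upwards [hτ e.1.1 e.1.2] with s hs
    rw [abs_le] at hs
    simp only [hφ]
    rw [min_eq_right hs.2, max_eq_right hs.1]
  refine ⟨fun e s => φ e (A s e.1.1 e.1.2), fun e => (hφm e).comp (h.measurable _ _),
    h.indep.comp φ hφm, fun e s => ?_, fun e => ?_, fun e => ?_, ?_⟩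
  · rw [abs_le]
    exact ⟨le_max_left _ _, max_le (by linarith) (min_le_left _ _)⟩
  · rw [integral_congr_ae (hae e), integral_sub (h.integrable _ _) (integrable_const _), h.mean]
    simp [hΩ]
  · rw [variance_eq_integral (h.measurable _ _).aemeasurable, h.mean]
    refine integral_congr_ae ?_
    filter_upwards [hae e] with s hs
    rw [hs]
  · filter_upwards [ae_all_iff.2 hae] with s hs
    ext i j
    have h1 := hs (mkEdge i j)
    rw [Matrix.add_apply, symMat_apply, h1]
    have hAs := congrFun (congrFun (h.A_symm s) i) j
    have hΩs := congrFun (congrFun (meanMatrix_transpose (Pi := Pi) (θ := θ) h.P_symm) i) j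
    rw [Matrix.transpose_apply] at hAs hΩs
    rw [← hΩ] at hΩs
    rcases le_total i j with hij | hij
    · simp [mkEdge, hij]
    · simp [mkEdge, hij, hAs, hΩs]

end Truncation

/-! ### The deterministic error bound. -/

section ErrorBound

open Matrix

variable {n K : ℕ}

theorem mul_permMatrix_inv_apply (Pi : Matrix (Fin n) (Fin K) ℝ) (π : Equiv.Perm (Fin K))
    (i : Fin n) (k : Fin K) : (Pi * (π⁻¹).permMatrix ℝ) i k = Pi i (π k) := by
  rw [Equiv.Perm.permMatrix, PEquiv.mul_toMatrix_toPEquiv]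
  rfl

/-- The deterministic part of the error analysis. -/
theorem scd_error_le_of_isTame {Pi : Matrix (Fin n) (Fin K) ℝ} {P : Matrix (Fin K) (Fin K) ℝ}
    {θ : Fin n → ℝ} {ρ M : ℝ} (hρ : 0 < ρ)
    (F : IsFactorModel Pi P (fun i => θ i / Real.sqrt ρ) M) {x : Edge n → ℝ} {b V τ ℓ ζ : ℝ}
    (hb0 : 0 ≤ b) (hV : 0 ≤ V) (hτ : 0 ≤ τ) (hℓ : 0 ≤ ℓ)
    (hx : IsTame x b (M ^ 9 / (ρ * n)) V τ ℓ
      fun l i => (diagonal (fun i => θ i / Real.sqrt ρ) * Pi) i l)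
    (hb : b ≤ ρ * n * ζ) (hVζ : Real.sqrt (V * ℓ * n) ≤ ρ * n * ζ) (hτζ : τ * ℓ ≤ ρ * n * ζ)
    (hζ0 : 0 ≤ ζ) (hζ : 304000 * M ^ 705 * ζ ≤ 1) {A : Matrix (Fin n) (Fin n) ℝ}
    (hA : A = meanMatrix Pi P θ + symMat x) {δ : ℝ} (hδ0 : 0 ≤ δ) (hδ : δ ≤ M * ζ)
    {Pihat : Matrix (Fin n) (Fin K) ℝ} (h : IsScD A δ Pihat) :
    ∃ σ : Equiv.Perm (Fin K), ∀ i,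
      ∑ k, |(Pihat - Pi * σ.permMatrix ℝ) i k| ≤ 194256 * M ^ 536 * ζ := by
  obtain ⟨U, lam, I, hU, hI, hPihat⟩ := h
  have hM := F.pos
  have hM2 := F.two_le
  have hM1 : 1 ≤ M := by linarith
  have hn : (0 : ℝ) < n := Nat.cast_pos.2 F.n_pos
  have hρn : 0 < ρ * n := by positivity
  have hpow : ∀ p : ℕ, p ≤ 705 → 304000 * (M ^ p * ζ) ≤ 1 := fun p hp => by
    refine le_trans ?_ hζ
    rw [mul_assoc]
    gcongr
  set a : Fin n → ℝ := fun i => θ i / Real.sqrt ρ with ha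
  have hAs : Aᵀ = A := by
    have h1 : (symMat x)ᵀ = symMat x := by
      have := symMat_isHermitian x
      rwa [IsHermitian, conjTranspose_eq_transpose_of_trivial] at this
    rw [hA, transpose_add, meanMatrix_transpose F.P_symm, h1]
  set c := (ρ * n)⁻¹ with hc
  have hc0 : 0 < c := inv_pos.2 hρn
  have hcA : c • A = (n : ℝ)⁻¹ • (diagonal a * Pi * P * (diagonal a * Pi)ᵀ) + c • symMat x := by
    rw [hA, smul_add, meanMatrix_eq_smul Pi P θ hρ, smul_smul]
    congr 2
    rw [hc]
    field_simp
  have hcAs : (c • A)ᵀ = c • A := by rw [transpose_smul, hAs]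
  have hcU := hU.smul (c := c) hc0.ne'
  have hW : ∀ v, l2norm ((c • symMat x) *ᵥ v) ≤ ζ * l2norm v := by
    intro v
    rw [smul_mulVec, l2norm_smul, abs_of_pos hc0]
    have := l2norm_nonneg v
    calc c * l2norm (symMat x *ᵥ v) ≤ c * (b * l2norm v) := by gcongr; exact hx.norm_le v
      _ ≤ c * (ρ * n * ζ * l2norm v) := by gcongr
      _ = ζ * l2norm v := by rw [hc]; field_simp
  have ht₀ : ∀ y, y ≤ ρ * n * ζ → M ^ 9 / (ρ * n) * y ≤ M ^ 9 * ζ := by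
    intro y hy
    calc M ^ 9 / (ρ * n) * y ≤ M ^ 9 / (ρ * n) * (ρ * n * ζ) := by gcongr
      _ = _ := by field_simp
  have h9 := hpow 9 (by norm_num)
  have hR : ∀ t, |t| ≤ M ^ 9 → ∀ l i, |resolventVec t (c • symMat x)
      (fun i => (diagonal a * Pi) i l) i - (diagonal a * Pi) i l| ≤ 76 * (M ^ 9 * ζ * M) := by
    intro t ht l i
    rw [resolventVec_smul]
    refine resolvent_entrywise_of_grid F.n_pos hb0 hM.le hV hτ hℓ (t₀ := M ^ 9 / (ρ * n))
      (by positivity) hx.norm_le (ht₀ _ hb) (ht₀ _ hVζ) (ht₀ _ hτζ) (by linarith)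
      (fun i => F.abs_loading_le i l) (hx.row_le l) ?_ i
    rw [abs_mul, abs_of_pos hc0, hc, div_eq_mul_inv]
    gcongr
  have h42 := hpow 42 (by norm_num)
  obtain ⟨f, g, hfg, hfac, hlam, hT⟩ := F.eigenvector_structure hcA hcAs hW hζ0 (by linarith) hcU
    (by positivity) (by
      calc M ^ 32 * (76 * (M ^ 9 * ζ * M)) = 76 * (M ^ 42 * ζ) := by ring
        _ ≤ _ := by linarith) hR
  set ε := M ^ 32 * (76 * (M ^ 9 * ζ * M)) with hε
  have hε' : ε = 76 * (M ^ 42 * ζ) := by rw [hε]; ring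
  have hε0 : 0 ≤ ε := by positivity
  -- With model constant `M^13` and `ε = 76 M^42 ζ`, the smallness condition has exponent `13 · 51 +
  -- 42 = 705` and the error `13 · 38 + 42 = 536`. The eigenvalues of `A` are `ρn` times the
  -- rescaled ones.
  obtain ⟨π, hπ⟩ := recovery hfg hfac hε0 (by
      calc (M ^ 13) ^ 51 * ε = 76 * (M ^ 705 * ζ) := by rw [hε']; ring
        _ ≤ _ := by linarith [hpow 705 le_rfl]) hδ0
    (hδ.trans (by
      calc M * ζ = 1 * (M ^ 1 * ζ) := by ring
        _ ≤ 76 * (M ^ 55 * ζ) := by gcongr <;> first | exact hM1 | norm_num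
        _ = _ := by rw [hε']; ring))
    (lam := lam) hρn (fun k => by
      rw [_root_.Pi.smul_apply, smul_eq_mul, hc, ← mul_assoc, mul_inv_cancel₀ hρn.ne', one_mul])
    hlam hT hI
  refine ⟨π⁻¹, fun i => ?_⟩
  calc ∑ k, |(Pihat - Pi * (π⁻¹).permMatrix ℝ) i k|
      = ∑ k, |zMatrix U lam I i k / ∑ m, |zMatrix U lam I i m| - Pi i (π k)| := by
        refine Finset.sum_congr rfl fun k _ => ?_
        rw [Matrix.sub_apply, mul_permMatrix_inv_apply, hPihat]
    _ ≤ 2556 * (M ^ 13) ^ 38 * ε := hπ i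
    _ = _ := by rw [hε']; ring

/-- The error never exceeds two. -/
theorem scd_error_le_two {A : Matrix (Fin n) (Fin n) ℝ} {Pi Pihat : Matrix (Fin n) (Fin K) ℝ}
    {δ : ℝ} (hPi : ∀ i k, 0 ≤ Pi i k) (hsum : ∀ i, ∑ k, Pi i k = 1) (h : IsScD A δ Pihat)
    (i : Fin n) :
    ∑ k, |(Pihat - Pi * (1 : Equiv.Perm (Fin K)).permMatrix ℝ) i k| ≤ 2 := by
  have h1 := sum_abs_row_le_one_of_isScD h i
  have h2 : ∀ k, |(Pihat - Pi * (1 : Equiv.Perm (Fin K)).permMatrix ℝ) i k| ≤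
      |Pihat i k| + Pi i k := by
    intro k
    rw [Matrix.sub_apply, Matrix.permMatrix_one, Matrix.mul_one]
    refine (abs_sub _ _).trans ?_
    rw [abs_of_nonneg (hPi i k)]
  refine (Finset.sum_le_sum fun k _ => h2 k).trans ?_
  rw [Finset.sum_add_distrib, hsum]
  linarith

end ErrorBound

/-! ### Comparison of the noise scales with the rate, and conclusion. -/

theorem noise_scale {γ ρ N ℓ τ V c ϖ : ℝ} (hγ : 0 ≤ γ) (hρN : 0 < ρ * N) (hℓ : 0 ≤ ℓ) (hc : 0 ≤ c)
    (hV : V = c ^ 2 * γ * ρ) (hϖ : ϖ = Real.sqrt (γ * ℓ) / Real.sqrt (ρ * N))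
    (hτ : τ ^ 2 * ℓ ≤ V * N) :
    Real.sqrt (V * N * ℓ) = c * (ρ * N) * ϖ ∧ τ * ℓ ≤ c * (ρ * N) * ϖ := by
  have hϖ0 : 0 ≤ ϖ := by rw [hϖ]; positivity
  have hϖsq : ϖ ^ 2 * (ρ * N) = γ * ℓ := by
    rw [hϖ, div_pow, Real.sq_sqrt (by positivity), Real.sq_sqrt hρN.le,
      div_mul_cancel₀ _ hρN.ne']
  have hVn : V * N * ℓ = (c * (ρ * N) * ϖ) ^ 2 := by
    calc V * N * ℓ = c ^ 2 * (ρ * N) * (γ * ℓ) := by rw [hV]; ring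
      _ = _ := by rw [← hϖsq]; ring
  have h0 : 0 ≤ c * (ρ * N) * ϖ := by positivity
  refine ⟨by rw [hVn, Real.sqrt_sq h0], (abs_le_of_sq_le_sq' ?_ h0).2⟩
  rw [← hVn]
  calc (τ * ℓ) ^ 2 = τ ^ 2 * ℓ * ℓ := by ring
    _ ≤ V * N * ℓ := by gcongr

theorem weight_mul_weight_le {n : ℕ} {θ : Fin n → ℝ} (hθ : ∀ i, 0 < θ i) {c ρ : ℝ} (hρ : 0 ≤ ρ)
    (hc : 0 ≤ c) (h : ∀ i, θ i ≤ c * Real.sqrt ρ) (i j : Fin n) : θ i * θ j ≤ c ^ 2 * ρ := by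
  calc θ i * θ j ≤ (c * Real.sqrt ρ) * (c * Real.sqrt ρ) :=
        mul_le_mul (h i) (h j) (hθ j).le (by positivity)
    _ = c ^ 2 * (Real.sqrt ρ * Real.sqrt ρ) := by ring
    _ = _ := by rw [Real.mul_self_sqrt hρ]

/-- The error bound with all constants of the model collected into `M`. -/
theorem measure_scd_error_gt_le {n K : ℕ} (hn : 3 ≤ n) {S : Type*} [MeasurableSpace S]
    {μ : Measure S} [IsProbabilityMeasure μ] {Pi : Matrix (Fin n) (Fin K) ℝ}
    {P : Matrix (Fin K) (Fin K) ℝ} {θ : Fin n → ℝ} {A : S → Matrix (Fin n) (Fin n) ℝ}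
    {κ₀ B c₀ c₁ C₁ D τ γ ρ M Q : ℝ} (hc₀ : 0 < c₀) (hc₁ : 0 < c₁) (h : IsDCMMDF μ Pi P θ A)
    (hτ : ∀ i j, ∀ᵐ s ∂μ, |A s i j - meanMatrix Pi P θ i j| ≤ τ)
    (hγ : ∀ i j, variance (fun s => A s i j) μ / (θ i * θ j) ≤ γ)
    (hsparse : τ ^ 2 * Real.log n ≤ γ * (⨆ i, θ i) * ∑ i, |θ i|)
    (hκ : condNumber P ≤ κ₀) (hB : ∀ k l, |P k l| ≤ B)
    (hev : ∀ ν, Module.End.HasEigenvalue (Matrix.toLin' (Pi.transpose * Pi)) ν →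
      c₀ * (n / K) ≤ ν)
    (hρ : 0 < ρ) (hθ : ∀ i, c₁ * Real.sqrt ρ ≤ θ i ∧ θ i ≤ C₁ * Real.sqrt ρ)
    (hM2 : 2 ≤ M) (hMK : (K : ℝ) ≤ M) (hMκ : κ₀ ≤ M) (hMB : B ≤ M) (hMc₀ : K / c₀ ≤ M)
    (hMc₁ : c₁⁻¹ ≤ M) (hMC₁ : C₁ ≤ M) (hMD : D ≤ M) (hQ1 : 1 ≤ Q)
    (hQ : Real.sqrt (64 * Real.exp 9) = Q) :
    μ {s | ¬ ∀ δ, 0 ≤ δ → δ ≤ D * scdRate n P γ ρ →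
        (∃ Pihat : Matrix (Fin n) (Fin K) ℝ, IsScD (A s) δ Pihat) ∧
        ∀ Pihat : Matrix (Fin n) (Fin K) ℝ, IsScD (A s) δ Pihat →
          ∃ σ : Equiv.Perm (Fin K), ∀ i,
            ∑ k, |(Pihat - Pi * σ.permMatrix ℝ) i k| ≤
              608000 * M ^ 708 * Q * scdRate n P γ ρ}
      ≤ ENNReal.ofReal ((1 + 6 * K) / (n : ℝ) ^ 6) := by
  have hM : 0 < M := by linarith
  have hM1 : 1 ≤ M := by linarith
  have hn0 : (0 : ℝ) < n := by exact_mod_cast (by omega : 0 < n)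
  have hlog : 0 < Real.log n := Real.log_pos (by exact_mod_cast (by omega : 1 < n))
  let i₀ : Fin n := ⟨0, by omega⟩
  have : Nonempty (Fin n) := ⟨i₀⟩
  have hK : 0 < K := by
    rcases Nat.eq_zero_or_pos K with rfl | hK
    · have := h.Pi_sum i₀
      simp at this
    · exact hK
  have hKn : K ≤ n := by
    have := Pi.rank_le_height
    rwa [h.rank_Pi] at this
  have F := isFactorModel_of_isDCMMDF h (by omega) hK hκ hB hc₀ hc₁ hev hρ hθ hM2 hMK hMκ hMB
    hMc₀ hMc₁ hMC₁
  have hsρ := Real.sqrt_pos.2 hρ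
  have hC₁ : 0 < C₁ := by
    have := (mul_pos hc₁ hsρ).trans_le ((hθ i₀).1.trans (hθ i₀).2)
    exact pos_of_mul_pos_left this hsρ.le
  have hτ0 : 0 ≤ τ := by
    obtain ⟨s, hs⟩ := (hτ i₀ i₀).exists
    exact (abs_nonneg _).trans hs
  have hγ0 : 0 ≤ γ :=
    le_trans (div_nonneg (variance_nonneg _ _) (mul_pos (h.θ_pos i₀) (h.θ_pos i₀)).le) (hγ i₀ i₀)
  -- A uniform bound for the entry variances, since `θ i * θ j ≤ C₁² ρ`.
  obtain ⟨V, hVdef⟩ : ∃ V, V = C₁ ^ 2 * γ * ρ := ⟨_, rfl⟩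
  have hV0 : 0 ≤ V := by rw [hVdef]; positivity
  have hθθ := weight_mul_weight_le h.θ_pos hρ.le hC₁.le fun i => (hθ i).2
  have hτV : τ ^ 2 * Real.log n ≤ V * n := by
    refine hsparse.trans ?_
    have h1 : ⨆ i, θ i ≤ C₁ * Real.sqrt ρ := ciSup_le fun i => (hθ i).2
    have h2 : ∑ i, |θ i| ≤ n * (C₁ * Real.sqrt ρ) := by
      calc ∑ i, |θ i| ≤ ∑ _i : Fin n, C₁ * Real.sqrt ρ := Finset.sum_le_sum fun i _ => by
            rw [abs_of_pos (h.θ_pos i)]; exact (hθ i).2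
        _ = _ := by simp
    calc γ * (⨆ i, θ i) * ∑ i, |θ i| ≤ γ * (C₁ * Real.sqrt ρ) * (n * (C₁ * Real.sqrt ρ)) := by
          gcongr
      _ = C₁ ^ 2 * γ * (Real.sqrt ρ * Real.sqrt ρ) * n := by ring
      _ = _ := by rw [Real.mul_self_sqrt hρ.le, hVdef]
  obtain ⟨X, hXm, hXi, hXb, hX0, hXv, hXA⟩ := h.exists_truncation hτ hτ0
  have hXV : ∀ e, ∫ s, X e s ^ 2 ∂μ ≤ V := by
    intro e
    rw [hXv]
    have h1 := hγ e.1.1 e.1.2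
    rw [div_le_iff₀ (mul_pos (h.θ_pos _) (h.θ_pos _))] at h1
    refine h1.trans ?_
    calc γ * (θ e.1.1 * θ e.1.2) ≤ γ * (C₁ ^ 2 * ρ) := by exact mul_le_mul_of_nonneg_left (hθθ _ _) hγ0
      _ = _ := by rw [hVdef]; ring
  have hρn : 0 < ρ * n := by positivity
  obtain ⟨r, hr⟩ : ∃ r, r = scdRate n P γ ρ := ⟨_, rfl⟩
  rw [← hr]
  -- The rate without `sval P K`; as that singular value lies between `M⁻¹` and `M²`, the two are
  -- comparable.
  obtain ⟨ϖ, hϖ⟩ : ∃ ϖ, ϖ = Real.sqrt (γ * Real.log n) / Real.sqrt (ρ * n) := ⟨_, rfl⟩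
  have hϖ0 : 0 ≤ ϖ := by rw [hϖ]; positivity
  have hσ0 := sval_pos_of_rank_eq hK h.rank_P
  have hrϖ : ϖ = sval P K * r := by
    rw [hr, scdRate, hϖ]
    field_simp
  have hr0 : 0 ≤ r := by rw [hr, scdRate]; positivity
  have hσM : sval P K ≤ M ^ 2 := by
    refine (sval_le hK hB).trans ?_
    have h1 : Real.sqrt K ≤ M := by
      rw [Real.sqrt_le_iff]
      exact ⟨hM.le, by nlinarith⟩
    have h2 : 0 ≤ B := (abs_nonneg _).trans (hB ⟨0, hK⟩ ⟨0, hK⟩)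
    calc Real.sqrt K * B ≤ M * M := by gcongr
      _ = _ := by ring
  have hϖr : ϖ ≤ M ^ 2 * r := by rw [hrϖ]; gcongr
  have hrMϖ : r ≤ M * ϖ := by
    have h1 := one_le_mul_sval hK h.rank_P h.P_diag hκ
    calc r = 1 * r := (one_mul r).symm
      _ ≤ (M * sval P K) * r := by
          gcongr
          exact h1.trans (by gcongr)
      _ = _ := by rw [hrϖ]; ring
  -- Multiplied by `ρn`, this dominates the spectral norm bound and both scales in Bernstein's
  -- inequality.
  obtain ⟨ζ, hζ⟩ : ∃ ζ, ζ = Q * M * ϖ := ⟨_, rfl⟩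
  have hζ0 : 0 ≤ ζ := by rw [hζ]; positivity
  obtain ⟨hL, hτL⟩ := noise_scale hγ0 hρn hlog.le hC₁.le hVdef hϖ hτV
  have hLζ : C₁ * (ρ * n) * ϖ ≤ ρ * n * (M * ϖ) := by
    calc C₁ * (ρ * n) * ϖ ≤ M * (ρ * n) * ϖ := by gcongr
      _ = _ := by ring
  have hMϖζ : M * ϖ ≤ ζ := by
    calc M * ϖ = 1 * (M * ϖ) := (one_mul _).symm
      _ ≤ Q * (M * ϖ) := by gcongr
      _ = _ := by rw [hζ]; ring
  have hbζ : Real.sqrt (64 * Real.exp 9 * (V * n * Real.log n)) ≤ ρ * n * ζ := by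
    rw [Real.sqrt_mul (by positivity), hL, hQ]
    calc Q * (C₁ * (ρ * n) * ϖ) ≤ Q * (ρ * n * (M * ϖ)) := by gcongr
      _ = _ := by rw [hζ]; ring
  have hVζ : Real.sqrt (V * Real.log n * n) ≤ ρ * n * ζ := by
    have e : V * Real.log n * n = V * n * Real.log n := by ring
    rw [e, hL]
    exact hLζ.trans (by gcongr)
  have hτζ : τ * Real.log n ≤ ρ * n * ζ := hτL.trans (hLζ.trans (by gcongr))
  have hgood := measure_not_isTame_le hn hXm hXi hτ0 hV0 hXb hX0 hXV hτV (M ^ 9 / (ρ * n))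
    (fun (l : Fin K) i => (Matrix.diagonal (fun i => θ i / Real.sqrt ρ) * Pi) i l)
  refine le_trans ?_ hgood
  refine measure_mono_ae ?_
  filter_upwards [hXA] with s hs hbad htame
  refine hbad fun δ hδ0 hδ => ⟨exists_isScD (by omega) hK hKn (h.A_symm s) hδ0, fun Pihat hP => ?_⟩
  -- If the noise is too large for the perturbation argument, the right side exceeds two and the
  -- trivial bound with the identity permutation suffices.
  rcases le_or_gt (304000 * M ^ 705 * ζ) 1 with hsmall | hlarge
  · obtain ⟨σ, hσ⟩ := scd_error_le_of_isTame hρ F (Real.sqrt_nonneg _) hV0 hτ0 hlog.le htame hbζ hVζ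
      hτζ hζ0 hsmall hs hδ0 (hδ.trans (by
        calc D * r ≤ M * (M * ϖ) := by gcongr
          _ ≤ M * ζ := by gcongr)) hP
    refine ⟨σ, fun i => (hσ i).trans ?_⟩
    calc 194256 * M ^ 536 * ζ ≤ 194256 * M ^ 536 * (Q * M * (M ^ 2 * r)) := by rw [hζ]; gcongr
      _ = 194256 * M ^ 539 * Q * r := by ring
      _ ≤ 608000 * M ^ 708 * Q * r := by gcongr <;> first | exact hM1 | norm_num
  · refine ⟨1, fun i => (scd_error_le_two h.Pi_nonneg h.Pi_sum hP i).trans ?_⟩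
    have h1 : 304000 * M ^ 705 * ζ ≤ 304000 * M ^ 705 * (Q * M * (M ^ 2 * r)) := by
      rw [hζ]; gcongr
    calc (2 : ℝ) ≤ 2 * (304000 * M ^ 705 * (Q * M * (M ^ 2 * r))) := by linarith
      _ = _ := by ring

theorem theorem1 (K₀ : ℕ) (κ₀ B c₀ c₁ C₁ D : ℝ) (hc₀ : 0 < c₀) (hc₁ : 0 < c₁)
    (hD : 0 ≤ D) :
    ∃ (C : ℝ) (ε : ℕ → ℝ),
      ε =o[Filter.atTop] (fun n : ℕ => ((n : ℝ) ^ 5)⁻¹) ∧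
      ∀ (n K : ℕ) (S : Type*) [MeasurableSpace S] (μ : Measure S) [IsProbabilityMeasure μ]
        (Pi : Matrix (Fin n) (Fin K) ℝ) (P : Matrix (Fin K) (Fin K) ℝ) (θ : Fin n → ℝ)
        (A : S → Matrix (Fin n) (Fin n) ℝ) (τ γ ρ : ℝ),
        IsDCMMDF μ Pi P θ A →
        -- boundedness and variance
        (∀ i j, ∀ᵐ s ∂μ, |A s i j - meanMatrix Pi P θ i j| ≤ τ) →
        (∀ i j, variance (fun s => A s i j) μ / (θ i * θ j) ≤ γ) →
        -- sparsity
        τ ^ 2 * Real.log n ≤ γ * (⨆ i, θ i) * ∑ i, |θ i| →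
        -- orders of magnitude
        K ≤ K₀ → condNumber P ≤ κ₀ → (∀ k l, |P k l| ≤ B) →
        (∀ ν, Module.End.HasEigenvalue (Matrix.toLin' (Pi.transpose * Pi)) ν → c₀ * (n / K) ≤ ν) →
        0 < ρ → (∀ i, c₁ * Real.sqrt ρ ≤ θ i ∧ θ i ≤ C₁ * Real.sqrt ρ) →
        μ {s | ¬ ∀ δ, 0 ≤ δ → δ ≤ D * scdRate n P γ ρ →
            (∃ Pihat : Matrix (Fin n) (Fin K) ℝ, IsScD (A s) δ Pihat) ∧
            ∀ Pihat : Matrix (Fin n) (Fin K) ℝ, IsScD (A s) δ Pihat →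
              ∃ σ : Equiv.Perm (Fin K), ∀ i,
                ∑ k, |(Pihat - Pi * σ.permMatrix ℝ) i k| ≤ C * scdRate n P γ ρ}
          ≤ ENNReal.ofReal (ε n) := by
  obtain ⟨M, hMdef⟩ : ∃ M : ℝ, M = 2 + K₀ + |κ₀| + |B| + c₁⁻¹ + |C₁| + K₀ / c₀ + D := ⟨_, rfl⟩
  obtain ⟨Q, hQ⟩ : ∃ Q : ℝ, Q = Real.sqrt (64 * Real.exp 9) := ⟨_, rfl⟩
  have hQ1 : 1 ≤ Q := by
    rw [hQ, Real.one_le_sqrt]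
    linarith [Real.add_one_le_exp 9]
  have hK₀0 : (0 : ℝ) ≤ K₀ := K₀.cast_nonneg
  have hKc : 0 ≤ (K₀ : ℝ) / c₀ := by positivity
  have hci : 0 < c₁⁻¹ := inv_pos.2 hc₁
  have hκa := abs_nonneg κ₀
  have hBa := abs_nonneg B
  have hCa := abs_nonneg C₁
  have hM2 : 2 ≤ M := by rw [hMdef]; linarith
  -- The probability bound is used for `n ≥ 3` only; smaller `n` get the trivial bound `1`, which
  -- does not affect the asymptotics.
  refine ⟨608000 * M ^ 708 * Q, fun n => if n < 3 then 1 else (1 + 6 * K₀) / (n : ℝ) ^ 6, ?_, ?_⟩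
  · have h1 : (fun n : ℕ => (1 + 6 * K₀) / (n : ℝ) ^ 6) =o[Filter.atTop]
        fun n : ℕ => ((n : ℝ) ^ 5)⁻¹ := by
      refine Asymptotics.isLittleO_of_tendsto' ?_ ?_
      · filter_upwards [Filter.eventually_gt_atTop 0] with n hn h0
        have : (0 : ℝ) < n := Nat.cast_pos.2 hn
        exact absurd h0 (by positivity)
      · have h2 : Filter.Tendsto (fun n : ℕ => (1 + 6 * (K₀ : ℝ)) / (n : ℝ)) Filter.atTop
            (nhds 0) := tendsto_const_div_atTop_nhds_zero_nat _
        refine h2.congr' ?_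
        filter_upwards [Filter.eventually_gt_atTop 0] with n hn
        have : (0 : ℝ) < n := Nat.cast_pos.2 hn
        field_simp
    refine h1.congr' ?_ Filter.EventuallyEq.rfl
    filter_upwards [Filter.eventually_ge_atTop 3] with n hn
    rw [if_neg (by omega)]
  intro n K S _ μ _ Pi P θ A τ γ ρ h hτ hγ hsparse hKK₀ hκ hB hev hρ hθ
  by_cases hn3 : n < 3
  · simp only [if_pos hn3, ENNReal.ofReal_one]
    exact prob_le_one
  simp only [if_neg hn3]
  have hKR : (K : ℝ) ≤ K₀ := by exact_mod_cast hKK₀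
  have hKc' : (K : ℝ) / c₀ ≤ K₀ / c₀ := by gcongr
  refine (measure_scd_error_gt_le (M := M) (not_lt.1 hn3) hc₀ hc₁ h hτ hγ hsparse hκ hB hev hρ hθ
    hM2 ?_ ?_ ?_ ?_ ?_ ?_ ?_ hQ1 hQ.symm).trans (ENNReal.ofReal_le_ofReal (by gcongr))
  · linarith
  · linarith [le_abs_self κ₀]
  · linarith [le_abs_self B]
  · linarith
  · linarith
  · linarith [le_abs_self C₁]
  · linarith
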